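/- **Setting.** $G=(V,E)$ is a simple undirected graph with $|V|=n$, $|E|=m$ and no isolated vertices. For $u\in V$ let $p^k_u$ be the distribution of the $k$-step simple random walk started at $u$, and let $\mathrm{rp}(G)=\frac1n\sum_{u\in V}p^k_u(u)$ be the average $k$-step return probability. The edges of $G$ arrive one by one in a uniformly random order; the algorithm makes one pass and knows $V$, $m$, $k$, $\varepsilon$. Space is the number of words kept in memory between arrivals, a word being a natural number below $n^2$. **The algorithm $\mathrm{ApproxRP}(k,\varepsilon)$**, with constants $C,D>0$. Put $\eta=\varepsilon^8 2^{-Ck}$, $b=\lceil D/\varepsilon^2\rceil$, $s=\lceil 100\,b\,\eta^{-k}k!\rceil$. Regard the order of the stream as the increasing order of independent uniform timestamps $t_e\in[0,1]$, $e\in E$; the algorithm generates what it needs of these timestamps itself, namely the numbers of edges in the blocks $B_j=\{e: t_e\in[\eta(j-1),\eta j)\}$, $1\le j\le k$. Run $s$ walks in parallel on the stream, each with an independent uniform start vertex $u_0\in V$ and an independent uniform template $\pi\in[1]\times[2]\times\dots\times[k]$. For $j=1,\dots,k$: if $\pi_j=j$, choose $f_j$ by reservoir sampling uniformly from the set $H_j$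 of the edges of $B_j$ at $u_{j-1}$ (FAIL if $H_j=\emptyset$) and put $\gamma_j=\eta/|H_j|$; if $\pi_j<j$, put $f_j=f_{\pi_j}$ and $\gamma_j=1$ (FAIL if this edge is not incident to $u_{j-1}$, or if $\pi_{\pi_j}\ne\pi_j$, that is, unless $\pi_j$ is the first step that uses the edge $f_j$); let $u_j$ be the other endpoint of $f_j$. Let $\hat d_{j-1}$ be the degree of $u_{j-1}$ in $\{f_1,\dots,f_k\}\cup\{e:t_e\ge\eta k\}$. Accept the walk $(u_0,\dots,u_k)$ with probability $\prod_{j=1}^k\min\bigl(\frac{\eta}{\gamma_j\hat d_{j-1}},1\bigr)$, otherwise FAIL. If fewer than $b$ of the $s$ walks are accepted, output FAIL; otherwise output the fraction of walks with $u_k=u_0$ among the first $b$ accepted ones. **Statement.** For all sufficiently large constants $C$ and $D$ there are constants $c'>0$ and $A$ (depending only on $C$ and $D$) such that for every such graph $G$, every $\varepsilon\in(n^{-1/1000},1/2)$ and every integer $k$ with $$1\le k\le\min\Bigl\{\frac{c'\log n}{\log(1/\varepsilon)},\sqrt{c'\log n}\Bigr\}$$ the following holds. With probability at least $9/10$ over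 the order of the stream and the internal randomness, $\mathrm{ApproxRP}(k,\varepsilon)$ outputs a number $\widehat{\mathrm{rp}}$ (not FAIL) with $|\mathrm{rp}(G)-\widehat{\mathrm{rp}}|\le\varepsilon$. On every order of the edges and for every outcome of the internal randomness it uses at most $(1/\varepsilon)^{Ak}\cdot2^{Ak^2}$ words of space, that is, $(1/\varepsilon)^{O(k)}\cdot2^{O(k^2)}$. -/

import Mathlib

open scoped NNReal ENNReal Nat

noncomputable section

namespace RandomWalkStream

/-! ### Random walks and the average return probability -/

/-- `walkProb G k u v` is the probability that the simple random walk of `k` steps started at `u`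
ends at `v`: in every step the walk moves to a uniformly random neighbour. -/
def walkProb {n : ℕ} (G : SimpleGraph (Fin n)) [DecidableRel G.Adj] :
    ℕ → Fin n → Fin n → ℝ
  | 0, u, v => if v = u then 1 else 0
  | k + 1, u, v => ∑ w ∈ G.neighborFinset v, walkProb G k u w * (1 / (G.degree w : ℝ))

/-- The average `k`-step return probability of `G`. -/
def returnProb {n : ℕ} (G : SimpleGraph (Fin n)) [DecidableRel G.Adj] (k : ℕ) : ℝ :=
  (1 / (n : ℝ)) * ∑ u, walkProb G k u u

/-! ### One-pass streaming algorithms and random-order streams -/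

/-- A randomized one-pass streaming algorithm with stream items in `Item` and outputs in `Out`.
The contents of the memory between two arrivals are a `State`, which is stored as the list of
words `words`; this encoding loses nothing. -/
structure StreamAlg (Item Out : Type) where
  State : Type
  start : PMF State
  step : State → Item → PMF State
  finish : State → PMF Out
  words : State → List ℕ
  words_injective : Function.Injective words

namespace StreamAlg

variable {Item Out Out' : Type}

/-- The distribution of the state after the items of a list have arrived. -/
def after (A : StreamAlg Item Out) (σ : List Item) : PMF A.State :=
  σ.foldl (fun p e => p.bind fun x => A.step x e) A.start

/-- The distribution of the output on a given stream. -/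
def run (A : StreamAlg Item Out) (σ : List Item) : PMF Out :=
  (A.after σ).bind A.finish

/-- On the stream `σ`, at every point in time and for all outcomes of the internal randomness,
the memory holds at most `S` words, each of which is a natural number below `W`. -/
def SpaceAtMost (A : StreamAlg Item Out) (σ : List Item) (S : ℝ) (W : ℕ) : Prop :=
  ∀ τ, τ <+: σ → ∀ x ∈ (A.after τ).support,
    ((A.words x).length : ℝ) ≤ S ∧ ∀ w ∈ A.words x, w < W

/-- Post-processing of the output. -/
def mapOut (A : StreamAlg Item Out) (g : Out → Out') : StreamAlg Item Out' where
  State := A.State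
  start := A.start
  step := A.step
  finish x := (A.finish x).map g
  words := A.words
  words_injective := A.words_injective

end StreamAlg

instance edgeOrder_nonempty {n : ℕ} (G : SimpleGraph (Fin n)) [DecidableRel G.Adj] :
    Nonempty (Fin G.edgeFinset.card ≃ G.edgeFinset) :=
  ⟨G.edgeFinset.equivFin.symm⟩

/-- The edges of `G` in a uniformly random order. -/
def randomStream {n : ℕ} (G : SimpleGraph (Fin n)) [DecidableRel G.Adj] :
    PMF (List (Sym2 (Fin n))) :=
  (PMF.uniformOfFintype (Fin G.edgeFinset.card ≃ G.edgeFinset)).map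
    fun o => List.ofFn fun i => (o i : Sym2 (Fin n))

/-! ### Sampling primitives -/

/-- A coin that shows `true` with probability `p`. -/
def coin (p : ℝ≥0) (h : p ≤ 1) : PMF Bool :=
  PMF.ofFintype (fun b => cond b (p : ℝ≥0∞) ((1 - p : ℝ≥0) : ℝ≥0∞)) (by
    simp only [Fintype.univ_bool, Finset.mem_singleton, Bool.true_eq_false, not_false_eq_true,
      Finset.sum_insert, cond_true, Finset.sum_singleton, cond_false]
    rw [← ENNReal.coe_add, add_tsub_cancel_of_le h, ENNReal.coe_one])

/-- Independent samples, the `i`-th one from `p i`. -/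
def indep {α : Type} : {s : ℕ} → (Fin s → PMF α) → PMF (Fin s → α)
  | 0, _ => PMF.pure Fin.elim0
  | _ + 1, p => (p 0).bind fun a => (indep fun i => p i.succ).map (Fin.cons a)

theorem measurable_block (η : ℝ) : Measurable fun t : unitInterval => ⌊(t : ℝ) / η⌋₊ :=
  Nat.measurable_floor.comp (measurable_subtype_coe.div_const η)

/-- The block of a uniformly random timestamp `t ∈ [0, 1]`: block `j` is the set of all `t` in
`[j * η, (j + 1) * η)`. -/
def timestampBlock (η : ℝ) : PMF ℕ :=
  haveI : MeasureTheory.IsProbabilityMeasure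
      (MeasureTheory.Measure.map (fun t : unitInterval => ⌊(t : ℝ) / η⌋₊)
        MeasureTheory.MeasureSpace.volume) :=
    MeasureTheory.Measure.isProbabilityMeasure_map (measurable_block η).aemeasurable
  (MeasureTheory.Measure.map (fun t : unitInterval => ⌊(t : ℝ) / η⌋₊)
    MeasureTheory.MeasureSpace.volume).toPMF

/-- Draw `m` independent uniform timestamps in `[0, 1]` and keep only, for every `j < k`, the
number of those that lie in block `j`. -/
def blockSizes (k : ℕ) (η : ℝ) : ℕ → PMF (Fin k → ℕ)
  | 0 => PMF.pure fun _ => 0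
  | m + 1 => (blockSizes k η m).bind fun c => (timestampBlock η).map fun i =>
      fun j : Fin k => if (j : ℕ) = i then c j + 1 else c j

/-! ### Walk templates and the memory of a single walk -/

/-- Walk templates of length `k` (0-based): the `j`-th entry is at most `j`. -/
abbrev Template (k : ℕ) : Type := (j : Fin k) → Fin ((j : ℕ) + 1)

namespace Template

variable {k : ℕ}

/-- An entry of the template as a step of the walk. -/
def idx (π : Template k) (j : Fin k) : Fin k := ⟨π j, lt_of_lt_of_le (π j).2 j.2⟩

end Template

/-- The memory used for one walk: the start vertex, the template, and for every step `j` the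
reservoir (a uniform sample from the edges of `H_j` seen so far), the size of `H_j` so far, and
the number of edges at the `j`-th vertex of the walk seen so far in the tail of the stream. -/
@[ext]
structure Walker (n k : ℕ) where
  root : Fin n
  tmpl : Template k
  res : Fin k → Option (Sym2 (Fin n))
  cnt : Fin k → ℕ
  tail : Fin k → ℕ

namespace Walker

variable {n k : ℕ}

/-- The edge of step `j`: the new edge sampled in block `j` if `π_j = j`, and otherwise the new
edge of the earlier step `π_j`. A template with `π_{π_j} ≠ π_j` is one to which no walk conforms
(`π_j` has to be the first time at which the edge of step `j` is used), so the walk fails. -/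
def edge (w : Walker n k) (j : Fin k) : Option (Sym2 (Fin n)) :=
  if w.tmpl.idx (w.tmpl.idx j) = w.tmpl.idx j then w.res (w.tmpl.idx j) else none

/-- The `j`-th vertex of the walk; `none` means that the walk has failed (no new edge, or the
prescribed old edge is not incident to the current vertex). -/
def vertex (w : Walker n k) : ℕ → Option (Fin n)
  | 0 => some w.root
  | j + 1 =>
    if hj : j < k then
      (w.vertex j).bind fun u => (w.edge ⟨j, hj⟩).bind fun e =>
        open Classical in if hu : u ∈ e then some (Sym2.Mem.other hu) else none
    else none

/-- The edge `e` is incident to the `j`-th vertex of the walk. -/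
def Touches (w : Walker n k) (j : ℕ) (e : Sym2 (Fin n)) : Prop :=
  ∃ u, w.vertex j = some u ∧ u ∈ e

open Classical in
/-- Arrival of the edge `e` in block `j`: if step `j` takes a new edge, one step of reservoir
sampling from the edges of block `j` at the current vertex. -/
def stepBlock (w : Walker n k) (j : Fin k) (e : Sym2 (Fin n)) : PMF (Walker n k) :=
  if w.tmpl.idx j = j ∧ w.Touches j e then
    (PMF.uniformOfFintype (Fin (w.cnt j + 1))).map fun i =>
      { w with
        res := if i = 0 then Function.update w.res j (some e) else w.res
        cnt := Function.update w.cnt j (w.cnt j + 1) }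
  else PMF.pure w

open Classical in
/-- Arrival of the edge `e` after the last block: it is counted at the vertices of the walk. -/
def stepTail (w : Walker n k) (e : Sym2 (Fin n)) : Walker n k :=
  { w with tail := fun j => if w.Touches j e then w.tail j + 1 else w.tail j }

open Classical in
/-- The degree estimate for the `j`-th vertex `u` of the walk: the degree of `u` in the set of the
edges of the walk and the edges in the tail of the stream (the two sets are disjoint). -/
def degEst (w : Walker n k) (j : Fin k) : ℕ :=
  (Finset.univ.filter fun e : Sym2 (Fin n) =>
    w.Touches j e ∧ ∃ i : Fin k, w.edge i = some e).card + w.tail j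

/-- `γ_j = η / |H_j|` if step `j` takes a new edge, and `γ_j = 1` otherwise. -/
def gamma (w : Walker n k) (η : ℝ) (j : Fin k) : ℝ :=
  if w.tmpl.idx j = j then 1 / (w.cnt j : ℝ) * η else 1

/-- The acceptance probability `∏ j, min (η / (γ_j d_j), 1)` of rejection sampling. -/
def acceptProb (w : Walker n k) (η : ℝ) : ℝ≥0 :=
  ∏ j : Fin k, min (Real.toNNReal (η / (w.gamma η j * (w.degEst j : ℝ)))) 1

theorem acceptProb_le_one (w : Walker n k) (η : ℝ) : w.acceptProb η ≤ 1 :=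
  Finset.prod_le_one' fun _ _ => min_le_right _ _

/-- The vertices of the candidate walk, if it has not failed. -/
def walk (w : Walker n k) : Option (Fin (k + 1) → Fin n) :=
  if h : ∀ j : Fin (k + 1), (w.vertex j).isSome then some fun j => (w.vertex j).get (h j)
  else none

/-- Rejection sampling; `none` is FAIL. -/
def finish (w : Walker n k) (η : ℝ) : PMF (Option (Fin (k + 1) → Fin n)) :=
  (coin (w.acceptProb η) (w.acceptProb_le_one η)).map fun accept =>
    if accept then w.walk else none

/-- A stored edge as two words; `0, 0` stands for "no edge". -/
def edgeWords : Option (Sym2 (Fin n)) → ℕ × ℕ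
  | none => (0, 0)
  | some e => ((e.inf : ℕ) + 1, (e.sup : ℕ) + 1)

/-- The words in which the memory of a walk is stored. -/
def words (w : Walker n k) : List ℕ :=
  (w.root : ℕ) :: (List.ofFn fun j : Fin k =>
    [(w.tmpl j : ℕ), (edgeWords (w.res j)).1, (edgeWords (w.res j)).2, w.cnt j, w.tail j]).flatten

theorem edgeWords_injective : Function.Injective (edgeWords (n := n)) := by
  intro a b h
  cases a with
  | none =>
    cases b with
    | none => rfl
    | some e => simp [edgeWords] at h
  | some d =>
    cases b with
    | none => simp [edgeWords] at h
    | some e =>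
      simp only [edgeWords, Prod.mk.injEq, add_left_inj] at h
      exact congrArg some (Sym2.inf_eq_inf_and_sup_eq_sup.1
        ⟨Fin.ext h.1, Fin.ext h.2⟩)

theorem words_length (w : Walker n k) : w.words.length = 1 + 5 * k := by
  simp [words, List.length_flatten, List.map_ofFn, Function.comp_def]
  ring

theorem words_injective : Function.Injective (words (n := n) (k := k)) := by
  intro v w h
  simp only [words, List.cons.injEq] at h
  obtain ⟨h1, h2⟩ := h
  have h3 := List.ofFn_injective (List.eq_iff_flatten_eq.2
    ⟨h2, by simp [List.map_ofFn, Function.comp_def]⟩)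
  have h4 := fun j => congrFun h3 j
  simp only [List.cons.injEq, and_true] at h4
  refine Walker.ext (Fin.ext h1) (funext fun j => Fin.ext (h4 j).1) (funext fun j => ?_)
    (funext fun j => (h4 j).2.2.2.1) (funext fun j => (h4 j).2.2.2.2)
  exact edgeWords_injective (Prod.ext (h4 j).2.1 (h4 j).2.2.1)

end Walker

/-! ### The algorithms -/

/-- The fraction `η = ε ^ 8 * 2 ^ (-C k)` of the stream that is used for one step. -/
def stepFraction (C ε : ℝ) (k : ℕ) : ℝ := ε ^ 8 * (2 : ℝ) ^ (-(C * k))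

/-- The number `s = b * 100 * η ^ (-k) * k!` of walks that are started, rounded up. -/
def numStarts (C ε : ℝ) (k b : ℕ) : ℕ :=
  ⌈(b : ℝ) * 100 * (stepFraction C ε k ^ k)⁻¹ * (k ! : ℝ)⌉₊

/-- The memory of the algorithm: for every block the number of its edges that have not yet
arrived, and the memory of each of the `s` walks. -/
@[ext]
structure Memory (n k s : ℕ) where
  left : Fin k → ℕ
  walkers : Fin s → Walker n k

namespace Memory

variable {n k s : ℕ}

/-- The block of the next edge; `none` means that all blocks are complete. -/
def block (x : Memory n k s) : Option (Fin k) :=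
  (List.finRange k).find? fun j => decide (x.left j ≠ 0)

/-- The words in which the memory is stored. -/
def words (x : Memory n k s) : List ℕ :=
  List.ofFn x.left ++ (List.ofFn fun i => (x.walkers i).words).flatten

theorem words_injective : Function.Injective (words (n := n) (k := k) (s := s)) := by
  intro x y h
  obtain ⟨h1, h2⟩ := List.append_inj h (by simp)
  have h3 := List.ofFn_injective (List.eq_iff_flatten_eq.2
    ⟨h2, by simp [List.map_ofFn, Function.comp_def, Walker.words_length]⟩)
  exact Memory.ext (List.ofFn_injective h1)
    (funext fun i => Walker.words_injective (congrFun h3 i))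

/-- The start: the sizes of the blocks (the first `k` intervals of length `η` of independent
uniform timestamps of the `m` edges), and independent uniform start vertices and templates. -/
def start (n k s : ℕ) [NeZero n] (m : ℕ) (η : ℝ) : PMF (Memory n k s) :=
  (blockSizes k η m).bind fun c =>
    (indep fun _ : Fin s =>
      (PMF.uniformOfFintype (Fin n)).bind fun u =>
        (PMF.uniformOfFintype (Template k)).map fun π =>
          (⟨u, π, fun _ => none, fun _ => 0, fun _ => 0⟩ : Walker n k)).map fun ws => ⟨c, ws⟩

/-- Arrival of an edge: all walks process it, with independent randomness. -/
def step (x : Memory n k s) (e : Sym2 (Fin n)) : PMF (Memory n k s) :=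
  match x.block with
  | some j => (indep fun i => (x.walkers i).stepBlock j e).map fun ws =>
      ⟨Function.update x.left j (x.left j - 1), ws⟩
  | none => PMF.pure ⟨x.left, fun i => (x.walkers i).stepTail e⟩

end Memory

/-- `simulateWalks n m k ε C b`, for graphs with `n` vertices and `m` edges: `s` walks are run in
parallel, and the first `b` successful ones are returned; `none` is FAIL. -/
def simulateWalks (n m k : ℕ) [NeZero n] (ε C : ℝ) (b : ℕ) :
    StreamAlg (Sym2 (Fin n)) (Option (List (Fin (k + 1) → Fin n))) where
  State := Memory n k (numStarts C ε k b)
  start := Memory.start n k _ m (stepFraction C ε k)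
  step := Memory.step
  finish x := (indep fun i => (x.walkers i).finish (stepFraction C ε k)).map fun v =>
    if b ≤ (List.ofFn v).reduceOption.length then some ((List.ofFn v).reduceOption.take b)
    else none
  words := Memory.words
  words_injective := Memory.words_injective

/-- The number `b = D / ε ^ 2` of walks that are averaged, rounded up. -/
def numWalks (D ε : ℝ) : ℕ := ⌈D / ε ^ 2⌉₊

/-- `approxRP n m k ε C D`, for graphs with `n` vertices and `m` edges: the fraction of closed
walks among `b` simulated walks; `none` is FAIL. -/
def approxRP (n m k : ℕ) [NeZero n] (ε C D : ℝ) : StreamAlg (Sym2 (Fin n)) (Option ℝ) :=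
  (simulateWalks n m k ε C (numWalks D ε)).mapOut fun r => r.map fun ws =>
    (1 / (numWalks D ε : ℝ)) * ((ws.countP fun v => decide (v (Fin.last k) = v 0) : ℕ) : ℝ)

end RandomWalkStream

end

/-! Random timestamps give the edges independent labels: each of the k blocks with probability η,
the tail with probability 1 - kη (`expect_stream_le`). Given the labels, the s walkers are
independent and identically distributed, and a walker outputs a given walk v with an explicit
probability, `walkMass` (`walkDist_apply_some`). It is positive only if every edge of v lies in the
block of its first use, and then exactly one of the k! templates can produce v. As long as no
minimum in the acceptance probability is attained by 1, a new step contributes 1/|H| · |H|/d̂ = 1/d̂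
and an old step η/d̂, where d̂ is the degree estimate.

A walk with q distinct edges has fitting labels with probability η^q, and its k - q old steps
contribute η^(k - q). Hence repeated edges are neither favoured nor penalised, and since d̂ is close
to the degree, the expected mass of v is close to μ = η^k / k! times its probability under the
random walk.

The mass of a set of walks is concentrated around μ times its probability (`labelExpect_sq_le`).
This needs a lower bound for the first moment (`labelExpect_walkMass_ge`) and an upper bound for the
second (`labelExpect_pair_le`). Two walks that share neither an edge nor a vertex of degree below
1/η are almost uncorrelated. For other pairs the correlation can grow by a factor of about (k +
1)^(2k) η^(-k), but such pairs are rare: the degree measure is stationary and dominates the uniform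
start, so their total weight is of order k²/(ηn) (`sum_interfere_le`). The upper bound on k makes n
large enough to win.

Applied to all walks and to the closed walks, this shows that, outside a small probability, the
acceptance probability P and the probability Q of an accepted closed walk are so close to μ and μ ·
rp that Q/P is within ε/2 of rp. Given the labels, s independent walkers then yield b acceptances,
and the closed fraction of the first b has the right mean and variance of order 1/b
(`sampleExpect_bad_le`). The label randomness and the sampling each cost failure probability 1/20
(`success_of_variance_le`). The space is the number of walkers times O(k) words. -/

namespace RandomWalkStream

/-! ### Expectations of nonnegative functions -/

/-- The expectation of a nonnegative function under a probability mass function. -/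
noncomputable def expect {α : Type} (p : PMF α) (f : α → ℝ≥0∞) : ℝ≥0∞ := ∑' a, p a * f a

section Expect

variable {α β : Type}

theorem expect_pure (a : α) (f : α → ℝ≥0∞) : expect (PMF.pure a) f = f a := by
  rw [expect, tsum_eq_single a]
  · simp
  · intro b hb
    simp [PMF.pure_apply, hb]

theorem expect_bind (p : PMF α) (q : α → PMF β) (f : β → ℝ≥0∞) :
    expect (p.bind q) f = expect p fun a => expect (q a) f := by
  simp only [expect, PMF.bind_apply, ← ENNReal.tsum_mul_right, ← ENNReal.tsum_mul_left]
  rw [ENNReal.tsum_comm]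
  simp only [mul_assoc]

theorem expect_map (p : PMF α) (g : α → β) (f : β → ℝ≥0∞) :
    expect (p.map g) f = expect p (f ∘ g) := by
  rw [PMF.map, expect_bind]
  exact congrArg _ (funext fun a => expect_pure _ _)

theorem expect_congr {p : PMF α} {f g : α → ℝ≥0∞} (h : ∀ a ∈ p.support, f a = g a) :
    expect p f = expect p g := by
  refine tsum_congr fun a => ?_
  by_cases ha : p a = 0
  · simp [ha]
  · rw [h a ha]

theorem expect_mono {p : PMF α} {f g : α → ℝ≥0∞} (h : ∀ a, f a ≤ g a) :
    expect p f ≤ expect p g :=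
  ENNReal.tsum_le_tsum fun a => mul_le_mul_right (h a) _

theorem expect_const (p : PMF α) (c : ℝ≥0∞) : expect p (fun _ => c) = c := by
  rw [expect, ENNReal.tsum_mul_right, p.tsum_coe, one_mul]

theorem expect_add (p : PMF α) (f g : α → ℝ≥0∞) :
    expect p (fun a => f a + g a) = expect p f + expect p g := by
  simp only [expect, mul_add]
  exact ENNReal.tsum_add

theorem expect_fintype [Fintype α] (p : PMF α) (f : α → ℝ≥0∞) :
    expect p f = ∑ a, p a * f a := tsum_fintype _

theorem expect_zero {p : PMF α} {f : α → ℝ≥0∞} (h : ∀ a ∈ p.support, f a = 0) :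
    expect p f = 0 := by
  rw [expect_congr h, expect_const]

theorem exists_of_expect_ne_zero {p : PMF α} {f : α → ℝ≥0∞} (h : expect p f ≠ 0) :
    ∃ a ∈ p.support, f a ≠ 0 := by
  by_contra hc
  push Not at hc
  exact h (expect_zero hc)

theorem bind_apply_eq_expect (p : PMF α) (q : α → PMF β) (b : β) :
    p.bind q b = expect p fun a => q a b := rfl

theorem toOuterMeasure_eq_expect (p : PMF α) (s : Set α) :
    p.toOuterMeasure s = expect p (s.indicator 1) := by
  rw [PMF.toOuterMeasure_apply]
  refine tsum_congr fun a => ?_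
  by_cases ha : a ∈ s <;> simp [ha]

theorem expect_uniformOfFintype [Fintype α] [Nonempty α] (f : α → ℝ≥0∞) :
    expect (PMF.uniformOfFintype α) f = (Fintype.card α : ℝ≥0∞)⁻¹ * ∑ a, f a := by
  rw [expect_fintype, Finset.mul_sum]
  simp

theorem le_toOuterMeasure_of_compl (p : PMF α) (s : Set α) {a b : ℝ≥0∞} (hab : a + b = 1)
    (hb : b ≠ ∞) (h : p.toOuterMeasure sᶜ ≤ b) : a ≤ p.toOuterMeasure s := by
  have h1 : p.toOuterMeasure s + p.toOuterMeasure sᶜ = 1 := by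
    rw [toOuterMeasure_eq_expect, toOuterMeasure_eq_expect, ← expect_add]
    have : (fun a => s.indicator (1 : α → ℝ≥0∞) a + sᶜ.indicator 1 a) = fun _ => 1 := by
      funext a
      by_cases ha : a ∈ s <;> simp [ha]
    rw [this, expect_const]
  have h2 : a + b ≤ p.toOuterMeasure s + b := by
    rw [hab, ← h1]
    gcongr
  exact (ENNReal.add_le_add_iff_right hb).1 h2

end Expect

/-! ### Iterated random steps -/

section Fold

variable {S I : Type}

/-- The distribution of the state after a list of random steps. -/
noncomputable def runList (f : S → I → PMF S) : List I → S → PMF S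
  | [], s => PMF.pure s
  | e :: l, s => (f s e).bind (runList f l)

/-- Passes from a fold of distributions, the form in which the algorithm is defined, to kernels
iterated from a single state, the form suited to induction on the stream. -/
theorem foldl_bind_eq (f : S → I → PMF S) (l : List I) (p : PMF S) :
    l.foldl (fun p e => p.bind fun x => f x e) p = p.bind (runList f l) := by
  induction l generalizing p with
  | nil => exact (PMF.bind_pure p).symm
  | cons e l ih =>
    rw [List.foldl_cons, ih, PMF.bind_bind]
    rfl

theorem runList_append (f : S → I → PMF S) (l l' : List I) (s : S) :
    runList f (l ++ l') s = (runList f l s).bind (runList f l') := by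
  induction l generalizing s with
  | nil => simp [runList]
  | cons e l ih =>
    simp only [List.cons_append, runList, PMF.bind_bind]
    exact congrArg _ (funext ih)

/-- A property that every step preserves holds at the end. -/
theorem runList_invariant (f : S → I → PMF S) (P : S → Prop) {l : List I}
    (hf : ∀ e ∈ l, ∀ s, P s → ∀ t ∈ (f s e).support, P t) {s t : S} (hs : P s)
    (ht : t ∈ (runList f l s).support) : P t := by
  induction l generalizing s with
  | nil =>
    rw [runList, PMF.mem_support_pure_iff] at ht
    exact ht ▸ hs
  | cons e l ih =>
    rw [runList, PMF.mem_support_bind_iff] at ht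
    obtain ⟨u, hu, ht⟩ := ht
    exact ih (fun e' he' => hf e' (List.mem_cons_of_mem _ he'))
      (hf e List.mem_cons_self s hs u hu) ht

theorem runList_pure (f : S → I → S) (l : List I) (s : S) :
    runList (fun s e => PMF.pure (f s e)) l s = PMF.pure (l.foldl f s) := by
  induction l generalizing s with
  | nil => rfl
  | cons e l ih => rw [runList, PMF.pure_bind, ih, List.foldl_cons]

end Fold

/-! ### Independent samples -/

section Indep

variable {α β : Type}

/-- The processing of one coordinate never looks at another, so it commutes with the sampling of the
others. This keeps parallel walkers independent from start to finish. -/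
theorem indep_bind {s : ℕ} (p : Fin s → PMF α) (f : Fin s → α → PMF β) :
    ((indep p).bind fun v => indep fun i => f i (v i)) = indep fun i => (p i).bind (f i) := by
  induction s with
  | zero => simp [indep]
  | succ s ih =>
    simp only [indep, PMF.bind_bind, PMF.bind_map, Function.comp_def, Fin.cons_zero, Fin.cons_succ]
    congr 1
    funext a
    rw [PMF.bind_comm]
    congr 1
    funext b
    rw [← ih, PMF.map_bind]

theorem indep_pure {s : ℕ} (v : Fin s → α) : (indep fun i => PMF.pure (v i)) = PMF.pure v := by
  induction s with
  | zero => exact congrArg PMF.pure (Subsingleton.elim _ _)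
  | succ s ih =>
    rw [indep, PMF.pure_bind, ih, PMF.pure_map]
    exact congrArg PMF.pure (Fin.cons_self_tail v)

theorem indep_apply {s : ℕ} (p : Fin s → PMF α) (v : Fin s → α) :
    indep p v = ∏ i, p i (v i) := by
  classical
  induction s with
  | zero => simp [indep, PMF.pure_apply, Subsingleton.elim v Fin.elim0]
  | succ s ih =>
    rw [indep, bind_apply_eq_expect, Fin.prod_univ_succ, expect, tsum_eq_single (v 0)]
    · congr 1
      rw [PMF.map_apply, tsum_eq_single (Fin.tail v)]
      · rw [if_pos (Fin.cons_self_tail v).symm, ih]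
        rfl
      · intro w hw
        refine if_neg fun h => hw ?_
        rw [h, Fin.tail_cons]
    · intro a ha
      rw [PMF.map_apply]
      refine mul_eq_zero_of_right _ (ENNReal.tsum_eq_zero.2 fun w => if_neg fun h => ha ?_)
      rw [h, Fin.cons_zero]

theorem mem_support_indep {s : ℕ} {p : Fin s → PMF α} {v : Fin s → α}
    (h : v ∈ (indep p).support) (i : Fin s) : v i ∈ (p i).support := by
  rw [PMF.mem_support_iff, indep_apply] at h
  exact fun h0 => h (Finset.prod_eq_zero (Finset.mem_univ i) h0)

end Indep

end RandomWalkStream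

namespace RandomWalkStream

/-! ### The sequence of block labels -/

section RunList

variable {S I J : Type}

theorem runList_map (f : S → J → PMF S) (g : I → J) (l : List I) (s : S) :
    runList f (l.map g) s = runList (fun s i => f s (g i)) l s := by
  induction l generalizing s with
  | nil => rfl
  | cons e l ih =>
    simp only [List.map_cons, runList]
    exact congrArg _ (funext ih)

theorem runList_flatMap (f : S → J → PMF S) (g : I → List J) (l : List I) (s : S) :
    runList f (l.flatMap g) s = runList (fun s i => runList f (g i) s) l s := by
  induction l generalizing s with
  | nil => rfl
  | cons e l ih =>
    rw [List.flatMap_cons, runList_append, runList]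
    exact congrArg _ (funext ih)

theorem runList_congr {f g : S → I → PMF S} {l : List I} (h : ∀ e ∈ l, ∀ s, f s e = g s e)
    (s : S) : runList f l s = runList g l s := by
  induction l generalizing s with
  | nil => rfl
  | cons e l ih =>
    rw [runList, runList, h e List.mem_cons_self s]
    exact congrArg _ (funext fun t => ih (fun e' he' => h e' (List.mem_cons_of_mem _ he')) t)

end RunList

section Labels

variable {k : ℕ}

/-- The first block, among those in a list, that is not yet complete. -/
def nextIn (js : List (Fin k)) (left : Fin k → ℕ) : Option (Fin k) :=
  js.find? fun j => decide (left j ≠ 0)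

/-- The block sizes that are left after the arrival of one edge. -/
def decIn (js : List (Fin k)) (left : Fin k → ℕ) : Fin k → ℕ :=
  match nextIn js left with
  | some j => Function.update left j (left j - 1)
  | none => left

/-- The block labels of the next `t` edges. -/
def labelSeq : ℕ → (Fin k → ℕ) → List (Option (Fin k))
  | 0, _ => []
  | t + 1, left => nextIn (List.finRange k) left :: labelSeq t (decIn (List.finRange k) left)

/-- The block sizes that are left after the arrival of `t` edges. -/
def leftAfter : ℕ → (Fin k → ℕ) → Fin k → ℕ
  | 0, left => left
  | t + 1, left => leftAfter t (decIn (List.finRange k) left)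

/-- The labels of the blocks in a list, each as often as the block has edges. -/
def flatLabels (js : List (Fin k)) (left : Fin k → ℕ) : List (Option (Fin k)) :=
  js.flatMap fun j => List.replicate (left j) (some j)

theorem decIn_apply_of_notMem {js : List (Fin k)} (left : Fin k → ℕ) {i : Fin k} (hi : i ∉ js) :
    decIn js left i = left i := by
  rw [decIn]
  cases h : nextIn js left with
  | none => rfl
  | some j =>
    have hj : j ∈ js := List.mem_of_find?_eq_some h
    exact Function.update_of_ne (fun hij : i = j => hi (hij ▸ hj)) _ _

theorem flatLabels_congr {js : List (Fin k)} {left left' : Fin k → ℕ}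
    (h : ∀ j ∈ js, left j = left' j) : flatLabels js left = flatLabels js left' := by
  unfold flatLabels
  exact List.flatMap_congr fun j hj => by rw [h j hj]

/-- Removing one edge from the first nonempty block peels exactly the head off the list of remaining
labels. A general list `js` is needed for the induction, since the search skips empty blocks at the
front. -/
theorem flatLabels_step {js : List (Fin k)} (hjs : js.Nodup) (left : Fin k → ℕ) :
    (nextIn js left = none ∧ flatLabels js left = []) ∨
      (nextIn js left ≠ none ∧
        flatLabels js left = nextIn js left :: flatLabels js (decIn js left)) := by
  induction js with
  | nil => exact Or.inl ⟨rfl, rfl⟩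
  | cons j js ih =>
    have hj := (List.nodup_cons.1 hjs).1
    by_cases h0 : left j = 0
    · have h1 : nextIn (j :: js) left = nextIn js left := by simp [nextIn, h0]
      have h2 : decIn (j :: js) left = decIn js left := by simp only [decIn, h1]
      have h3 : ∀ l : Fin k → ℕ, l j = 0 → flatLabels (j :: js) l = flatLabels js l :=
        fun l hl => by simp [flatLabels, hl]
      rw [h1, h2, h3 _ h0, h3 _ ((decIn_apply_of_notMem left hj).trans h0)]
      exact ih (List.nodup_cons.1 hjs).2
    · have h1 : nextIn (j :: js) left = some j := by simp [nextIn, h0]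
      refine Or.inr ⟨by simp [h1], ?_⟩
      have h2 : decIn (j :: js) left = Function.update left j (left j - 1) := by
        simp only [decIn, h1]
      have h3 : flatLabels js (Function.update left j (left j - 1)) = flatLabels js left :=
        flatLabels_congr fun i hi =>
          Function.update_of_ne (fun hij : i = j => hj (hij ▸ hi)) _ _
      have h4 : ∀ l : Fin k → ℕ, flatLabels (j :: js) l =
          List.replicate (l j) (some j) ++ flatLabels js l := fun l => rfl
      rw [h1, h2, h4, h4, h3, Function.update_self]
      obtain ⟨c, hc⟩ := Nat.exists_eq_succ_of_ne_zero h0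
      rw [hc, Nat.succ_sub_one, List.replicate_succ, List.cons_append]

/-- `flatLabels_step` is iterated until the counters are exhausted; from then on they no longer
change and only tail labels appear. -/
theorem labelSeq_eq (t : ℕ) (left : Fin k → ℕ)
    (h : (flatLabels (List.finRange k) left).length ≤ t) :
    labelSeq t left = flatLabels (List.finRange k) left ++
      List.replicate (t - (flatLabels (List.finRange k) left).length) none := by
  induction t generalizing left with
  | zero =>
    rw [List.eq_nil_of_length_eq_zero (Nat.le_zero.1 h)]
    rfl
  | succ t ih =>
    rcases flatLabels_step (List.nodup_finRange k) left with ⟨h1, h2⟩ | ⟨h1, h2⟩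
    · have h3 : decIn (List.finRange k) left = left := by simp only [decIn, h1]
      rw [labelSeq, h1, h3, ih _ (by simp [h2]), h2]
      simp [List.replicate_succ]
    · rw [h2, List.length_cons] at h
      rw [labelSeq, ih _ (by omega), h2, List.length_cons, List.cons_append,
        Nat.add_sub_add_right]

theorem length_labelSeq (t : ℕ) (left : Fin k → ℕ) : (labelSeq t left).length = t := by
  induction t generalizing left with
  | zero => rfl
  | succ t ih => rw [labelSeq, List.length_cons, ih]

theorem length_flatLabels (left : Fin k → ℕ) :
    (flatLabels (List.finRange k) left).length = ∑ j, left j := by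
  rw [flatLabels, List.length_flatMap, ← List.sum_ofFn, List.ofFn_eq_map]
  simp

/-- A list sorted by label is the concatenation of its label classes. This splits a run over the
stream into runs over blocks. -/
theorem eq_flatMap_filter_of_map_eq {I : Type} {js : List (Fin k)} (hjs : js.Nodup)
    (left : Fin k → ℕ) (l : List I) (f : I → Option (Fin k)) (h : l.map f = flatLabels js left) :
    l = js.flatMap fun j => l.filter fun x => decide (f x = some j) := by
  induction js generalizing l with
  | nil => simpa [flatLabels] using h
  | cons j js ih =>
    have h4 : flatLabels (j :: js) left =
          List.replicate (left j) (some j) ++ flatLabels js left := rfl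
    rw [h4] at h
    obtain ⟨l1, l2, rfl, h1, h2⟩ := List.map_eq_append_iff.1 h
    have hj := (List.nodup_cons.1 hjs).1
    have e1 : ∀ x ∈ l1, f x = some j := fun x hx =>
      List.eq_of_mem_replicate (h1 ▸ List.mem_map_of_mem hx)
    have e2 : ∀ x ∈ l2, f x ≠ some j := by
      intro x hx hxj
      have : some j ∈ flatLabels js left := by
        rw [← h2, ← hxj]
        exact List.mem_map_of_mem hx
      simp only [flatLabels, List.mem_flatMap, List.mem_replicate, Option.some.injEq] at this
      obtain ⟨i, hi, -, rfl⟩ := this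
      exact hj hi
    rw [List.flatMap_cons, List.filter_append]
    congr 1
    · rw [List.filter_eq_self.2 fun x hx => by simp [e1 x hx],
        List.filter_eq_nil_iff.2 fun x hx => by simp [e2 x hx], List.append_nil]
    · conv_lhs => rw [ih (List.nodup_cons.1 hjs).2 l2 h2]
      refine List.flatMap_congr fun i hi => ?_
      have e3 : l1.filter (fun x => decide (f x = some i)) = [] :=
        List.filter_eq_nil_iff.2 fun x hx => by
          simp only [e1 x hx, Option.some.injEq, decide_eq_true_eq]
          exact fun hij => hj (hij ▸ hi)
      rw [List.filter_append, e3, List.nil_append]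

theorem eq_flatMap_filter_append {I : Type} {left : Fin k → ℕ} {c : ℕ} {l : List I}
    {f : I → Option (Fin k)}
    (h : l.map f = flatLabels (List.finRange k) left ++ List.replicate c none) :
    l = ((List.finRange k).flatMap fun j => l.filter fun x => decide (f x = some j)) ++
      l.filter fun x => decide (f x = none) := by
  obtain ⟨l1, l2, rfl, h1, h2⟩ := List.map_eq_append_iff.1 h
  have e2 : ∀ x ∈ l2, f x = none := fun x hx =>
      List.eq_of_mem_replicate (h2 ▸ List.mem_map_of_mem hx)
  have e1 : ∀ x ∈ l1, f x ≠ none := by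
    intro x hx hxj
    have : none ∈ flatLabels (List.finRange k) left := by
      rw [← h1, ← hxj]
      exact List.mem_map_of_mem hx
    simp [flatLabels, List.mem_flatMap, List.mem_replicate] at this
  congr 1
  · conv_lhs => rw [eq_flatMap_filter_of_map_eq (List.nodup_finRange k) left l1 f h1]
    refine List.flatMap_congr fun i hi => ?_
    have e3 : l2.filter (fun x => decide (f x = some i)) = [] :=
      List.filter_eq_nil_iff.2 fun x hx => by simp [e2 x hx]
    rw [List.filter_append, e3, List.append_nil]
  · rw [List.filter_append, List.filter_eq_nil_iff.2 fun x hx => by simp [e1 x hx],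
      List.nil_append, List.filter_eq_self.2 fun x hx => by simp [e2 x hx]]

end Labels

/-! ### Decomposition of the algorithm into independent walkers -/

section Decompose

variable {n k s : ℕ}

/-- Arrival of an edge with a given block label; the label `none` stands for the tail. -/
noncomputable def Walker.stepLabel (w : Walker n k) (z : Option (Fin k) × Sym2 (Fin n)) :
    PMF (Walker n k) :=
  match z.1 with
  | some j => w.stepBlock j z.2
  | none => PMF.pure (w.stepTail z.2)

theorem Memory.step_eq (left : Fin k → ℕ) (ws : Fin s → Walker n k) (e : Sym2 (Fin n)) :
    Memory.step ⟨left, ws⟩ e =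
      (indep fun i => (ws i).stepLabel (nextIn (List.finRange k) left, e)).map fun ws =>
        ⟨decIn (List.finRange k) left, ws⟩ := by
  have h : Memory.block ⟨left, ws⟩ = nextIn (List.finRange k) left := rfl
  unfold Memory.step decIn Walker.stepLabel
  rw [h]
  cases nextIn (List.finRange k) left with
  | some j => rfl
  | none =>
    simp only
    rw [indep_pure fun i => (ws i).stepTail e, PMF.pure_map]

/-- The label of an arrival depends on the counters and not on the walkers, so the counters evolve
deterministically. All randomness during the stream is private to the walkers, and `indep_bind`
merges it step by step. -/
theorem runList_memory_step (σ : List (Sym2 (Fin n))) (left : Fin k → ℕ)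
    (ws : Fin s → Walker n k) :
    runList Memory.step σ ⟨left, ws⟩ =
      (indep fun i =>
        runList Walker.stepLabel ((labelSeq σ.length left).zip σ) (ws i)).map fun ws =>
          ⟨leftAfter σ.length left, ws⟩ := by
  induction σ generalizing left ws with
  | nil =>
    simp only [runList, List.zip_nil_right]
    rw [indep_pure, PMF.pure_map]
    rfl
  | cons e σ ih =>
    rw [runList, Memory.step_eq, PMF.bind_map]
    simp only [List.length_cons, labelSeq, leftAfter, List.zip_cons_cons, runList,
      Function.comp_def, ih]
    rw [← PMF.map_bind, indep_bind _ fun _ => runList Walker.stepLabel _]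

/-- The start of a single walk. -/
noncomputable def Walker.start (n k : ℕ) [NeZero n] : PMF (Walker n k) :=
  (PMF.uniformOfFintype (Fin n)).bind fun u =>
    (PMF.uniformOfFintype (Template k)).map fun π =>
      (⟨u, π, fun _ => none, fun _ => 0, fun _ => 0⟩ : Walker n k)

/-- The outcome of a single walk, for given block sizes. -/
noncomputable def walkDist (n k : ℕ) [NeZero n] (η : ℝ) (c : Fin k → ℕ)
    (σ : List (Sym2 (Fin n))) : PMF (Option (Fin (k + 1) → Fin n)) :=
  (Walker.start n k).bind fun w =>
    (runList Walker.stepLabel ((labelSeq σ.length c).zip σ) w).bind fun w => w.finish η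

/-- The output computed from the outcomes of all walks. -/
noncomputable def outputOf (b : ℕ) (v : Fin s → Option (Fin (k + 1) → Fin n)) : Option ℝ :=
  (if b ≤ (List.ofFn v).reduceOption.length then some ((List.ofFn v).reduceOption.take b)
    else none).map fun ws =>
      (1 / (b : ℝ)) * ((ws.countP fun v => decide (v (Fin.last k) = v 0) : ℕ) : ℝ)

/-- For fixed order and block sizes, start, run and finish are three independent families that
compose coordinatewise. The walkers depend on each other only through the order and the block sizes.
-/
theorem start_bind_finish (n m k s b : ℕ) [NeZero n] (η : ℝ) (σ : List (Sym2 (Fin n))) :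
    ((Memory.start n k s m η).bind (runList Memory.step σ)).bind
        (fun x => (indep fun i => (x.walkers i).finish η).map (outputOf b)) =
      (blockSizes k η m).bind fun c =>
        (indep fun _ : Fin s => walkDist n k η c σ).map (outputOf b) := by
  rw [Memory.start, PMF.bind_bind, PMF.bind_bind]
  congr 1
  funext c
  rw [PMF.bind_map]
  simp only [Function.comp_def, runList_memory_step, PMF.bind_map]
  simp only [← PMF.map_bind]
  simp only [indep_bind _ fun _ (w : Walker n k) => w.finish η]
  rw [indep_bind _ fun _ w => (runList Walker.stepLabel _ w).bind _]
  rfl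

theorem approxRP_run (n m k : ℕ) [NeZero n] (ε C D : ℝ) (σ : List (Sym2 (Fin n))) :
    (approxRP n m k ε C D).run σ =
      (blockSizes k (stepFraction C ε k) m).bind fun c =>
        (indep fun _ : Fin (numStarts C ε k (numWalks D ε)) =>
          walkDist n k (stepFraction C ε k) c σ).map (outputOf (numWalks D ε)) := by
  refine Eq.trans ?_ (start_bind_finish n m k _ _ _ σ)
  refine Eq.trans (congrArg (fun p => PMF.bind p (approxRP n m k ε C D).finish)
    (foldl_bind_eq _ _ _)) ?_
  refine congrArg (PMF.bind _) (funext fun x => ?_)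
  exact PMF.map_comp _ _ _

theorem after_approxRP (n m k : ℕ) [NeZero n] (ε C D : ℝ) (σ : List (Sym2 (Fin n))) :
    (approxRP n m k ε C D).after σ =
      (Memory.start n k (numStarts C ε k (numWalks D ε)) m (stepFraction C ε k)).bind
        (runList Memory.step σ) := foldl_bind_eq _ _ _

end Decompose

end RandomWalkStream

namespace RandomWalkStream

/-! ### Candidate walks -/

section WalkEdges

variable {n k : ℕ}

/-- The `j`-th edge of a walk. -/
def edgeAt (v : Fin (k + 1) → Fin n) (j : Fin k) : Sym2 (Fin n) := s(v j.castSucc, v j.succ)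

theorem nonempty_sameEdge (v : Fin (k + 1) → Fin n) (j : Fin k) :
    (Finset.univ.filter fun i => edgeAt v i = edgeAt v j).Nonempty :=
  ⟨j, by simp⟩

/-- The first step of a walk that uses its `j`-th edge. -/
def firstUse (v : Fin (k + 1) → Fin n) (j : Fin k) : Fin k :=
  (Finset.univ.filter fun i => edgeAt v i = edgeAt v j).min' (nonempty_sameEdge v j)

theorem edgeAt_firstUse (v : Fin (k + 1) → Fin n) (j : Fin k) :
    edgeAt v (firstUse v j) = edgeAt v j :=
  (Finset.mem_filter.1 (Finset.min'_mem _ (nonempty_sameEdge v j))).2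

theorem firstUse_le_of_eq {v : Fin (k + 1) → Fin n} {i j : Fin k} (h : edgeAt v i = edgeAt v j) :
    firstUse v j ≤ i :=
  Finset.min'_le _ _ (by simp [h])

theorem firstUse_le (v : Fin (k + 1) → Fin n) (j : Fin k) : firstUse v j ≤ j :=
  firstUse_le_of_eq rfl

theorem firstUse_congr {v : Fin (k + 1) → Fin n} {i j : Fin k} (h : edgeAt v i = edgeAt v j) :
    firstUse v i = firstUse v j :=
  le_antisymm (firstUse_le_of_eq ((edgeAt_firstUse v j).trans h.symm))
    (firstUse_le_of_eq ((edgeAt_firstUse v i).trans h))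

theorem firstUse_firstUse (v : Fin (k + 1) → Fin n) (j : Fin k) :
    firstUse v (firstUse v j) = firstUse v j :=
  firstUse_congr (edgeAt_firstUse v j)

/-- The edges of a walk lie in the blocks in which a walker can find them. -/
def LabelsFit (ℓ : Sym2 (Fin n) → Option (Fin k)) (v : Fin (k + 1) → Fin n) : Prop :=
  ∀ j, ℓ (edgeAt v j) = some (firstUse v j)

/-- The number of edges of block `j` at the `j`-th vertex of a walk. -/
def blockDeg (E : Finset (Sym2 (Fin n))) (ℓ : Sym2 (Fin n) → Option (Fin k))
    (v : Fin (k + 1) → Fin n) (j : Fin k) : ℕ :=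
  (E.filter fun e => ℓ e = some j ∧ v j.castSucc ∈ e).card

/-- The degree of the `j`-th vertex of a walk in the edges of the walk and the tail. -/
def degHat (E : Finset (Sym2 (Fin n))) (ℓ : Sym2 (Fin n) → Option (Fin k))
    (v : Fin (k + 1) → Fin n) (j : Fin k) : ℕ :=
  (E.filter fun e => v j.castSucc ∈ e ∧ (ℓ e = none ∨ ∃ i, edgeAt v i = e)).card

open Classical in
/-- The probability that a walker outputs the walk `v`, for given block labels of the edges. -/
noncomputable def walkMass (η : ℝ) (E : Finset (Sym2 (Fin n)))
    (ℓ : Sym2 (Fin n) → Option (Fin k)) (v : Fin (k + 1) → Fin n) : ℝ :=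
  if LabelsFit ℓ v then
    (1 / (n : ℝ)) * (1 / (k ! : ℝ)) * ∏ j, if firstUse v j = j then
      1 / (blockDeg E ℓ v j : ℝ) * min ((blockDeg E ℓ v j : ℝ) / degHat E ℓ v j) 1
    else min (η / degHat E ℓ v j) 1
  else 0

/-- The template of a walk. -/
def templateOf (v : Fin (k + 1) → Fin n) : Template k := fun j =>
  ⟨firstUse v j, Nat.lt_succ_of_le (firstUse_le v j)⟩

theorem idx_templateOf (v : Fin (k + 1) → Fin n) (j : Fin k) :
    (templateOf v).idx j = firstUse v j := rfl

theorem card_template (k : ℕ) : Fintype.card (Template k) = k ! := by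
  rw [Fintype.card_pi]
  simp only [Fintype.card_fin]
  rw [Fin.prod_univ_eq_prod_range (fun i => i + 1) k, Finset.prod_range_add_one_eq_factorial]

end WalkEdges

/-! ### The vertices of a walker -/

namespace Walker

variable {n k : ℕ}

theorem idx_le (π : Template k) (j : Fin k) : π.idx j ≤ j := Nat.lt_succ_iff.1 (π j).2

theorem vertex_succ (w : Walker n k) (j : Fin k) :
    w.vertex (j + 1) = (w.vertex j).bind fun u => (w.edge j).bind fun e =>
        open Classical in if hu : u ∈ e then some (Sym2.Mem.other hu) else none := by
  rw [vertex, dif_pos j.2]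

/-- Template entries never point forward, so the first j steps read only the reservoirs of the first
j blocks. -/
theorem vertex_congr {w w' : Walker n k} (hr : w.root = w'.root) (ht : w.tmpl = w'.tmpl) (j : ℕ)
    (h : ∀ i : Fin k, (i : ℕ) < j → w.res i = w'.res i) : w.vertex j = w'.vertex j := by
  induction j with
  | zero => simp [vertex, hr]
  | succ j ih =>
    by_cases hj : j < k
    · have he : w.edge ⟨j, hj⟩ = w'.edge ⟨j, hj⟩ := by
        rw [edge, edge, ht, h _ (Nat.lt_succ_of_le (idx_le w'.tmpl ⟨j, hj⟩))]
      have h1 := w.vertex_succ ⟨j, hj⟩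
      have h2 := w'.vertex_succ ⟨j, hj⟩
      simp only at h1 h2
      rw [h1, h2, ih fun i hi => h i (hi.trans (Nat.lt_succ_self j)), he]
    · rw [vertex, vertex, dif_neg hj, dif_neg hj]

theorem vertex_of_edges {w : Walker n k} {v : Fin (k + 1) → Fin n} {m : ℕ} (hr : w.root = v 0)
    (h : ∀ i : Fin k, (i : ℕ) < m → w.edge i = some (edgeAt v i)) (j : ℕ) (hjm : j ≤ m)
    (hj : j < k + 1) : w.vertex j = some (v ⟨j, hj⟩) := by
  induction j with
  | zero => simp [vertex, hr]
  | succ j ih =>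
    have hjk : j < k := Nat.lt_of_succ_lt_succ hj
    have h1 := w.vertex_succ ⟨j, hjk⟩
    simp only at h1
    rw [h1, ih (Nat.le_of_succ_le hjm) (Nat.lt_succ_of_lt hjk), h ⟨j, hjk⟩ hjm]
    simp only [Option.bind_some]
    have hu : v ⟨j, Nat.lt_succ_of_lt hjk⟩ ∈ edgeAt v ⟨j, hjk⟩ := Sym2.mem_mk_left _ _
    rw [dif_pos hu]
    have h2 := Sym2.other_spec hu
    exact congrArg some (Sym2.congr_right.1 h2)

theorem walk_eq_some_iff {w : Walker n k} {v : Fin (k + 1) → Fin n} :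
    w.walk = some v ↔ ∀ j : Fin (k + 1), w.vertex j = some (v j) := by
  unfold walk
  constructor
  · intro h j
    split_ifs at h with hs
    have := congrFun (Option.some.inj h) j
    rw [← this, Option.some_get]
  · intro h
    have hs : ∀ j : Fin (k + 1), (w.vertex j).isSome := fun j => by rw [h j]; rfl
    rw [dif_pos hs]
    refine congrArg some (funext fun j => ?_)
    simp [h j]

/-- The vertices determine the edges: `Sym2.Mem.other` leads from one vertex to the next only along
the edge that joins them. -/
theorem edge_of_walk {w : Walker n k} {v : Fin (k + 1) → Fin n} (h : w.walk = some v) :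
    w.root = v 0 ∧ ∀ i, w.edge i = some (edgeAt v i) := by
  rw [walk_eq_some_iff] at h
  refine ⟨by simpa [vertex] using h 0, fun i => ?_⟩
  have h1 := w.vertex_succ i
  have h2 := h i.succ
  have h3 := h i.castSucc
  rw [Fin.val_succ] at h2
  rw [Fin.val_castSucc] at h3
  rw [h2, h3, Option.bind_some] at h1
  cases he : w.edge i with
  | none => rw [he] at h1; simp at h1
  | some e =>
    rw [he, Option.bind_some] at h1
    split_ifs at h1 with hu
    rw [edgeAt, Option.some.inj h1, Sym2.other_spec hu]

/-! ### Reservoir sampling -/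

/-- The walker after reservoir sampling in block `j`. -/
def withSample (w : Walker n k) (j : Fin k) (e : Sym2 (Fin n)) (t : ℕ) : Walker n k :=
  { w with res := Function.update w.res j (some e), cnt := Function.update w.cnt j t }

theorem touches_congr {w w' : Walker n k} (hr : w.root = w'.root) (ht : w.tmpl = w'.tmpl) (j : ℕ)
    (h : ∀ i : Fin k, (i : ℕ) < j → w.res i = w'.res i) (e : Sym2 (Fin n)) :
    w.Touches j e ↔ w'.Touches j e := by
  rw [Touches, Touches, vertex_congr hr ht j h]

/-- The j-th vertex is fixed before block j starts, so the changes to reservoir j do not alter which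
edges are eligible for it. -/
theorem touches_withSample (w : Walker n k) (j : Fin k) (e : Sym2 (Fin n)) (t : ℕ)
    (x : Sym2 (Fin n)) : (w.withSample j e t).Touches j x ↔ w.Touches j x :=
  touches_congr (w := w.withSample j e t) (w' := w) rfl rfl _ (fun i hi => by
    have hij : i ≠ j := by
      rintro rfl
      exact lt_irrefl _ hi
    exact Function.update_of_ne hij _ _) x

theorem expect_stepBlock {w : Walker n k} {j : Fin k} {x : Sym2 (Fin n)}
    (hj : w.tmpl.idx j = j) (hx : w.Touches j x) (g : Walker n k → ℝ≥0∞) :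
    expect (w.stepBlock j x) g = ((w.cnt j + 1 : ℕ) : ℝ≥0∞)⁻¹ *
      (g (w.withSample j x (w.cnt j + 1)) +
        w.cnt j * g { w with cnt := Function.update w.cnt j (w.cnt j + 1) }) := by
  rw [stepBlock, if_pos ⟨hj, hx⟩, expect_map]
  refine (expect_map (PMF.uniformOfFintype (Fin (w.cnt j + 1))) Fin.val _).trans ?_
  rw [expect_uniformOfFintype, Fintype.card_fin, Fin.sum_univ_succ]
  simp [withSample, Function.comp_def]

theorem stepBlock_of_not {w : Walker n k} {j : Fin k} {x : Sym2 (Fin n)}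
    (h : ¬(w.tmpl.idx j = j ∧ w.Touches j x)) : w.stepBlock j x = PMF.pure w := by
  rw [stepBlock, if_neg h]

/-- The walker after all edges in a list have arrived in block `j`. -/
noncomputable def runBlock (w : Walker n k) (j : Fin k) (l : List (Sym2 (Fin n))) :
    PMF (Walker n k) :=
  runList (fun w e => w.stepBlock j e) l w

-- Induction on the last arrival: if each of h eligible edges is stored with probability 1/h, the
-- next eligible one replaces the stored edge with probability 1/(h + 1), and h/(h + 1) · 1/h = 1/(h
-- + 1). An arbitrary `g` is allowed because the expectation over the later blocks is substituted
-- for it.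
open Classical in
theorem expect_runBlock {w : Walker n k} {j : Fin k} (hj : w.tmpl.idx j = j) (h0 : w.cnt j = 0)
    (l : List (Sym2 (Fin n))) (g : Walker n k → ℝ≥0∞) :
    expect (w.runBlock j l) g =
      if (l.filter fun e => w.Touches j e).length = 0 then g w
      else ((l.filter fun e => w.Touches j e).length : ℝ≥0∞)⁻¹ *
        ((l.filter fun e => w.Touches j e).map fun e =>
          g (w.withSample j e (l.filter fun e => w.Touches j e).length)).sum := by
  induction l using List.reverseRecOn generalizing g with
  | nil => simp [runBlock, runList, expect_pure]
  | append_singleton l x ih =>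
    have h1 : w.runBlock j (l ++ [x]) = (w.runBlock j l).bind fun u => u.stepBlock j x := by
      simp only [runBlock, runList_append, runList, PMF.bind_pure]
    rw [h1, expect_bind, ih, List.filter_append]
    by_cases hx : w.Touches j x
    · have hf : List.filter (fun e => decide (w.Touches j e)) [x] = [x] := by simp [hx]
      rw [hf]
      set H := l.filter fun e => decide (w.Touches j e) with hH
      by_cases hl : H.length = 0
      · rw [List.eq_nil_of_length_eq_zero hl, expect_stepBlock hj hx, h0]
        simp
      · have h2 : ∀ e, expect ((w.withSample j e H.length).stepBlock j x) g =
            ((H.length + 1 : ℕ) : ℝ≥0∞)⁻¹ * (g (w.withSample j x (H.length + 1)) +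
              H.length * g (w.withSample j e (H.length + 1))) := by
          intro e
          rw [expect_stepBlock (by exact hj) ((touches_withSample w j e _ x).2 hx)]
          simp [withSample]
        simp only [h2, if_neg hl]
        rw [if_neg (by simp), List.sum_map_mul_left, List.sum_map_add, List.map_const',
          List.sum_replicate, List.sum_map_mul_left, List.length_append, List.length_singleton,
          List.map_append, List.sum_append, List.map_singleton, List.sum_singleton, nsmul_eq_mul,
          ← mul_add, mul_left_comm, ← mul_assoc (H.length : ℝ≥0∞)⁻¹,
          ENNReal.inv_mul_cancel (by exact_mod_cast hl) (ENNReal.natCast_ne_top _), one_mul,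
          add_comm (g _)]
    · have hf : List.filter (fun e => decide (w.Touches j e)) [x] = [] := by simp [hx]
      rw [hf, List.append_nil]
      have h2 : ∀ u : Walker n k, (¬ u.Touches j x) → expect (u.stepBlock j x) g = g u :=
        fun u hu => by rw [stepBlock_of_not fun h => hu h.2, expect_pure]
      rw [h2 w hx]
      simp only [fun e t => h2 (w.withSample j e t) fun h => hx ((touches_withSample w j e _ x).1 h)]

theorem runBlock_of_old {w : Walker n k} {j : Fin k} (hj : w.tmpl.idx j ≠ j)
    (l : List (Sym2 (Fin n))) : w.runBlock j l = PMF.pure w := by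
  induction l with
  | nil => rfl
  | cons x l ih =>
    rw [runBlock, runList, stepBlock_of_not fun h => hj h.1, PMF.pure_bind]
    exact ih

theorem mem_support_runBlock {w s : Walker n k} {j : Fin k} {l : List (Sym2 (Fin n))}
    (hs : s ∈ (w.runBlock j l).support) :
    s.root = w.root ∧ s.tmpl = w.tmpl ∧ s.tail = w.tail ∧ (∀ i, i ≠ j → s.res i = w.res i) ∧
      ∀ e, s.res j = some e → w.res j = some e ∨ e ∈ l := by
  refine runList_invariant (fun (w : Walker n k) e => w.stepBlock j e) (fun s : Walker n k =>
    s.root = w.root ∧ s.tmpl = w.tmpl ∧ s.tail = w.tail ∧ (∀ i, i ≠ j → s.res i = w.res i) ∧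
      ∀ e, s.res j = some e → w.res j = some e ∨ e ∈ l) (l := l) ?_
    ⟨rfl, rfl, rfl, fun _ _ => rfl, fun _ h => Or.inl h⟩ hs
  rintro x hx s ⟨h1, h2, h3, h4, h5⟩ t ht
  rw [stepBlock] at ht
  split_ifs at ht
  · rw [PMF.mem_support_map_iff] at ht
    obtain ⟨i, -, rfl⟩ := ht
    refine ⟨h1, h2, h3, fun i' hi' => ?_, fun e he => ?_⟩
    · by_cases hi : i = 0
      · simp only [hi, if_true, Function.update_of_ne hi', h4 i' hi']
      · simp only [hi, if_false, h4 i' hi']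
    · by_cases hi : i = 0
      · simp only [hi, if_true, Function.update_self, Option.some.injEq] at he
        exact Or.inr (he ▸ hx)
      · simp only [hi, if_false] at he
        exact h5 e he
  · rw [PMF.mem_support_pure_iff] at ht
    subst ht
    exact ⟨h1, h2, h3, h4, h5⟩

/-- The walker after all edges of the blocks in a list have arrived. -/
noncomputable def runBlocks (L : Fin k → List (Sym2 (Fin n))) (js : List (Fin k))
    (w : Walker n k) : PMF (Walker n k) :=
  runList (fun w j => w.runBlock j (L j)) js w

/-- Only block i writes to reservoir i, and it writes edges of `L i`. Hence later blocks cannot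
repair a wrong sample, and a stored edge reveals its label. -/
theorem mem_support_runBlocks {w s : Walker n k} {L : Fin k → List (Sym2 (Fin n))}
    {js : List (Fin k)} (hs : s ∈ (w.runBlocks L js).support) :
    s.root = w.root ∧ s.tmpl = w.tmpl ∧ s.tail = w.tail ∧ (∀ i ∉ js, s.res i = w.res i) ∧
      ∀ i e, s.res i = some e → w.res i = some e ∨ e ∈ L i := by
  refine runList_invariant (fun (w : Walker n k) j => w.runBlock j (L j))
    (fun s : Walker n k => s.root = w.root ∧ s.tmpl = w.tmpl ∧ s.tail = w.tail ∧
      (∀ i ∉ js, s.res i = w.res i) ∧ ∀ i e, s.res i = some e → w.res i = some e ∨ e ∈ L i)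
    (l := js) ?_ ⟨rfl, rfl, rfl, fun _ _ => rfl, fun _ _ h => Or.inl h⟩ hs
  rintro j hj s ⟨h1, h2, h3, h4, h5⟩ t ht
  obtain ⟨g1, g2, g3, g4, g5⟩ := mem_support_runBlock ht
  refine ⟨g1.trans h1, g2.trans h2, g3.trans h3, fun i hi => ?_, fun i e he => ?_⟩
  · rw [g4 i fun hij => hi (hij ▸ hj), h4 i hi]
  · by_cases hij : i = j
    · subst hij
      exact (g5 e he).elim (h5 i e) Or.inr
    · exact h5 i e (g4 i hij ▸ he)

/-! ### The tail of the stream -/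

/-- The walker with other tail counts. -/
def withTail (w : Walker n k) (t : Fin k → ℕ) : Walker n k := { w with tail := t }

theorem touches_withTail (w : Walker n k) (t : Fin k → ℕ) (j : ℕ) (e : Sym2 (Fin n)) :
    (w.withTail t).Touches j e ↔ w.Touches j e :=
  touches_congr (w := w.withTail t) (w' := w) rfl rfl j (fun _ _ => rfl) e

theorem walk_withTail (w : Walker n k) (t : Fin k → ℕ) : (w.withTail t).walk = w.walk := by
  have h : ∀ j : ℕ, (w.withTail t).vertex j = w.vertex j :=
    fun j => vertex_congr (w := w.withTail t) (w' := w) rfl rfl j fun _ _ => rfl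
  simp only [walk, h]

open Classical in
theorem foldl_stepTail (w : Walker n k) (l : List (Sym2 (Fin n))) :
    l.foldl stepTail w = w.withTail fun j =>
      w.tail j + (l.filter fun e => decide (w.Touches j e)).length := by
  induction l using List.reverseRecOn with
  | nil => simp [withTail]
  | append_singleton l x ih =>
    rw [List.foldl_append, ih]
    simp only [List.foldl_cons, List.foldl_nil, stepTail, touches_withTail]
    simp only [withTail]
    congr 1
    funext j
    by_cases hx : w.Touches j x <;> simp [hx, add_assoc]

theorem walk_foldl_stepTail (w : Walker n k) (l : List (Sym2 (Fin n))) :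
    (l.foldl stepTail w).walk = w.walk := by
  rw [foldl_stepTail, walk_withTail]

open Classical in
theorem finish_apply (w : Walker n k) (η : ℝ) (v : Fin (k + 1) → Fin n) :
    w.finish η (some v) = if w.walk = some v then (w.acceptProb η : ℝ≥0∞) else 0 := by
  rw [finish, PMF.map_apply, tsum_fintype, Fintype.sum_bool]
  have h1 : coin (w.acceptProb η) (w.acceptProb_le_one η) true = (w.acceptProb η : ℝ≥0∞) := rfl
  rw [h1]
  simp [eq_comm]

end Walker

end RandomWalkStream

namespace RandomWalkStream

/-! ### The outcome of a single walker -/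

section Single

variable {n k : ℕ}

/-- The state of a walker that follows the walk `v` after the first `m` blocks. -/
def targetState (E : Finset (Sym2 (Fin n))) (ℓ : Sym2 (Fin n) → Option (Fin k))
    (v : Fin (k + 1) → Fin n) (m : ℕ) : Walker n k where
  root := v 0
  tmpl := templateOf v
  res i := if (i : ℕ) < m ∧ firstUse v i = i then some (edgeAt v i) else none
  cnt i := if (i : ℕ) < m ∧ firstUse v i = i then blockDeg E ℓ v i else 0
  tail _ := 0

variable {E : Finset (Sym2 (Fin n))} {ℓ : Sym2 (Fin n) → Option (Fin k)}
  {v : Fin (k + 1) → Fin n}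

theorem edge_targetState {m : ℕ} {i : Fin k} (hi : (i : ℕ) < m) :
    (targetState E ℓ v m).edge i = some (edgeAt v i) := by
  have h1 : (targetState E ℓ v m).tmpl = templateOf v := rfl
  rw [Walker.edge, h1, idx_templateOf, idx_templateOf, if_pos (firstUse_firstUse v i)]
  have h2 : ((firstUse v i : Fin k) : ℕ) < m := lt_of_le_of_lt (firstUse_le v i) hi
  simp [targetState, h2, firstUse_firstUse, edgeAt_firstUse]

theorem vertex_targetState {m j : ℕ} (hjm : j ≤ m) (hj : j < k + 1) :
    (targetState E ℓ v m).vertex j = some (v ⟨j, hj⟩) :=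
  Walker.vertex_of_edges (m := m) rfl (fun _ hi => edge_targetState hi) j hjm hj

theorem touches_targetState {m j : ℕ} (hjm : j ≤ m) (hj : j < k + 1) (e : Sym2 (Fin n)) :
    (targetState E ℓ v m).Touches j e ↔ v ⟨j, hj⟩ ∈ e := by
  simp [Walker.Touches, vertex_targetState hjm hj]

theorem walk_targetState : (targetState E ℓ v k).walk = some v :=
  Walker.walk_eq_some_iff.2 fun j => vertex_targetState (Nat.lt_succ_iff.1 j.2) j.2

variable {σ : List (Sym2 (Fin n))}

theorem withSample_targetState {j : Fin k} (hj : firstUse v j = j) :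
    (targetState E ℓ v j).withSample j (edgeAt v j) (blockDeg E ℓ v j) =
      targetState E ℓ v (j + 1) := by
  have key : ∀ i : Fin k, i ≠ j → (((i : ℕ) < (j : ℕ) + 1 ∧ firstUse v i = i) ↔
      ((i : ℕ) < (j : ℕ) ∧ firstUse v i = i)) := by
    intro i hij
    have h1 : (i : ℕ) ≠ j := fun h => hij (Fin.ext h)
    rw [and_congr_left_iff]
    intro _
    omega
  refine Walker.ext rfl rfl (funext fun i => ?_) (funext fun i => ?_) rfl
  · by_cases hij : i = j
    · subst hij
      simp [Walker.withSample, targetState, hj]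
    · simp only [Walker.withSample, Function.update_of_ne hij, targetState, key i hij]
  · by_cases hij : i = j
    · subst hij
      simp [Walker.withSample, targetState, hj]
    · simp only [Walker.withSample, Function.update_of_ne hij, targetState, key i hij]

theorem targetState_succ_of_old {j : Fin k} (hj : firstUse v j ≠ j) :
    targetState E ℓ v j = targetState E ℓ v (j + 1) := by
  have key : ∀ i : Fin k, (((i : ℕ) < (j : ℕ) + 1 ∧ firstUse v i = i) ↔
      ((i : ℕ) < (j : ℕ) ∧ firstUse v i = i)) := by
    intro i
    rw [and_congr_left_iff]
    intro hi
    have h1 : (i : ℕ) ≠ j := fun h => hj ((Fin.ext h : i = j) ▸ hi)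
    omega
  refine Walker.ext rfl rfl (funext fun i => ?_) (funext fun i => ?_) rfl <;>
  simp only [targetState, key i]

/-- The list of the edges with a given label. -/
def labelled (ℓ : Sym2 (Fin n) → Option (Fin k)) (σ : List (Sym2 (Fin n)))
    (a : Option (Fin k)) : List (Sym2 (Fin n)) :=
  σ.filter fun e => decide (ℓ e = a)

open Classical in
theorem toFinset_filter_labelled (hE : σ.toFinset = E) (j : Fin k) :
    ((labelled ℓ σ (some j)).filter fun e =>
      decide ((targetState E ℓ v j).Touches j e)).toFinset =
        E.filter fun e => ℓ e = some j ∧ v j.castSucc ∈ e := by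
  have h1 : ∀ e, (targetState E ℓ v j).Touches j e ↔ v j.castSucc ∈ e := fun e =>
    touches_targetState le_rfl (Nat.lt_succ_of_lt j.2) e
  simp only [h1]
  ext e
  simp only [labelled, List.mem_toFinset, List.mem_filter, decide_eq_true_eq,
    Finset.mem_filter, ← hE, and_assoc]

/-- Only one trajectory contributes. A wrong sample in the block of a first use is never
overwritten, so `g` vanishes at the end; of the equally likely samples of a new step just the edge
of v survives, with weight 1/|H|. Blocks of old steps change nothing. The induction is on the number
`d` of remaining blocks. -/
theorem expect_runBlocks_drop (hσ : σ.Nodup) (hE : σ.toFinset = E) (hv : LabelsFit ℓ v)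
    (hvE : ∀ j, edgeAt v j ∈ E) (g : Walker n k → ℝ≥0∞)
    (hg : ∀ s : Walker n k, s.tmpl = templateOf v → g s ≠ 0 → ∀ i, firstUse v i = i → s.res i = some (edgeAt v i)) (d : ℕ) :
    ∀ j : ℕ, j + d = k →
      expect ((targetState E ℓ v j).runBlocks (fun i => labelled ℓ σ (some i))
        ((List.finRange k).drop j)) g =
        (∏ i ∈ Finset.univ.filter fun i : Fin k => j ≤ i ∧ firstUse v i = i,
          (blockDeg E ℓ v i : ℝ≥0∞)⁻¹) * g (targetState E ℓ v k) := by
  classical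
  induction d with
  | zero =>
    intro j hj
    obtain rfl : j = k := hj
    have h1 : (Finset.univ.filter fun i : Fin j => j ≤ i ∧ firstUse v i = i) = ∅ :=
      Finset.filter_eq_empty_iff.2 fun i _ h => absurd h.1 (not_le.2 i.2)
    rw [h1, List.drop_of_length_le (by simp), Walker.runBlocks, runList, expect_pure]
    simp
  | succ d ih =>
    intro j hj
    have hjk : j < k := by omega
    set J : Fin k := ⟨j, hjk⟩ with hJ
    have hnot : J ∉ (List.finRange k).drop (j + 1) := by
      intro h
      obtain ⟨i, hi, h2⟩ := List.mem_iff_getElem.1 h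
      simp only [List.getElem_drop, List.getElem_finRange, hJ, Fin.ext_iff] at h2
      simp at h2
      omega
    have hd : (List.finRange k).drop j = J :: (List.finRange k).drop (j + 1) := by
      rw [List.drop_eq_getElem_cons (by simpa using hjk)]
      congr 1
      simp [hJ]
    have hrun : expect ((targetState E ℓ v j).runBlocks (fun i => labelled ℓ σ (some i))
        ((List.finRange k).drop j)) g =
        expect ((targetState E ℓ v j).runBlock J (labelled ℓ σ (some J))) fun w =>
          expect (w.runBlocks (fun i => labelled ℓ σ (some i))
            ((List.finRange k).drop (j + 1))) g := by
      rw [hd, Walker.runBlocks, runList, expect_bind]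
      rfl
    rw [hrun]
    by_cases hnew : firstUse v J = J
    · have hH := toFinset_filter_labelled (ℓ := ℓ) (v := v) hE J
      have hnd : ((labelled ℓ σ (some J)).filter fun e =>
        decide ((targetState E ℓ v j).Touches J e)).Nodup := (hσ.filter _).filter _
      set H := (labelled ℓ σ (some J)).filter fun e =>
        decide ((targetState E ℓ v j).Touches J e) with hHdef
      have hlen : H.length = blockDeg E ℓ v J := by
        rw [← List.toFinset_card_of_nodup hnd, hH, blockDeg]
      have hmem : edgeAt v J ∈ H.toFinset := by
        rw [hH, Finset.mem_filter]
        exact ⟨hvE J, by rw [hv J, hnew], Sym2.mem_mk_left _ _⟩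
      have hpos : H.length ≠ 0 := by
        rw [List.mem_toFinset] at hmem
        exact (List.length_pos_of_mem hmem).ne'
      rw [Walker.expect_runBlock (by exact hnew) (by simp [targetState, hJ]), ← hHdef,
        if_neg hpos, ← List.sum_toFinset _ hnd, Finset.sum_eq_single (edgeAt v J)]
      · have h1 : (Finset.univ.filter fun i : Fin k => j ≤ i ∧ firstUse v i = i) =
            insert J (Finset.univ.filter fun i : Fin k => j + 1 ≤ i ∧ firstUse v i = i) := by
          ext i
          simp only [Finset.mem_filter, Finset.mem_univ, true_and, Finset.mem_insert]
          constructor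
          · rintro ⟨h2, h3⟩
            rcases h2.eq_or_lt with h2 | h2
            · exact Or.inl (Fin.ext h2.symm)
            · exact Or.inr ⟨h2, h3⟩
          · rintro (rfl | ⟨h2, h3⟩)
            · exact ⟨le_rfl, hnew⟩
            · exact ⟨by omega, h3⟩
        rw [h1, Finset.prod_insert (by simp [hJ]), hlen,
          withSample_targetState (E := E) (ℓ := ℓ) (j := J) hnew, ih (j + 1) (by omega), mul_assoc]
      · intro e _ he
        refine expect_zero fun s hs => ?_
        by_contra hgs
        have h2 := (Walker.mem_support_runBlocks hs).2.2.2.1 J hnot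
        rw [hg s (Walker.mem_support_runBlocks hs).2.1 hgs J hnew] at h2
        simp only [Walker.withSample, Function.update_self, Option.some.injEq] at h2
        exact he h2.symm
      · exact fun h => absurd hmem h
    · have h1 : (Finset.univ.filter fun i : Fin k => j ≤ i ∧ firstUse v i = i) =
            Finset.univ.filter fun i : Fin k => j + 1 ≤ i ∧ firstUse v i = i := by
        ext i
        simp only [Finset.mem_filter, Finset.mem_univ, true_and]
        rw [and_congr_left_iff]
        intro hi
        have h1 : (i : ℕ) ≠ j := fun h => hnew ((Fin.ext h : i = J) ▸ hi)
        omega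
      rw [Walker.runBlock_of_old (by exact hnew), expect_pure, h1,
        targetState_succ_of_old (j := J) hnew]
      exact ih (j + 1) (by omega)

/-- The walker at the start of the stream. -/
def initial (u : Fin n) (π : Template k) : Walker n k :=
  ⟨u, π, fun _ => none, fun _ => 0, fun _ => 0⟩

theorem targetState_zero : targetState E ℓ v 0 = initial (v 0) (templateOf v) := by
  simp [targetState, initial]

theorem res_of_walk {s : Walker n k} (hw : s.walk = some v) (i : Fin k) :
    s.tmpl.idx (s.tmpl.idx i) = s.tmpl.idx i ∧ s.res (s.tmpl.idx i) = some (edgeAt v i) := by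
  have h := (Walker.edge_of_walk hw).2 i
  rw [Walker.edge] at h
  split_ifs at h with h1
  exact ⟨h1, h⟩

/-- A walker that ends with the walk `v` starts with the start vertex and the template of `v`. -/
theorem of_mem_support_of_walk {u : Fin n} {π : Template k} {s : Walker n k}
    (hs : s ∈ ((initial u π).runBlocks (fun i => labelled ℓ σ (some i)) (List.finRange k)).support)
    (hw : s.walk = some v) : u = v 0 ∧ π = templateOf v ∧ LabelsFit ℓ v := by
  obtain ⟨h1, h2, -, -, h5⟩ := Walker.mem_support_runBlocks hs
  have hres : ∀ i e, s.res i = some e → ℓ e = some i := by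
    intro i e he
    rcases h5 i e he with h | h
    · simp [initial] at h
    · simpa using (List.mem_filter.1 h).2
  have hπ : s.tmpl = π := h2
  have hr := fun i => res_of_walk hw i
  rw [hπ] at hr
  have hℓ : ∀ i, ℓ (edgeAt v i) = some (π.idx i) := fun i => hres _ _ (hr i).2
  -- Equal edges have equal labels and hence equal template entries, so the entry at i is also the
  -- entry at the first use of its edge, and thus at most that position. Conversely, because the
  -- entry is a fixed point of the template, the step it names uses the same edge, so it is not
  -- before the first use.
  have hidx : ∀ i, π.idx i = firstUse v i := by
    intro i
    refine le_antisymm ?_ (firstUse_le_of_eq ?_)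
    · have h := (hℓ (firstUse v i)).symm.trans ((congrArg ℓ (edgeAt_firstUse v i)).trans (hℓ i))
      rw [← Option.some.inj h]
      exact Walker.idx_le π _
    · have h := (hr (π.idx i)).2
      rw [(hr i).1, (hr i).2] at h
      exact (Option.some.inj h).symm
  refine ⟨?_, ?_, fun i => by rw [hℓ i, hidx i]⟩
  · rw [← (Walker.edge_of_walk hw).1, h1]
    rfl
  · funext i
    exact Fin.ext (congrArg (fun j : Fin k => (j : ℕ)) (hidx i))

-- The edges of the walk carry block labels, so none of them lies in the tail, and adding the two
-- counts counts no edge twice.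
open Classical in
theorem degEst_target (hσ : σ.Nodup) (hE : σ.toFinset = E) (hv : LabelsFit ℓ v)
    (hvE : ∀ j, edgeAt v j ∈ E) (j : Fin k) :
    ((labelled ℓ σ none).foldl Walker.stepTail (targetState E ℓ v k)).degEst j =
      degHat E ℓ v j := by
  have ht : ∀ e, (targetState E ℓ v k).Touches j e ↔ v j.castSucc ∈ e := fun e =>
    touches_targetState j.2.le (Nat.lt_succ_of_lt j.2) e
  rw [Walker.foldl_stepTail, Walker.degEst]
  have hedge : ∀ t i, ((targetState E ℓ v k).withTail t).edge i = some (edgeAt v i) :=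
    fun t i => edge_targetState (E := E) (ℓ := ℓ) (v := v) i.2
  simp only [Walker.touches_withTail, ht, hedge, Option.some.injEq]
  have h2 : ∀ f : Fin k → ℕ, ((targetState E ℓ v k).withTail f).tail j = f j := fun _ => rfl
  rw [h2]
  have h3 : (targetState E ℓ v k).tail j = 0 := rfl
  have h4 : ((labelled ℓ σ none).filter fun e => decide (v j.castSucc ∈ e)).Nodup :=
    (hσ.filter _).filter _
  rw [h3, zero_add]
  simp only [ht]
  rw [← List.toFinset_card_of_nodup h4, degHat, ← Finset.card_union_of_disjoint]
  · congr 1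
    ext e
    simp only [Finset.mem_union, Finset.mem_filter, Finset.mem_univ, true_and, List.mem_toFinset,
      List.mem_filter, labelled, decide_eq_true_eq, ← hE]
    constructor
    · rintro (⟨h5, i, rfl⟩ | ⟨⟨h5, h6⟩, h7⟩)
      · have := hvE i
        rw [← hE, List.mem_toFinset] at this
        exact ⟨this, h5, Or.inr ⟨i, rfl⟩⟩
      · exact ⟨h5, h7, Or.inl h6⟩
    · rintro ⟨h5, h6, h7 | h7⟩
      · exact Or.inr ⟨⟨h5, h7⟩, h6⟩
      · exact Or.inl ⟨h6, h7⟩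
  · rw [Finset.disjoint_left]
    intro e he he'
    simp only [Finset.mem_filter, Finset.mem_univ, true_and, List.mem_toFinset,
      List.mem_filter, labelled, decide_eq_true_eq] at he he'
    obtain ⟨-, i, rfl⟩ := he
    rw [hv i] at he'
    exact absurd he'.1.2 (by simp)

theorem blockDeg_pos (hv : LabelsFit ℓ v) (hvE : ∀ j, edgeAt v j ∈ E) {j : Fin k}
    (hj : firstUse v j = j) : 0 < blockDeg E ℓ v j :=
  Finset.card_pos.2 ⟨edgeAt v j, Finset.mem_filter.2
    ⟨hvE j, by rw [hv j, hj], Sym2.mem_mk_left _ _⟩⟩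

/-- For a new step γ = η/|H|, so η cancels in η/(γ d̂) and |H|/d̂ remains; for an old step γ = 1 and
η stays. -/
theorem acceptProb_target {η : ℝ} (hη : 0 < η) (hσ : σ.Nodup) (hE : σ.toFinset = E)
    (hv : LabelsFit ℓ v) (hvE : ∀ j, edgeAt v j ∈ E) :
    (((labelled ℓ σ none).foldl Walker.stepTail (targetState E ℓ v k)).acceptProb η : ℝ) =
      ∏ j, if firstUse v j = j then min ((blockDeg E ℓ v j : ℝ) / degHat E ℓ v j) 1
        else min (η / degHat E ℓ v j) 1 := by
  rw [Walker.acceptProb, NNReal.coe_prod]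
  refine Finset.prod_congr rfl fun j _ => ?_
  have hcnt : ((labelled ℓ σ none).foldl Walker.stepTail (targetState E ℓ v k)).gamma η j =
      if firstUse v j = j then 1 / (blockDeg E ℓ v j : ℝ) * η else 1 := by
    rw [Walker.foldl_stepTail, Walker.gamma]
    by_cases hj : firstUse v j = j
    · rw [if_pos hj, if_pos (by exact hj)]
      simp [Walker.withTail, targetState, hj]
    · rw [if_neg hj, if_neg (by exact hj)]
  rw [degEst_target hσ hE hv hvE, hcnt, NNReal.coe_min, NNReal.coe_one]
  split_ifs with hj
  · have hb : (0 : ℝ) < blockDeg E ℓ v j := by exact_mod_cast blockDeg_pos hv hvE hj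
    rw [Real.coe_toNNReal _ (by positivity)]
    congr 1
    field_simp
  · rw [Real.coe_toNNReal _ (by positivity), one_mul]

/-- The outcome of a single walker, for given block labels of the edges. -/
theorem expect_start_runBlocks [NeZero n] {η : ℝ} (hη : 0 < η) (hσ : σ.Nodup)
    (hE : σ.toFinset = E) (hℓ : ∀ e, ℓ e ≠ none → e ∈ E) (v : Fin (k + 1) → Fin n) :
    (expect (Walker.start n k) fun w => expect
      (w.runBlocks (fun i => labelled ℓ σ (some i)) (List.finRange k)) fun w =>
        ((labelled ℓ σ none).foldl Walker.stepTail w).finish η (some v)) =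
      ENNReal.ofReal (walkMass η E ℓ v) := by
  classical
  rw [Walker.start, expect_bind, expect_uniformOfFintype]
  simp only [expect_map, expect_uniformOfFintype, Fintype.card_fin, card_template,
    Function.comp_def, ← Finset.mul_sum]
  set X : Fin n → Template k → ℝ≥0∞ := fun u π => expect
    ((initial u π).runBlocks (fun i => labelled ℓ σ (some i)) (List.finRange k)) fun w =>
      ((labelled ℓ σ none).foldl Walker.stepTail w).finish η (some v) with hX
  change (n : ℝ≥0∞)⁻¹ * ((k ! : ℝ≥0∞)⁻¹ * ∑ u, ∑ π, X u π) = _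
  -- A nonzero contribution pins down the start vertex and the template, so the double sum collapses
  -- to one term; this is the source of the factor 1/(n k!).
  have hX0 : ∀ u π, X u π ≠ 0 → u = v 0 ∧ π = templateOf v ∧ LabelsFit ℓ v := by
    intro u π h
    obtain ⟨s, hs, h⟩ := exists_of_expect_ne_zero h
    rw [Walker.finish_apply, Walker.walk_foldl_stepTail] at h
    exact of_mem_support_of_walk hs (ite_ne_right_iff.1 h).1
  by_cases hv : LabelsFit ℓ v
  · have hvE : ∀ j, edgeAt v j ∈ E := fun j => hℓ _ (by rw [hv j]; simp)
    have h1 := expect_runBlocks_drop hσ hE hv hvE (fun w =>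
      ((labelled ℓ σ none).foldl Walker.stepTail w).finish η (some v)) (fun s ht hs i hi => by
        rw [Walker.finish_apply, Walker.walk_foldl_stepTail] at hs
        have hr := (res_of_walk (ite_ne_right_iff.1 hs).1 i).2
        rwa [ht, idx_templateOf, hi] at hr) k 0 (zero_add k)
    rw [targetState_zero, List.drop_zero, Walker.finish_apply, Walker.walk_foldl_stepTail,
      if_pos walk_targetState] at h1
    rw [Finset.sum_eq_single (v 0), Finset.sum_eq_single (templateOf v), hX]
    · simp only
      rw [h1, ← ENNReal.ofReal_coe_nnreal, acceptProb_target hη hσ hE hv hvE, walkMass, if_pos hv]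
      have h2 : (∏ j, if firstUse v j = j then
          1 / (blockDeg E ℓ v j : ℝ) * min ((blockDeg E ℓ v j : ℝ) / degHat E ℓ v j) 1
          else min (η / degHat E ℓ v j) 1) =
          (∏ i ∈ Finset.univ.filter fun i : Fin k => 0 ≤ (i : ℕ) ∧ firstUse v i = i,
            (blockDeg E ℓ v i : ℝ)⁻¹) *
          ∏ j, if firstUse v j = j then min ((blockDeg E ℓ v j : ℝ) / degHat E ℓ v j) 1
            else min (η / degHat E ℓ v j) 1 := by
        rw [Finset.prod_filter, ← Finset.prod_mul_distrib]
        refine Finset.prod_congr rfl fun j _ => ?_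
        by_cases hj : firstUse v j = j <;> simp [hj]
      have h3 : ∀ m : ℕ, m ≠ 0 → ENNReal.ofReal ((m : ℝ)⁻¹) = (m : ℝ≥0∞)⁻¹ := fun m hm => by
        rw [ENNReal.ofReal_inv_of_pos (by positivity), ENNReal.ofReal_natCast]
      rw [h2, one_div, one_div, ENNReal.ofReal_mul (by positivity),
        ENNReal.ofReal_mul (by positivity), ENNReal.ofReal_mul
          (Finset.prod_nonneg fun i _ => by positivity),
        h3 n (NeZero.ne n), h3 _ (Nat.factorial_ne_zero k), mul_assoc]
      congr 3
      rw [ENNReal.ofReal_prod_of_nonneg fun i _ => by positivity]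
      refine Finset.prod_congr rfl fun i hi => ?_
      exact (h3 _ (blockDeg_pos hv hvE (Finset.mem_filter.1 hi).2.2).ne').symm
    · intro π _ hπ
      by_contra h
      exact hπ (hX0 _ _ h).2.1
    · exact fun h => absurd (Finset.mem_univ _) h
    · intro u _ hu
      refine Finset.sum_eq_zero fun π _ => ?_
      by_contra h
      exact hu (hX0 _ _ h).1
    · exact fun h => absurd (Finset.mem_univ _) h
  · have h1 : ∀ u π, X u π = 0 := fun u π => by
      by_contra h
      exact hv (hX0 u π h).2.2
    simp [h1, walkMass, hv]

/-- The outcome of a walk, for block sizes that give every edge of the stream its label. -/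
theorem walkDist_apply_some [NeZero n] {η : ℝ} (hη : 0 < η) (hσ : σ.Nodup)
    (hE : σ.toFinset = E) (hℓ : ∀ e, ℓ e ≠ none → e ∈ E) {c : Fin k → ℕ}
    (hc : ∑ j, c j ≤ σ.length) (hlab : labelSeq σ.length c = σ.map ℓ)
    (v : Fin (k + 1) → Fin n) :
    walkDist n k η c σ (some v) = ENNReal.ofReal (walkMass η E ℓ v) := by
  rw [← expect_start_runBlocks hη hσ hE hℓ v, walkDist, bind_apply_eq_expect]
  congr 1
  funext w
  rw [bind_apply_eq_expect, hlab]
  have h1 : (σ.map ℓ).zip σ = σ.map fun e => (ℓ e, e) := by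
    conv_lhs => rw [← List.map_id σ, List.map_map]
    rw [List.zip_map']
    rfl
  have h2 := hlab
  rw [labelSeq_eq _ _ ((length_flatLabels c).trans_le hc)] at h2
  -- The labels along the stream are sorted, so the stream is the concatenation of its blocks
  -- followed by its tail.
  have h3 : σ = ((List.finRange k).flatMap fun j => labelled ℓ σ (some j)) ++
      labelled ℓ σ none := eq_flatMap_filter_append h2.symm
  have h4 : ∀ w : Walker n k, runList Walker.stepLabel (σ.map fun e => (ℓ e, e)) w =
      (w.runBlocks (fun i => labelled ℓ σ (some i)) (List.finRange k)).bind fun w =>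
        PMF.pure ((labelled ℓ σ none).foldl Walker.stepTail w) := by
    intro w
    rw [runList_map]
    conv_lhs => rw [h3]
    rw [runList_append, runList_flatMap]
    congr 1
    · refine runList_congr (fun j _ s => ?_) w
      refine runList_congr (fun e he s => ?_) s
      have := (List.mem_filter.1 he).2
      simp only [decide_eq_true_eq] at this
      rw [this]
      rfl
    · funext w
      rw [← runList_pure]
      refine runList_congr (fun e he s => ?_) w
      have := (List.mem_filter.1 he).2
      simp only [decide_eq_true_eq] at this
      rw [this]
      rfl
  rw [h1, h4, expect_bind]
  congr 1
  funext w
  rw [expect_pure]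

end Single

end RandomWalkStream

namespace RandomWalkStream

/-! ### Independent block labels -/

section BlockLabels

/-- The probability of a block label. -/
noncomputable def labelWeight (η : ℝ) {k : ℕ} (a : Option (Fin k)) : ℝ :=
  a.elim (1 - k * η) fun _ => η

theorem labelWeight_nonneg {η : ℝ} {k : ℕ} (h0 : 0 ≤ η) (h1 : k * η ≤ 1) (a : Option (Fin k)) :
    0 ≤ labelWeight η a := by
  cases a with
  | none => exact sub_nonneg.2 h1
  | some j => exact h0

theorem sum_labelWeight (η : ℝ) (k : ℕ) : ∑ a : Option (Fin k), labelWeight η a = 1 := by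
  simp [Fintype.sum_option, labelWeight]

/-- The block label of a block number. -/
def toLabel (k : ℕ) (i : ℕ) : Option (Fin k) := if h : i < k then some ⟨i, h⟩ else none

theorem toLabel_eq_some_iff {k i : ℕ} {j : Fin k} : toLabel k i = some j ↔ (j : ℕ) = i := by
  unfold toLabel
  split_ifs with h
  · simp [Fin.ext_iff, eq_comm]
  · simp only [false_iff]
    rintro rfl
    exact h j.2

/-- `hj` keeps the whole block inside [0, 1]; otherwise it would be cut off and have smaller
measure. -/
theorem timestampBlock_apply {η : ℝ} (hη : 0 < η) {j : ℕ} (hj : ((j : ℝ) + 1) * η ≤ 1) :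
    timestampBlock η j = ENNReal.ofReal η := by
  rw [timestampBlock, MeasureTheory.Measure.toPMF_apply,
    MeasureTheory.Measure.map_apply (measurable_block η) (measurableSet_singleton j)]
  have h0 : (j : ℝ) * η ∈ unitInterval := ⟨by positivity, by nlinarith⟩
  have h1 : ((j : ℝ) + 1) * η ∈ unitInterval := ⟨by positivity, hj⟩
  have h2 : (fun t : unitInterval => ⌊(t : ℝ) / η⌋₊) ⁻¹' {j} =
      Set.Ico (⟨_, h0⟩ : unitInterval) ⟨_, h1⟩ := by
    ext t
    have ht : (0 : ℝ) ≤ (t : ℝ) / η := div_nonneg t.2.1 hη.le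
    simp only [Set.mem_preimage, Set.mem_singleton_iff, Nat.floor_eq_iff ht, Set.mem_Ico,
      ← Subtype.coe_le_coe, ← Subtype.coe_lt_coe, le_div_iff₀ hη, div_lt_iff₀ hη]
  rw [h2, unitInterval.volume_Ico]
  congr 1
  simp only
  ring

theorem map_toLabel_apply {η : ℝ} {k : ℕ} (hη : 0 < η) (hk : k * η ≤ 1) (a : Option (Fin k)) :
    (timestampBlock η).map (toLabel k) a = ENNReal.ofReal (labelWeight η a) := by
  set p := (timestampBlock η).map (toLabel k) with hp
  have hsome : ∀ j : Fin k, p (some j) = ENNReal.ofReal η := by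
    intro j
    rw [hp, PMF.map_apply, tsum_eq_single (j : ℕ), if_pos (toLabel_eq_some_iff.2 rfl).symm]
    · refine timestampBlock_apply hη (le_trans ?_ hk)
      have : (j : ℝ) + 1 ≤ k := by exact_mod_cast j.2
      gcongr
    · exact fun i hi => if_neg fun h => hi (toLabel_eq_some_iff.1 h.symm).symm
  cases a with
  | some j => exact hsome j
  | none =>
    have h1 : p none + (k : ℝ≥0∞) * ENNReal.ofReal η = 1 := by
      rw [← p.tsum_coe, tsum_fintype, Fintype.sum_option]
      simp [hsome]
    have h2 : (k : ℝ≥0∞) * ENNReal.ofReal η = ENNReal.ofReal (k * η) := by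
      rw [ENNReal.ofReal_mul (Nat.cast_nonneg k), ENNReal.ofReal_natCast]
    rw [h2] at h1
    change _ = ENNReal.ofReal (1 - k * η)
    rw [ENNReal.ofReal_sub _ (by positivity), ENNReal.ofReal_one, ← h1,
      ENNReal.add_sub_cancel_right ENNReal.ofReal_ne_top]

/-- The number of edges of every block. -/
def labelCounts {ι : Type} [Fintype ι] {k : ℕ} (L : ι → Option (Fin k)) (j : Fin k) : ℕ :=
  (Finset.univ.filter fun i => L i = some j).card

theorem labelCounts_cons {m k : ℕ} (a : Option (Fin k)) (L : Fin m → Option (Fin k)) :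
    labelCounts (Fin.cons a L : Fin (m + 1) → Option (Fin k)) =
      fun j => if a = some j then labelCounts L j + 1 else labelCounts L j := by
  funext j
  simp only [labelCounts, Finset.card_filter, Fin.sum_univ_succ, Fin.cons_zero, Fin.cons_succ]
  split_ifs <;> omega

theorem sum_cons {m : ℕ} {α M : Type} [Fintype α] [AddCommMonoid M]
    (f : (Fin (m + 1) → α) → M) :
    ∑ v, f v = ∑ a, ∑ v : Fin m → α, f (Fin.cons a v) := by
  rw [← Fintype.sum_prod_type' (fun a (v : Fin m → α) => f (Fin.cons a v))]
  exact (Fintype.sum_equiv (Fin.consEquiv fun _ => α) _ _ fun _ => rfl).symm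

/-- Counting timestamps block by block amounts to drawing m independent labels and forgetting which
timestamp has which. The algorithm stores only the counts; the analysis brings the labels back. -/
theorem expect_blockSizes {η : ℝ} {k : ℕ} (hη : 0 < η) (hk : k * η ≤ 1) (m : ℕ)
    (g : (Fin k → ℕ) → ℝ≥0∞) :
    expect (blockSizes k η m) g = ∑ L : Fin m → Option (Fin k),
      (∏ i, ENNReal.ofReal (labelWeight η (L i))) * g (labelCounts L) := by
  induction m generalizing g with
  | zero =>
    rw [blockSizes, expect_pure, Fintype.sum_unique, Fin.prod_univ_zero, one_mul]
    congr 1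
  | succ m ih =>
    have h1 : ∀ c : Fin k → ℕ, expect ((timestampBlock η).map fun i =>
        fun j : Fin k => if (j : ℕ) = i then c j + 1 else c j) g =
        ∑ a : Option (Fin k), ENNReal.ofReal (labelWeight η a) *
          g fun j => if a = some j then c j + 1 else c j := by
      intro c
      have h2 : (fun (i : ℕ) (j : Fin k) => if (j : ℕ) = i then c j + 1 else c j) =
          (fun a : Option (Fin k) => fun j => if a = some j then c j + 1 else c j) ∘
            toLabel k := by
        funext i j
        simp only [Function.comp_apply, toLabel_eq_some_iff]
      rw [h2, ← PMF.map_comp, expect_map, expect_fintype]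
      simp only [map_toLabel_apply hη hk]
      rfl
    rw [blockSizes, expect_bind, ih, sum_cons, Finset.sum_comm]
    refine Finset.sum_congr rfl fun L _ => ?_
    rw [h1, Finset.mul_sum]
    refine Finset.sum_congr rfl fun a _ => ?_
    rw [Fin.prod_univ_succ, labelCounts_cons]
    simp only [Fin.cons_zero, Fin.cons_succ]
    ring

end BlockLabels

/-! ### A random order with random block sizes -/

section Shuffle

variable {n k : ℕ}

theorem card_fiber_eq_count {m : ℕ} {α : Type} [BEq α] [LawfulBEq α] [DecidableEq α]
    (f : Fin m → α) (a : α) :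
    (Finset.univ.filter fun i => f i = a).card = (List.ofFn f).count a := by
  rw [Finset.card_filter]
  induction m with
  | zero => simp
  | succ m ih =>
    rw [Fin.sum_univ_succ, List.ofFn_succ, List.count_cons, ← ih fun i => f i.succ, add_comm]
    simp

theorem count_flatLabels (js : List (Fin k)) (c : Fin k → ℕ) (j : Fin k) (hjs : js.Nodup) :
    (flatLabels js c).count (some j) = if j ∈ js then c j else 0 := by
  induction js with
  | nil => simp [flatLabels]
  | cons i js ih =>
    have h4 : flatLabels (i :: js) c =
      List.replicate (c i) (some i) ++ flatLabels js c := rfl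
    rw [h4, List.count_append, ih (List.nodup_cons.1 hjs).2, List.count_replicate]
    have hi := (List.nodup_cons.1 hjs).1
    by_cases hij : i = j
    · subst hij
      simp [hi]
    · simp [hij, Ne.symm hij]

theorem sum_labelCounts_le {m : ℕ} (L : Fin m → Option (Fin k)) : ∑ j, labelCounts L j ≤ m := by
  have h := Finset.card_eq_sum_card_fiberwise (s := Finset.univ) (t := Finset.univ) (f := L)
    (fun _ _ => Finset.mem_univ _)
  rw [Finset.card_univ, Fintype.card_fin, Fintype.sum_option] at h
  simp only [labelCounts]
  omega

/-- Both sequences contain every block label equally often, and then also the tail label, as both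
have length m. Matching the fibres gives the permutation, which sorts the timestamps. -/
theorem exists_perm_labelSeq {m : ℕ} (L : Fin m → Option (Fin k)) :
    ∃ τ : Equiv.Perm (Fin m), labelSeq m (labelCounts L) = List.ofFn fun i => L (τ i) := by
  set c := labelCounts L with hc
  have hlen := length_labelSeq m c
  obtain ⟨f, hf⟩ : ∃ f : Fin m → Option (Fin k), List.ofFn f = labelSeq m c := by
    refine ⟨fun i => (labelSeq m c)[i]'(by rw [hlen]; exact i.2), ?_⟩
    refine List.ext_getElem (by simp [hlen]) fun i h1 h2 => by simp
  have hsum : ∑ j, c j ≤ m := sum_labelCounts_le L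
  have hcount : ∀ j, (List.ofFn f).count (some j) = (List.ofFn L).count (some j) := by
    intro j
    rw [hf, labelSeq_eq m c (by rwa [length_flatLabels]), List.count_append,
      count_flatLabels _ _ _ (List.nodup_finRange k), List.count_replicate,
      ← card_fiber_eq_count]
    simp [hc, labelCounts]
  have hcard : ∀ a, (Finset.univ.filter fun i => f i = a).card =
      (Finset.univ.filter fun i => L i = a).card := by
    have hs : ∀ j, (Finset.univ.filter fun i => f i = some j).card =
        (Finset.univ.filter fun i => L i = some j).card := fun j => by
      rw [card_fiber_eq_count, card_fiber_eq_count, hcount]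
    intro a
    cases a with
    | some j => exact hs j
    | none =>
      have h1 := Finset.card_eq_sum_card_fiberwise (s := Finset.univ) (t := Finset.univ) (f := f)
        (fun _ _ => Finset.mem_univ _)
      have h2 := Finset.card_eq_sum_card_fiberwise (s := Finset.univ) (t := Finset.univ) (f := L)
        (fun _ _ => Finset.mem_univ _)
      rw [Fintype.sum_option] at h1 h2
      simp only [hs] at h1
      omega
  have e : ∀ a, {i // f i = a} ≃ {i // L i = a} := fun a => Fintype.equivOfCardEq (by
    rw [Fintype.card_subtype, Fintype.card_subtype, hcard a])
  refine ⟨Equiv.ofFiberEquiv e, ?_⟩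
  rw [← hf]
  exact congrArg List.ofFn (funext fun i => (Equiv.ofFiberEquiv_map e i).symm)

/-- Edge labels as labels of all pairs of vertices. -/
def extendLabels {E : Finset (Sym2 (Fin n))} (ℓ : E → Option (Fin k)) (e : Sym2 (Fin n)) :
    Option (Fin k) :=
  if h : e ∈ E then ℓ ⟨e, h⟩ else none

theorem extendLabels_coe {E : Finset (Sym2 (Fin n))} (ℓ : E → Option (Fin k)) (e : E) :
    extendLabels ℓ e = ℓ e := dif_pos e.2

theorem mem_of_extendLabels_ne {E : Finset (Sym2 (Fin n))} (ℓ : E → Option (Fin k))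
    {e : Sym2 (Fin n)} (h : extendLabels ℓ e ≠ none) : e ∈ E := by
  by_contra he
  exact h (dif_neg he)

/-- In a random order with random block sizes, the labels of the edges are independent. -/
theorem expect_stream_le (G : SimpleGraph (Fin n)) [DecidableRel G.Adj] {η : ℝ} (hη : 0 < η)
    (hk : k * η ≤ 1) (F : List (Sym2 (Fin n)) → (Fin k → ℕ) → ℝ≥0∞)
    (Φ : (Sym2 (Fin n) → Option (Fin k)) → ℝ≥0∞)
    (hF : ∀ σ c ℓ, σ.Nodup → σ.toFinset = G.edgeFinset → ∑ j, c j ≤ σ.length →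
      (∀ e, ℓ e ≠ none → e ∈ G.edgeFinset) → labelSeq σ.length c = σ.map ℓ → F σ c ≤ Φ ℓ) :
    (expect (randomStream G) fun σ => expect (blockSizes k η G.edgeFinset.card) (F σ)) ≤
      ∑ ℓ : G.edgeFinset → Option (Fin k),
        (∏ e, ENNReal.ofReal (labelWeight η (ℓ e))) * Φ (extendLabels ℓ) := by
  set m := G.edgeFinset.card with hm
  rw [randomStream, expect_map, expect_uniformOfFintype]
  simp only [Function.comp_apply, expect_blockSizes hη hk]
  set W : (Fin m → Option (Fin k)) → ℝ≥0∞ :=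
    fun L => ∏ i, ENNReal.ofReal (labelWeight η (L i)) with hW
  choose τ hτ using fun L : Fin m → Option (Fin k) => exists_perm_labelSeq L
  have h1 : ∀ (o : Fin m ≃ G.edgeFinset) (L : Fin m → Option (Fin k)),
      F (List.ofFn fun i => (o i : Sym2 (Fin n))) (labelCounts L) ≤
        Φ (extendLabels fun e => L (((τ L).symm.trans o).symm e)) := by
    intro o L
    refine hF _ _ _ ?_ ?_ ?_ (fun e he => mem_of_extendLabels_ne _ he) ?_
    · exact List.nodup_ofFn.2 (Subtype.val_injective.comp o.injective)
    · ext e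
      rw [List.mem_toFinset, List.mem_ofFn]
      constructor
      · rintro ⟨i, rfl⟩
        exact (o i).2
      · exact fun he => ⟨o.symm ⟨e, he⟩, by simp⟩
    · rw [List.length_ofFn]
      exact sum_labelCounts_le L
    · rw [List.length_ofFn, hτ, List.map_ofFn]
      refine congrArg List.ofFn (funext fun i => ?_)
      rw [Function.comp_apply, extendLabels_coe]
      simp
  -- A uniformly random order stays uniform when the positions are permuted, even by a permutation
  -- that depends on the labels. So the edges may be treated as if they carried the unsorted labels.
  have h2 : ∀ L : Fin m → Option (Fin k),
      ∑ o : Fin m ≃ G.edgeFinset, Φ (extendLabels fun e => L (((τ L).symm.trans o).symm e)) =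
        ∑ o : Fin m ≃ G.edgeFinset, Φ (extendLabels fun e => L (o.symm e)) := by
    intro L
    let r : (Fin m ≃ G.edgeFinset) ≃ (Fin m ≃ G.edgeFinset) :=
      { toFun := fun o => (τ L).symm.trans o
        invFun := fun o => (τ L).trans o
        left_inv := fun o => by ext; simp
        right_inv := fun o => by ext; simp }
    exact Fintype.sum_equiv r _ _ fun o => rfl
  -- For a fixed order, transporting labels from positions to edges preserves the product weight.
  have h3 : ∀ o : Fin m ≃ G.edgeFinset,
      ∑ L, W L * Φ (extendLabels fun e => L (o.symm e)) =
        ∑ ℓ : G.edgeFinset → Option (Fin k),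
          (∏ e, ENNReal.ofReal (labelWeight η (ℓ e))) * Φ (extendLabels ℓ) := by
    intro o
    refine Fintype.sum_equiv (Equiv.arrowCongr o (Equiv.refl _)) _ _ fun L => ?_
    congr 1
    rw [hW]
    exact Fintype.prod_equiv o _ _ fun i => by simp [Equiv.arrowCongr]
  calc _ ≤ (Fintype.card (Fin m ≃ G.edgeFinset) : ℝ≥0∞)⁻¹ * ∑ o : Fin m ≃ G.edgeFinset, ∑ L,
        W L * Φ (extendLabels fun e => L (((τ L).symm.trans o).symm e)) := by
        gcongr with o _ L _
        exact h1 o L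
    _ = (Fintype.card (Fin m ≃ G.edgeFinset) : ℝ≥0∞)⁻¹ * ∑ o : Fin m ≃ G.edgeFinset, ∑ L,
        W L * Φ (extendLabels fun e => L (o.symm e)) := by
        rw [Finset.sum_comm, Finset.sum_comm (s := (Finset.univ : Finset (Fin m ≃ _)))]
        simp only [← Finset.mul_sum, h2]
    _ = _ := by
        rw [Finset.sum_congr rfl fun o _ => h3 o, Finset.sum_const, Finset.card_univ,
          nsmul_eq_mul, ← mul_assoc, ENNReal.inv_mul_cancel
            (by exact_mod_cast Fintype.card_ne_zero) (ENNReal.natCast_ne_top _), one_mul]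

end Shuffle

end RandomWalkStream

namespace RandomWalkStream

/-! ### Sums over walks -/

section WalkSums

variable {n : ℕ} (G : SimpleGraph (Fin n)) [DecidableRel G.Adj]

/-- The transition probability of the simple random walk. -/
noncomputable def stepWeight (u x : Fin n) : ℝ := if G.Adj u x then 1 / (G.degree u : ℝ) else 0

/-- The probability of a walk, given its start vertex. -/
noncomputable def pathWeight {k : ℕ} (v : Fin (k + 1) → Fin n) : ℝ :=
  ∏ j : Fin k, stepWeight G (v j.castSucc) (v j.succ)

/-- The probability of a walk with a uniformly random start vertex. -/
noncomputable def walkWeight {k : ℕ} (v : Fin (k + 1) → Fin n) : ℝ :=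
  1 / (n : ℝ) * pathWeight G v

theorem stepWeight_nonneg (u x : Fin n) : 0 ≤ stepWeight G u x := by
  unfold stepWeight
  split_ifs <;> positivity

theorem pathWeight_nonneg {k : ℕ} (v : Fin (k + 1) → Fin n) : 0 ≤ pathWeight G v :=
  Finset.prod_nonneg fun _ _ => stepWeight_nonneg G _ _

theorem walkWeight_nonneg {k : ℕ} (v : Fin (k + 1) → Fin n) : 0 ≤ walkWeight G v :=
  mul_nonneg (by positivity) (pathWeight_nonneg G v)

theorem pathWeight_snoc {k : ℕ} (v : Fin (k + 1) → Fin n) (x : Fin n) :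
    pathWeight G (Fin.snoc v x : Fin (k + 2) → Fin n) =
      pathWeight G v * stepWeight G (v (Fin.last k)) x := by
  rw [pathWeight, Fin.prod_univ_castSucc, pathWeight]
  congr 1
  · refine Finset.prod_congr rfl fun j _ => ?_
    rw [Fin.succ_castSucc]
    simp only [Fin.snoc_castSucc]
  · rw [Fin.succ_last, Fin.snoc_last, Fin.snoc_castSucc]

theorem sum_snoc {m : ℕ} {α M : Type} [Fintype α] [AddCommMonoid M]
    (f : (Fin (m + 1) → α) → M) :
    ∑ v, f v = ∑ v : Fin m → α, ∑ a, f (Fin.snoc v a) := by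
  rw [← Fintype.sum_prod_type' (fun (v : Fin m → α) a => f (Fin.snoc v a))]
  exact (Fintype.sum_equiv ((Equiv.prodComm _ _).trans (Fin.snocEquiv fun _ => α)) _ _
    fun _ => rfl).symm

theorem zero_snoc {k : ℕ} (v : Fin (k + 1) → Fin n) (x : Fin n) :
    (Fin.snoc v x : Fin (k + 2) → Fin n) 0 = v 0 := by
  rw [← Fin.castSucc_zero, Fin.snoc_castSucc]

theorem sum_stepWeight (hdeg : ∀ v, 0 < G.degree v) (u : Fin n) : ∑ x, stepWeight G u x = 1 := by
  have h : (0 : ℝ) < G.degree u := by exact_mod_cast hdeg u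
  simp only [stepWeight]
  rw [← Finset.sum_filter, Finset.sum_const, ← SimpleGraph.neighborFinset_eq_filter,
    SimpleGraph.card_neighborFinset_eq_degree, nsmul_eq_mul]
  field_simp

/-- The degree of a vertex as a real number. -/
noncomputable def realDegree (u : Fin n) : ℝ := G.degree u

theorem sum_degree_mul_stepWeight (hdeg : ∀ v, 0 < G.degree v) (x : Fin n) :
    ∑ u, realDegree G u * stepWeight G u x = realDegree G x := by
  have h : ∀ u, realDegree G u * stepWeight G u x = if G.Adj x u then 1 else 0 := by
    intro u
    have h : (0 : ℝ) < G.degree u := by exact_mod_cast hdeg u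
    by_cases hx : G.Adj u x
    · rw [stepWeight, if_pos hx, if_pos hx.symm, realDegree]
      field_simp
    · rw [stepWeight, if_neg hx, if_neg fun h => hx h.symm, mul_zero]
  simp only [h]
  rw [← Finset.sum_filter, Finset.sum_const, ← SimpleGraph.neighborFinset_eq_filter,
    SimpleGraph.card_neighborFinset_eq_degree, nsmul_eq_mul, mul_one, realDegree]

theorem walkProb_eq_sum (k : ℕ) (u x : Fin n) :
    walkProb G k u x =
      ∑ v : Fin (k + 1) → Fin n, if v 0 = u ∧ v (Fin.last k) = x then pathWeight G v else 0 := by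
  induction k generalizing x with
  | zero =>
    rw [walkProb]
    rw [← (Equiv.funUnique (Fin 1) (Fin n)).symm.sum_comp]
    have h1 : ∀ i : Fin n, ((Equiv.funUnique (Fin 1) (Fin n)).symm i) (Fin.last 0) = i :=
      fun i => rfl
    have h2 : ∀ i : Fin n, ((Equiv.funUnique (Fin 1) (Fin n)).symm i) 0 = i :=
      fun i => rfl
    simp only [h1, h2, pathWeight, Fin.prod_univ_zero]
    rw [Finset.sum_eq_single u]
    · simp [eq_comm]
    · intro i _ hi
      simp [hi]
    · simp
  | succ k ih =>
    have h1 : ∀ w ∈ G.neighborFinset x, walkProb G k u w * (1 / (G.degree w : ℝ)) =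
        walkProb G k u w * stepWeight G w x := by
      intro w hw
      rw [stepWeight, if_pos ((G.mem_neighborFinset x w).1 hw).symm]
    rw [walkProb, Finset.sum_congr rfl h1, sum_snoc]
    rw [Finset.sum_subset (Finset.subset_univ _)]
    · simp only [ih, Finset.sum_mul]
      rw [Finset.sum_comm]
      refine Finset.sum_congr rfl fun v _ => ?_
      simp only [zero_snoc, Fin.snoc_last, pathWeight_snoc]
      rw [Finset.sum_eq_single (v (Fin.last k)), Finset.sum_eq_single x]
      · by_cases h : v 0 = u <;> simp [h]
      · intro y _ hy
        simp [hy]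
      · simp
      · intro y _ hy
        simp [hy.symm]
      · simp
    · intro w _ hw
      rw [stepWeight, if_neg, mul_zero]
      exact fun h => hw ((G.mem_neighborFinset x w).2 h.symm)

theorem sum_pathWeight (hdeg : ∀ v, 0 < G.degree v) (k : ℕ) :
    ∑ v : Fin (k + 1) → Fin n, pathWeight G v = n := by
  induction k with
  | zero => simp [pathWeight]
  | succ k ih =>
    rw [sum_snoc]
    simp only [pathWeight_snoc, ← Finset.mul_sum, sum_stepWeight G hdeg, mul_one, ih]

theorem sum_walkWeight [NeZero n] (hdeg : ∀ v, 0 < G.degree v) (k : ℕ) :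
    ∑ v : Fin (k + 1) → Fin n, walkWeight G v = 1 := by
  have : (n : ℝ) ≠ 0 := by exact_mod_cast NeZero.ne n
  simp only [walkWeight, ← Finset.mul_sum, sum_pathWeight G hdeg]
  field_simp

theorem returnProb_eq_sum (k : ℕ) :
    returnProb G k = ∑ v ∈ Finset.univ.filter
      (fun v : Fin (k + 1) → Fin n => v (Fin.last k) = v 0), walkWeight G v := by
  simp only [returnProb, walkWeight, walkProb_eq_sum, ← Finset.mul_sum]
  rw [Finset.sum_comm, Finset.sum_filter]
  congr 1
  refine Finset.sum_congr rfl fun v _ => ?_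
  rw [Finset.sum_eq_single (v 0)]
  · simp
  · intro u _ hu
    simp [hu.symm]
  · simp

/-- Stationarity of the degree measure: it puts mass 1 on every directed edge, so the mass that
flows into a vertex is again its degree. -/
theorem sum_degree_mul_pathWeight_last (hdeg : ∀ v, 0 < G.degree v) (k : ℕ) (x : Fin n) :
    ∑ v : Fin (k + 1) → Fin n,
      (if v (Fin.last k) = x then realDegree G (v 0) * pathWeight G v else 0) =
        realDegree G x := by
  induction k generalizing x with
  | zero =>
    rw [← (Equiv.funUnique (Fin 1) (Fin n)).symm.sum_comp, Finset.sum_eq_single x]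
    · have h1 : (Equiv.funUnique (Fin 1) (Fin n)).symm x 0 = x := rfl
      simp [pathWeight, h1]
    · intro i _ hi
      exact if_neg hi
    · simp
  | succ k ih =>
    rw [sum_snoc]
    simp only [zero_snoc, Fin.snoc_last, pathWeight_snoc]
    have h1 : ∀ v : Fin (k + 1) → Fin n, (∑ a, if a = x then
        realDegree G (v 0) * (pathWeight G v * stepWeight G (v (Fin.last k)) a) else 0) =
        ∑ y, (if v (Fin.last k) = y then realDegree G (v 0) * pathWeight G v else 0) *
          stepWeight G y x := by
      intro v
      rw [Finset.sum_ite_eq' , if_pos (Finset.mem_univ _),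
        Finset.sum_eq_single (v (Fin.last k))]
      · rw [if_pos rfl, mul_assoc]
      · intro y _ hy
        rw [if_neg hy.symm, zero_mul]
      · simp
    simp only [h1]
    rw [Finset.sum_comm]
    simp only [← Finset.sum_mul, ih]
    exact sum_degree_mul_stepWeight G hdeg x

/-- The steps after time j are summed out, each with total probability 1, until j is the last
position. -/
theorem sum_degree_mul_pathWeight (hdeg : ∀ v, 0 < G.degree v) {k : ℕ} (j : Fin (k + 1))
    (x : Fin n) :
    ∑ v : Fin (k + 1) → Fin n,
      (if v j = x then realDegree G (v 0) * pathWeight G v else 0) = realDegree G x := by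
  induction k with
  | zero =>
    obtain rfl : j = Fin.last 0 := Fin.ext (by have := j.2; simp only [Fin.val_last]; omega)
    exact sum_degree_mul_pathWeight_last G hdeg 0 x
  | succ k ih =>
    induction j using Fin.lastCases with
    | last => exact sum_degree_mul_pathWeight_last G hdeg _ x
    | cast i =>
      rw [sum_snoc]
      simp only [zero_snoc, Fin.snoc_castSucc, pathWeight_snoc]
      rw [← ih i]
      refine Finset.sum_congr rfl fun v _ => ?_
      split_ifs
      · rw [← Finset.mul_sum, ← Finset.mul_sum, sum_stepWeight G hdeg, mul_one]
      · simp

theorem sum_degree_mul_pathWeight_edge (hdeg : ∀ v, 0 < G.degree v) {k : ℕ} (j : Fin k)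
    (x y : Fin n) :
    ∑ v : Fin (k + 1) → Fin n, (if v j.castSucc = x ∧ v j.succ = y then
      realDegree G (v 0) * pathWeight G v else 0) ≤ 1 := by
  induction k with
  | zero => exact j.elim0
  | succ k ih =>
    induction j using Fin.lastCases with
    | last =>
      rw [sum_snoc]
      simp only [zero_snoc, Fin.snoc_castSucc, pathWeight_snoc, Fin.succ_last, Fin.snoc_last]
      have h1 : ∀ v : Fin (k + 1) → Fin n, (∑ a, if v (Fin.last k) = x ∧ a = y then
          realDegree G (v 0) * (pathWeight G v * stepWeight G (v (Fin.last k)) a) else 0) =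
          (if v (Fin.last k) = x then realDegree G (v 0) * pathWeight G v else 0) *
            stepWeight G x y := by
        intro v
        rw [Finset.sum_eq_single y]
        · by_cases h : v (Fin.last k) = x
          · simp [h, mul_assoc]
          · simp [h]
        · intro a _ ha
          simp [ha]
        · simp
      simp only [h1]
      rw [← Finset.sum_mul, sum_degree_mul_pathWeight_last G hdeg, stepWeight]
      have h : (0 : ℝ) < realDegree G x := by
        rw [realDegree]
        exact_mod_cast hdeg x
      split_ifs
      · exact (mul_one_div_cancel h.ne').le
      · simp
    | cast i =>
      rw [sum_snoc]
      simp only [zero_snoc, Fin.snoc_castSucc, pathWeight_snoc, Fin.succ_castSucc]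
      refine le_trans (Finset.sum_le_sum fun v _ => ?_) (ih i)
      split_ifs
      · rw [← Finset.mul_sum, ← Finset.mul_sum, sum_stepWeight G hdeg, mul_one]
      · simp

/-- Without isolated vertices the degree measure dominates the counting measure, so bounds obtained
from stationarity carry over to the uniform start. -/
theorem walkWeight_le (hdeg : ∀ v, 0 < G.degree v) {k : ℕ} (v : Fin (k + 1) → Fin n) :
    walkWeight G v ≤ 1 / (n : ℝ) * (realDegree G (v 0) * pathWeight G v) := by
  have h : (1 : ℝ) ≤ G.degree (v 0) := by exact_mod_cast hdeg (v 0)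
  rw [walkWeight]
  gcongr
  exact le_mul_of_one_le_left (pathWeight_nonneg G v) h

theorem sum_walkWeight_vertex (hdeg : ∀ v, 0 < G.degree v) {k : ℕ} (j : Fin (k + 1))
    (x : Fin n) :
    ∑ v : Fin (k + 1) → Fin n, (if v j = x then walkWeight G v else 0) ≤
      (G.degree x : ℝ) / n := by
  change _ ≤ realDegree G x / n
  rw [← sum_degree_mul_pathWeight G hdeg j x, div_eq_inv_mul, ← one_div, Finset.mul_sum]
  refine Finset.sum_le_sum fun v _ => ?_
  split_ifs
  · exact walkWeight_le G hdeg v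
  · simp

theorem sum_walkWeight_edge (hdeg : ∀ v, 0 < G.degree v) {k : ℕ} (j : Fin k)
    (e : Sym2 (Fin n)) :
    ∑ v : Fin (k + 1) → Fin n, (if edgeAt v j = e then walkWeight G v else 0) ≤ 2 / n := by
  induction e using Sym2.ind with
  | _ x y =>
    have h1 := sum_degree_mul_pathWeight_edge G hdeg j x y
    have h2 := sum_degree_mul_pathWeight_edge G hdeg j y x
    have h3 : (2 : ℝ) / n = 1 / n * (1 + 1) := by ring
    rw [h3]
    refine le_trans ?_ (mul_le_mul_of_nonneg_left (add_le_add h1 h2) (by positivity))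
    rw [← Finset.sum_add_distrib, Finset.mul_sum]
    refine Finset.sum_le_sum fun v _ => ?_
    have h4 := walkWeight_le G hdeg v
    have h5 : (0 : ℝ) ≤ 1 / n * (realDegree G (v 0) * pathWeight G v) :=
      (walkWeight_nonneg G v).trans h4
    have h6 : edgeAt v j = s(x, y) ↔ (v j.castSucc = x ∧ v j.succ = y) ∨
        (v j.castSucc = y ∧ v j.succ = x) := by
      rw [edgeAt, Sym2.eq_iff]
    by_cases ha : v j.castSucc = x ∧ v j.succ = y
    · rw [if_pos (h6.2 (Or.inl ha)), if_pos ha, mul_add]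
      refine h4.trans (le_add_of_nonneg_right ?_)
      split_ifs
      · exact h5
      · simp
    · by_cases hb : v j.castSucc = y ∧ v j.succ = x
      · rw [if_pos (h6.2 (Or.inr hb)), if_neg ha, if_pos hb, zero_add]
        exact h4
      · rw [if_neg fun h => (h6.1 h).elim ha hb, if_neg ha, if_neg hb]
        simp

/-- Two walks interfere if they share an edge or a vertex of degree below `1 / η`. -/
def Interfere (η : ℝ) {k : ℕ} (v w : Fin (k + 1) → Fin n) : Prop :=
  (∃ i j : Fin k, edgeAt w j = edgeAt v i) ∨
    ∃ i j : Fin (k + 1), w j = v i ∧ (G.degree (v i) : ℝ) < 1 / η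

-- Union bound over pairs of positions for fixed v: at a given position w uses a given edge with
-- probability at most 2/n and visits a given vertex of degree below 1/η with probability at most
-- 1/(ηn). Shared vertices of high degree may be frequent, which is why they do not count as
-- interference.
open Classical in
theorem sum_interfere_le [NeZero n] (hdeg : ∀ v, 0 < G.degree v) {η : ℝ} (hη : 0 < η) (k : ℕ) :
    ∑ v : Fin (k + 1) → Fin n, ∑ w : Fin (k + 1) → Fin n,
      (if Interfere G η v w then walkWeight G v * walkWeight G w else 0) ≤
        (2 * (k : ℝ) ^ 2 + ((k : ℝ) + 1) ^ 2 / η) / n := by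
  have hn : (0 : ℝ) < n := by exact_mod_cast NeZero.pos n
  set B : ℝ := (2 * (k : ℝ) ^ 2 + ((k : ℝ) + 1) ^ 2 / η) / n with hB
  have key : ∀ v : Fin (k + 1) → Fin n,
      ∑ w : Fin (k + 1) → Fin n, (if Interfere G η v w then walkWeight G w else 0) ≤ B := by
    intro v
    have h1 : ∀ w : Fin (k + 1) → Fin n, (if Interfere G η v w then walkWeight G w else 0) ≤
        (∑ i : Fin k, ∑ j : Fin k, if edgeAt w j = edgeAt v i then walkWeight G w else 0) +
        ∑ i : Fin (k + 1), ∑ j : Fin (k + 1),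
          if (G.degree (v i) : ℝ) < 1 / η then (if w j = v i then walkWeight G w else 0)
            else 0 := by
      intro w
      have hw := walkWeight_nonneg G w
      have hA : ∀ i ∈ Finset.univ, 0 ≤ ∑ j : Fin k,
          if edgeAt w j = edgeAt v i then walkWeight G w else 0 :=
        fun i _ => Finset.sum_nonneg fun j _ => by split_ifs <;> simp [hw]
      have hB : ∀ i ∈ Finset.univ, 0 ≤ ∑ j : Fin (k + 1),
          if (G.degree (v i) : ℝ) < 1 / η then (if w j = v i then walkWeight G w else 0)
            else 0 :=
        fun i _ => Finset.sum_nonneg fun j _ => by split_ifs <;> simp [hw]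
      split_ifs with h
      · rcases h with ⟨i, j, h⟩ | ⟨i, j, h, h'⟩
        · refine le_trans ?_ (le_add_of_nonneg_right (Finset.sum_nonneg hB))
          refine le_trans ?_ (Finset.single_le_sum hA (Finset.mem_univ i))
          refine le_trans ?_ (Finset.single_le_sum
            (fun j _ => by split_ifs <;> simp [hw]) (Finset.mem_univ j))
          rw [if_pos h]
        · refine le_trans ?_ (le_add_of_nonneg_left (Finset.sum_nonneg hA))
          refine le_trans ?_ (Finset.single_le_sum hB (Finset.mem_univ i))
          refine le_trans ?_ (Finset.single_le_sum
            (fun j _ => by split_ifs <;> simp [hw]) (Finset.mem_univ j))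
          rw [if_pos h', if_pos h]
      · exact add_nonneg (Finset.sum_nonneg hA) (Finset.sum_nonneg hB)
    refine (Finset.sum_le_sum fun w _ => h1 w).trans ?_
    rw [Finset.sum_add_distrib, Finset.sum_comm,
      Finset.sum_comm (t := (Finset.univ : Finset (Fin (k + 1))))]
    have h2 : ∀ i ∈ (Finset.univ : Finset (Fin k)), ∑ w : Fin (k + 1) → Fin n, ∑ j : Fin k,
        (if edgeAt w j = edgeAt v i then walkWeight G w else 0) ≤ k * (2 / n) := by
      intro i _
      rw [Finset.sum_comm]
      refine (Finset.sum_le_sum fun j _ => sum_walkWeight_edge G hdeg j _).trans ?_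
      simp
    have h3 : ∀ i ∈ (Finset.univ : Finset (Fin (k + 1))), ∑ w : Fin (k + 1) → Fin n,
        ∑ j : Fin (k + 1), (if (G.degree (v i) : ℝ) < 1 / η then
          (if w j = v i then walkWeight G w else 0) else 0) ≤
          ((k : ℝ) + 1) * (1 / η / n) := by
      intro i _
      rw [Finset.sum_comm]
      have h4 : ∀ j ∈ (Finset.univ : Finset (Fin (k + 1))), ∑ w : Fin (k + 1) → Fin n,
          (if (G.degree (v i) : ℝ) < 1 / η then
            (if w j = v i then walkWeight G w else 0) else 0) ≤ 1 / η / n := by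
        intro j _
        split_ifs with h
        · refine (sum_walkWeight_vertex G hdeg j _).trans ?_
          gcongr
        · simp only [Finset.sum_const_zero]
          positivity
      refine (Finset.sum_le_sum h4).trans ?_
      simp
    refine (add_le_add (Finset.sum_le_sum h2) (Finset.sum_le_sum h3)).trans ?_
    simp only [Finset.sum_const, Finset.card_univ, Fintype.card_fin, nsmul_eq_mul, hB]
    push_cast
    apply le_of_eq
    field_simp
  calc _ = ∑ v : Fin (k + 1) → Fin n, walkWeight G v *
        ∑ w : Fin (k + 1) → Fin n, (if Interfere G η v w then walkWeight G w else 0) := by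
        simp only [Finset.mul_sum, mul_ite, mul_zero]
    _ ≤ ∑ v : Fin (k + 1) → Fin n, walkWeight G v * B :=
        Finset.sum_le_sum fun v _ => mul_le_mul_of_nonneg_left (key v) (walkWeight_nonneg G v)
    _ = B := by rw [← Finset.sum_mul, sum_walkWeight G hdeg, one_mul]

end WalkSums

end RandomWalkStream

namespace RandomWalkStream

/-! ### Expectations over independent labels -/

section LabelExpect

variable {n k : ℕ}

/-- The expectation over independent labels of the edges in `E`. -/
noncomputable def labelExpect (η : ℝ) (E : Finset (Sym2 (Fin n)))
    (F : (Sym2 (Fin n) → Option (Fin k)) → ℝ) : ℝ :=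
  ∑ ℓ : E → Option (Fin k), (∏ e, labelWeight η (ℓ e)) * F (extendLabels ℓ)

variable {η : ℝ} {E : Finset (Sym2 (Fin n))}

theorem labelExpect_mono (h0 : 0 ≤ η) (h1 : k * η ≤ 1)
    {F F' : (Sym2 (Fin n) → Option (Fin k)) → ℝ}
    (h : ∀ ℓ, (∀ e, ℓ e ≠ none → e ∈ E) → F ℓ ≤ F' ℓ) :
    labelExpect η E F ≤ labelExpect η E F' :=
  Finset.sum_le_sum fun ℓ _ => mul_le_mul_of_nonneg_left
    (h _ fun _ he => mem_of_extendLabels_ne ℓ he)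
    (Finset.prod_nonneg fun e _ => labelWeight_nonneg h0 h1 (ℓ e))

theorem labelExpect_add (F F' : (Sym2 (Fin n) → Option (Fin k)) → ℝ) :
    labelExpect η E (fun ℓ => F ℓ + F' ℓ) = labelExpect η E F + labelExpect η E F' := by
  simp only [labelExpect, mul_add, Finset.sum_add_distrib]

theorem labelExpect_sub (F F' : (Sym2 (Fin n) → Option (Fin k)) → ℝ) :
    labelExpect η E (fun ℓ => F ℓ - F' ℓ) = labelExpect η E F - labelExpect η E F' := by
  simp only [labelExpect, mul_sub, Finset.sum_sub_distrib]

theorem labelExpect_const_mul (c : ℝ) (F : (Sym2 (Fin n) → Option (Fin k)) → ℝ) :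
    labelExpect η E (fun ℓ => c * F ℓ) = c * labelExpect η E F := by
  simp only [labelExpect, Finset.mul_sum, mul_left_comm]

theorem labelExpect_sum {ι : Type} (s : Finset ι)
    (F : ι → (Sym2 (Fin n) → Option (Fin k)) → ℝ) :
    labelExpect η E (fun ℓ => ∑ i ∈ s, F i ℓ) = ∑ i ∈ s, labelExpect η E (F i) := by
  simp only [labelExpect, Finset.mul_sum]
  exact Finset.sum_comm

/-- The edges in `U` have the labels given by `τ`. -/
def FitsOn (U : Finset (Sym2 (Fin n))) (τ : Sym2 (Fin n) → Fin k)
    (ℓ : Sym2 (Fin n) → Option (Fin k)) : Prop :=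
  ∀ e ∈ U, ℓ e = some (τ e)

open Classical in
/-- The indicator function of a property. -/
noncomputable def ind (p : Prop) : ℝ := if p then 1 else 0

theorem ind_nonneg (p : Prop) : 0 ≤ ind p := by
  unfold ind
  split_ifs <;> simp

theorem ind_of {p : Prop} (h : p) : ind p = 1 := if_pos h

theorem ind_of_not {p : Prop} (h : ¬p) : ind p = 0 := if_neg h

/-- The indicator is a product over the edges, so independence factorises the expectation: η for
each edge of `U`, kη for each edge of `T`, and 1 for the others. -/
theorem labelExpect_event {U T : Finset (Sym2 (Fin n))} (hU : U ⊆ E) (hT : T ⊆ E)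
    (hUT : Disjoint U T) (τ : Sym2 (Fin n) → Fin k) :
    labelExpect η E (fun ℓ => ind (FitsOn U τ ℓ ∧ ∀ e ∈ T, ℓ e ≠ none)) =
      η ^ U.card * (k * η) ^ T.card := by
  classical
  let f : E → Option (Fin k) → ℝ := fun e a => labelWeight η a *
    if (e : Sym2 (Fin n)) ∈ U then (if a = some (τ e) then 1 else 0)
    else if (e : Sym2 (Fin n)) ∈ T then (if a ≠ none then 1 else 0) else 1
  have h1 : ∀ ℓ : E → Option (Fin k), (∏ e, labelWeight η (ℓ e)) *
      ind (FitsOn U τ (extendLabels ℓ) ∧ ∀ e ∈ T, extendLabels ℓ e ≠ none) =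
        ∏ e, f e (ℓ e) := by
    intro ℓ
    rw [Finset.prod_mul_distrib]
    congr 1
    by_cases h : FitsOn U τ (extendLabels ℓ) ∧ ∀ e ∈ T, extendLabels ℓ e ≠ none
    · rw [ind_of h, Finset.prod_eq_one]
      intro e _
      have h2 := h.1 e
      have h3 := h.2 e
      rw [extendLabels_coe] at h2 h3
      by_cases hu : (e : Sym2 (Fin n)) ∈ U
      · rw [if_pos hu, if_pos (h2 hu)]
      · rw [if_neg hu]
        by_cases ht : (e : Sym2 (Fin n)) ∈ T
        · rw [if_pos ht, if_pos (h3 ht)]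
        · rw [if_neg ht]
    · rw [ind_of_not h]
      symm
      rw [not_and_or, FitsOn] at h
      push Not at h
      rcases h with ⟨e, he, h⟩ | ⟨e, he, h⟩
      · refine Finset.prod_eq_zero (Finset.mem_univ ⟨e, hU he⟩) ?_
        rw [if_pos he, if_neg]
        rwa [← extendLabels_coe ℓ]
      · refine Finset.prod_eq_zero (Finset.mem_univ ⟨e, hT he⟩) ?_
        rw [if_neg (Finset.disjoint_right.1 hUT he), if_pos he, if_neg]
        rw [← extendLabels_coe ℓ]
        exact fun h' => h' h
  have h2 : ∀ e : E, ∑ a, f e a =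
      (if (e : Sym2 (Fin n)) ∈ U then η else 1) * if (e : Sym2 (Fin n)) ∈ T then k * η else 1 := by
    intro e
    by_cases hu : (e : Sym2 (Fin n)) ∈ U
    · have ht := Finset.disjoint_left.1 hUT hu
      simp only [f, if_pos hu, if_neg ht, mul_one]
      rw [Finset.sum_eq_single (some (τ e))]
      · simp [labelWeight]
      · intro a _ ha
        rw [if_neg ha, mul_zero]
      · simp
    · by_cases ht : (e : Sym2 (Fin n)) ∈ T
      · simp only [f, if_neg hu, if_pos ht, one_mul]
        rw [Fintype.sum_option]
        simp [labelWeight]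
      · simp only [f, if_neg hu, if_neg ht, mul_one]
        exact sum_labelWeight η k
  rw [labelExpect, Finset.sum_congr rfl fun ℓ _ => h1 ℓ, ← Fintype.prod_sum,
    Finset.prod_congr rfl fun e _ => h2 e, Finset.prod_mul_distrib]
  have h3 : ∀ (V : Finset (Sym2 (Fin n))) (c : ℝ), V ⊆ E →
      (∏ e : E, if (e : Sym2 (Fin n)) ∈ V then c else 1) = c ^ V.card := by
    intro V c hV
    rw [Finset.prod_coe_sort E fun e => if e ∈ V then c else 1, Finset.prod_ite_mem,
      Finset.inter_eq_right.2 hV, Finset.prod_const]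
  rw [h3 U _ hU, h3 T _ hT]

theorem labelExpect_fits {U : Finset (Sym2 (Fin n))} (hU : U ⊆ E) (τ : Sym2 (Fin n) → Fin k) :
    labelExpect η E (fun ℓ => ind (FitsOn U τ ℓ)) = η ^ U.card := by
  have h := labelExpect_event (η := η) hU (Finset.empty_subset E) (Finset.disjoint_empty_right U) τ
  simpa using h

/-- The number of edges in `S` that do not lie in the tail. -/
def headCount (S : Finset (Sym2 (Fin n))) (ℓ : Sym2 (Fin n) → Option (Fin k)) : ℕ :=
  (S.filter fun e => ℓ e ≠ none).card

theorem ind_mul_headCount (U S : Finset (Sym2 (Fin n))) (τ : Sym2 (Fin n) → Fin k)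
    (ℓ : Sym2 (Fin n) → Option (Fin k)) :
    ind (FitsOn U τ ℓ) * (headCount S ℓ : ℝ) =
      ∑ e ∈ S, ind (FitsOn U τ ℓ ∧ ∀ e' ∈ ({e} : Finset (Sym2 (Fin n))), ℓ e' ≠ none) := by
  rw [headCount, Finset.card_filter]
  push_cast
  rw [Finset.mul_sum]
  refine Finset.sum_congr rfl fun e _ => ?_
  by_cases h1 : FitsOn U τ ℓ <;> by_cases h2 : ℓ e = none <;> simp [ind, h1, h2]

theorem labelExpect_headCount {U S : Finset (Sym2 (Fin n))} (hU : U ⊆ E) (hS : S ⊆ E)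
    (hUS : Disjoint U S) (τ : Sym2 (Fin n) → Fin k) :
    labelExpect η E (fun ℓ => ind (FitsOn U τ ℓ) * (headCount S ℓ : ℝ)) =
      η ^ U.card * (S.card * (k * η)) := by
  simp only [ind_mul_headCount]
  rw [labelExpect_sum, Finset.sum_congr rfl fun e he => labelExpect_event hU
    (Finset.singleton_subset_iff.2 (hS he))
    (Finset.disjoint_singleton_right.2 (Finset.disjoint_right.1 hUS he)) τ]
  simp only [Finset.card_singleton, pow_one, Finset.sum_const, nsmul_eq_mul]
  ring

/-- Union bound over the at most 2^|S| subsets of size t that could lie entirely in the blocks. -/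
theorem labelExpect_headCount_large (h0 : 0 ≤ η) (h1 : k * η ≤ 1) {U S : Finset (Sym2 (Fin n))}
    (hU : U ⊆ E) (hS : S ⊆ E) (hUS : Disjoint U S) (τ : Sym2 (Fin n) → Fin k) (t : ℕ) :
    labelExpect η E (fun ℓ => ind (FitsOn U τ ℓ ∧ t ≤ headCount S ℓ)) ≤
      η ^ U.card * (2 ^ S.card * (k * η) ^ t) := by
  have h : ∀ ℓ : Sym2 (Fin n) → Option (Fin k), ind (FitsOn U τ ℓ ∧ t ≤ headCount S ℓ) ≤
      ∑ T ∈ S.powersetCard t, ind (FitsOn U τ ℓ ∧ ∀ e ∈ T, ℓ e ≠ none) := by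
    intro ℓ
    have hn : ∀ T ∈ S.powersetCard t, 0 ≤ ind (FitsOn U τ ℓ ∧ ∀ e ∈ T, ℓ e ≠ none) :=
      fun T _ => ind_nonneg _
    by_cases hp : FitsOn U τ ℓ ∧ t ≤ headCount S ℓ
    · obtain ⟨T, hT, hTc⟩ := Finset.exists_subset_card_eq hp.2
      have hm : T ∈ S.powersetCard t :=
        Finset.mem_powersetCard.2 ⟨hT.trans (Finset.filter_subset _ _), hTc⟩
      refine le_trans ?_ (Finset.single_le_sum hn hm)
      rw [ind_of hp, ind_of ⟨hp.1, fun e he => (Finset.mem_filter.1 (hT he)).2⟩]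
    · rw [ind_of_not hp]
      exact Finset.sum_nonneg hn
  refine (labelExpect_mono h0 h1 fun ℓ _ => h ℓ).trans ?_
  rw [labelExpect_sum]
  have h2 : ∀ T ∈ S.powersetCard t, labelExpect η E
      (fun ℓ => ind (FitsOn U τ ℓ ∧ ∀ e ∈ T, ℓ e ≠ none)) = η ^ U.card * (k * η) ^ t := by
    intro T hT
    obtain ⟨hT, hc⟩ := Finset.mem_powersetCard.1 hT
    rw [labelExpect_event hU (hT.trans hS) (Finset.disjoint_of_subset_right hT hUS), hc]
  rw [Finset.sum_congr rfl h2, Finset.sum_const, Finset.card_powersetCard, nsmul_eq_mul,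
    mul_left_comm]
  have h3 : ((S.card.choose t : ℕ) : ℝ) ≤ 2 ^ S.card := by
    exact_mod_cast Nat.choose_le_two_pow _ _
  gcongr

/-- For t = ⌈d/2⌉ one has d ≤ 2t ≤ 2^t and 2^d ≤ 4^t, so the product is at most (2^K · 4 · q)^t with
t ≥ 1. The rarity of a head with half of the edges thus beats the trivial bound d^K, uniformly in d.
-/
theorem pow_mul_two_pow_mul_pow_le {d K : ℕ} (hd : 1 ≤ d) {q : ℝ} (hq : 0 ≤ q)
    (hsmall : 2 ^ K * 4 * q ≤ 1) :
    (d : ℝ) ^ K * (2 ^ d * q ^ ((d + 1) / 2)) ≤ 2 ^ K * 4 * q := by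
  obtain ⟨t, ht⟩ : ∃ t, t = (d + 1) / 2 := ⟨_, rfl⟩
  have ht1 : 1 ≤ t := by omega
  have hdt : d ≤ 2 * t := by omega
  have h1 : 2 * t ≤ 2 ^ t := by
    obtain ⟨s, rfl⟩ := Nat.exists_eq_add_of_le' ht1
    have := Nat.lt_two_pow_self (n := s)
    rw [pow_succ]
    omega
  have h2 : (d : ℝ) ≤ 2 ^ t := by exact_mod_cast hdt.trans h1
  have h3 : (2 : ℝ) ^ d ≤ 4 ^ t := by
    have : (4 : ℝ) = 2 ^ 2 := by norm_num
    rw [this, ← pow_mul]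
    exact pow_le_pow_right₀ (by norm_num) hdt
  rw [← ht]
  calc (d : ℝ) ^ K * (2 ^ d * q ^ t) ≤ (2 ^ t) ^ K * (4 ^ t * q ^ t) := by gcongr
    _ = (2 ^ K * 4 * q) ^ t := by
        rw [← pow_mul, mul_comm t K, pow_mul, mul_pow, mul_pow, mul_assoc]
    _ ≤ 2 ^ K * 4 * q := pow_le_of_le_one (by positivity) hsmall (by omega)

/-- A pointwise bound for the powers of `d / (d - y - i)`. -/
noncomputable def ratioBound (K d y i : ℕ) : ℝ :=
  1 + 2 * 4 ^ K * (((i : ℝ) + y) / d) + (d : ℝ) ^ K * ind (d ≤ 2 * i)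

theorem one_le_ratioBound (K d y i : ℕ) : 1 ≤ ratioBound K d y i := by
  have := ind_nonneg (d ≤ 2 * i)
  unfold ratioBound
  have h1 : (0 : ℝ) ≤ 2 * 4 ^ K * (((i : ℝ) + y) / d) := by positivity
  have h2 : 0 ≤ (d : ℝ) ^ K * ind (d ≤ 2 * i) := by positivity
  linarith

theorem inv_one_sub_pow_le {x : ℝ} (h0 : 0 ≤ x) (h1 : x ≤ 3 / 4) (K : ℕ) :
    (1 / (1 - x)) ^ K ≤ 1 + 2 * 4 ^ K * x := by
  have hpos : 0 < 1 - x := by linarith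
  have hz : 1 / (1 - x) ≤ 1 + 4 * x := by
    rw [div_le_iff₀ hpos]
    nlinarith
  have hz4 : 1 / (1 - x) ≤ 4 := by linarith
  have hz0 : 0 ≤ 1 / (1 - x) := by positivity
  -- The subtracted 2 lets the induction close: a further factor yields the coefficient 4 + 4 (2 ·
  -- 4^K - 2) = 2 · 4^(K + 1) - 4.
  have key : (1 / (1 - x)) ^ K ≤ 1 + (2 * 4 ^ K - 2) * x := by
    induction K with
    | zero => simp
    | succ K ih =>
      have h4 : (1 : ℝ) ≤ 4 ^ K := one_le_pow₀ (by norm_num)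
      calc (1 / (1 - x)) ^ (K + 1) = (1 / (1 - x)) ^ K * (1 / (1 - x)) := pow_succ _ _
        _ ≤ (1 + (2 * 4 ^ K - 2) * x) * (1 / (1 - x)) := by gcongr
        _ = 1 / (1 - x) + (2 * 4 ^ K - 2) * x * (1 / (1 - x)) := by ring
        _ ≤ (1 + 4 * x) + (2 * 4 ^ K - 2) * x * 4 := by
            have : 0 ≤ (2 * 4 ^ K - 2) * x := mul_nonneg (by linarith) h0
            gcongr
        _ ≤ 1 + (2 * 4 ^ (K + 1) - 2) * x := by
            rw [pow_succ]
            nlinarith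
  linarith

/-- If i is below d/2, the missing fraction (i + y)/d is at most 1/2 + 1/4 and the power is linear
in it. Otherwise only D ≥ 1 is left, and the indicator term pays for d^K. -/
theorem div_pow_le_ratioBound {K d y i D : ℕ} (hd : 1 ≤ d) (hD : 1 ≤ D) (h : d ≤ D + y + i)
    (hy : 4 * y ≤ d) : ((d : ℝ) / D) ^ K ≤ ratioBound K d y i := by
  have hd' : (0 : ℝ) < d := by exact_mod_cast hd
  have hD' : (1 : ℝ) ≤ D := by exact_mod_cast hD
  by_cases hi : d ≤ 2 * i
  · rw [ratioBound, ind_of hi, mul_one]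
    have h1 : ((d : ℝ) / D) ^ K ≤ (d : ℝ) ^ K :=
      pow_le_pow_left₀ (by positivity) (div_le_self hd'.le hD') K
    have h2 : (0 : ℝ) ≤ 2 * 4 ^ K * (((i : ℝ) + y) / d) := by positivity
    linarith
  · rw [ratioBound, ind_of_not hi, mul_zero, add_zero]
    have h2 : 4 * ((i : ℝ) + y) ≤ 3 * d := by
      have : 4 * (i + y) ≤ 3 * d := by omega
      exact_mod_cast this
    have hx : ((i : ℝ) + y) / d ≤ 3 / 4 := by
      rw [div_le_iff₀ hd']
      linarith
    refine le_trans (pow_le_pow_left₀ (by positivity) ?_ K)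
      (inv_one_sub_pow_le (by positivity) hx K)
    have h3 : (d : ℝ) ≤ D + y + i := by exact_mod_cast h
    have h4 : 1 - ((i : ℝ) + y) / d = (d - (i + y)) / d := by field_simp
    rw [h4, one_div_div]
    have h5 : (0 : ℝ) < d - (i + y) := by linarith
    exact div_le_div_of_nonneg_left hd'.le h5 (by linarith)

/-- The linear term is governed by the mean head count |S|kη ≤ dkη, the indicator term by
`labelExpect_headCount_large`. Both are independent of the labels on `U`, which only contribute the
factor η^|U|. -/
theorem labelExpect_ratioBound (h0 : 0 ≤ η) (h1 : k * η ≤ 1) {U S : Finset (Sym2 (Fin n))}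
    (hU : U ⊆ E) (hS : S ⊆ E) (hUS : Disjoint U S) (τ : Sym2 (Fin n) → Fin k) {d K : ℕ} (y : ℕ)
    (hd : 1 ≤ d) (hSd : S.card ≤ d) (hsmall : 2 ^ K * 4 * (k * η) ≤ 1) :
    labelExpect η E (fun ℓ => ind (FitsOn U τ ℓ) * ratioBound K d y (headCount S ℓ)) ≤
      η ^ U.card * (1 + 2 * 4 ^ K * (k * η + y / d) + 2 ^ K * 4 * (k * η)) := by
  have hd' : (0 : ℝ) < d := by exact_mod_cast hd
  have hq : 0 ≤ k * η := by positivity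
  have h2 : ∀ ℓ : Sym2 (Fin n) → Option (Fin k),
      ind (FitsOn U τ ℓ) * ratioBound K d y (headCount S ℓ) =
      (1 + 2 * 4 ^ K * (y / d)) * ind (FitsOn U τ ℓ) +
        2 * 4 ^ K / d * (ind (FitsOn U τ ℓ) * (headCount S ℓ : ℝ)) +
        (d : ℝ) ^ K * ind (FitsOn U τ ℓ ∧ (d + 1) / 2 ≤ headCount S ℓ) := by
    intro ℓ
    have h3 : (d + 1) / 2 ≤ headCount S ℓ ↔ d ≤ 2 * headCount S ℓ := by omega
    rw [h3, ratioBound]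
    have h4 : ind (FitsOn U τ ℓ ∧ d ≤ 2 * headCount S ℓ) =
        ind (FitsOn U τ ℓ) * ind (d ≤ 2 * headCount S ℓ) := by
      by_cases h5 : FitsOn U τ ℓ <;> simp [ind, h5]
    rw [h4]
    ring
  simp only [h2]
  rw [labelExpect_add, labelExpect_add, labelExpect_const_mul, labelExpect_const_mul,
    labelExpect_const_mul, labelExpect_fits hU, labelExpect_headCount hU hS hUS]
  have h3 := labelExpect_headCount_large h0 h1 hU hS hUS τ ((d + 1) / 2)
  have h4 : (d : ℝ) ^ K * labelExpect η E
      (fun ℓ => ind (FitsOn U τ ℓ ∧ (d + 1) / 2 ≤ headCount S ℓ)) ≤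
      η ^ U.card * (2 ^ K * 4 * (k * η)) := by
    calc _ ≤ (d : ℝ) ^ K * (η ^ U.card * (2 ^ S.card * (k * η) ^ ((d + 1) / 2))) := by gcongr
      _ ≤ (d : ℝ) ^ K * (η ^ U.card * (2 ^ d * (k * η) ^ ((d + 1) / 2))) := by
          gcongr
          norm_num
      _ = η ^ U.card * ((d : ℝ) ^ K * (2 ^ d * (k * η) ^ ((d + 1) / 2))) := by ring
      _ ≤ _ := mul_le_mul_of_nonneg_left (pow_mul_two_pow_mul_pow_le hd hq hsmall)
          (by positivity)
  have h5 : 2 * 4 ^ K / (d : ℝ) * (η ^ U.card * (S.card * (k * η))) ≤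
      η ^ U.card * (2 * 4 ^ K * (k * η)) := by
    have h6 : (S.card : ℝ) ≤ d := by exact_mod_cast hSd
    calc _ ≤ 2 * 4 ^ K / (d : ℝ) * (η ^ U.card * (d * (k * η))) := by gcongr
      _ = _ := by field_simp
  linarith

end LabelExpect

end RandomWalkStream

namespace RandomWalkStream

/-! ### The expected mass of a walk -/

section WalkMass

variable {n k : ℕ}

/-- The set of the edges of a walk. -/
def edgeSet (v : Fin (k + 1) → Fin n) : Finset (Sym2 (Fin n)) := Finset.univ.image (edgeAt v)

theorem edgeAt_mem (v : Fin (k + 1) → Fin n) (j : Fin k) : edgeAt v j ∈ edgeSet v :=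
  Finset.mem_image_of_mem _ (Finset.mem_univ j)

theorem mem_edgeSet {v : Fin (k + 1) → Fin n} {e : Sym2 (Fin n)} :
    e ∈ edgeSet v ↔ ∃ i, edgeAt v i = e := by
  simp [edgeSet]

theorem card_edgeSet (v : Fin (k + 1) → Fin n) :
    (edgeSet v).card = (Finset.univ.filter fun j => firstUse v j = j).card := by
  have h : edgeSet v = (Finset.univ.filter fun j => firstUse v j = j).image (edgeAt v) := by
    ext e
    simp only [mem_edgeSet, Finset.mem_image, Finset.mem_filter, Finset.mem_univ, true_and]
    constructor
    · rintro ⟨i, rfl⟩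
      exact ⟨firstUse v i, firstUse_firstUse v i, edgeAt_firstUse v i⟩
    · rintro ⟨i, -, h⟩
      exact ⟨i, h⟩
  rw [h, Finset.card_image_of_injOn]
  intro i hi j hj hij
  simp only [Finset.coe_filter, Finset.mem_univ, true_and, Set.mem_ofPred_eq] at hi hj
  rw [← hi, ← hj]
  exact firstUse_congr hij

theorem card_edgeSet_le (v : Fin (k + 1) → Fin n) : (edgeSet v).card ≤ k :=
  Finset.card_image_le.trans (by simp)

/-- The label of an edge of a walk. -/
noncomputable def labelOf [NeZero k] (v : Fin (k + 1) → Fin n) (e : Sym2 (Fin n)) : Fin k :=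
  if h : ∃ i, edgeAt v i = e then firstUse v h.choose else 0

theorem labelOf_edgeAt [NeZero k] (v : Fin (k + 1) → Fin n) (j : Fin k) :
    labelOf v (edgeAt v j) = firstUse v j := by
  have h : ∃ i, edgeAt v i = edgeAt v j := ⟨j, rfl⟩
  rw [labelOf, dif_pos h]
  exact firstUse_congr h.choose_spec

theorem labelsFit_iff [NeZero k] {v : Fin (k + 1) → Fin n} {ℓ : Sym2 (Fin n) → Option (Fin k)} :
    LabelsFit ℓ v ↔ FitsOn (edgeSet v) (labelOf v) ℓ := by
  constructor
  · intro h e he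
    obtain ⟨j, rfl⟩ := mem_edgeSet.1 he
    rw [h j, labelOf_edgeAt]
  · intro h j
    rw [h _ (edgeAt_mem v j), labelOf_edgeAt]

variable {E : Finset (Sym2 (Fin n))} {ℓ : Sym2 (Fin n) → Option (Fin k)}
  {v : Fin (k + 1) → Fin n} {η : ℝ}

theorem degHat_pos (hvE : edgeSet v ⊆ E) (j : Fin k) : 1 ≤ degHat E ℓ v j :=
  Finset.card_pos.2 ⟨edgeAt v j, Finset.mem_filter.2
    ⟨hvE (edgeAt_mem v j), Sym2.mem_mk_left _ _, Or.inr ⟨j, rfl⟩⟩⟩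

/-- The degree of a vertex in a set of edges. -/
def degIn (E : Finset (Sym2 (Fin n))) (x : Fin n) : ℕ := (E.filter fun e => x ∈ e).card

theorem degHat_le_degIn (j : Fin k) : degHat E ℓ v j ≤ degIn E (v j.castSucc) :=
  Finset.card_le_card fun e he => by
    rw [Finset.mem_filter] at he ⊢
    exact ⟨he.1, he.2.1⟩

theorem subset_of_labelsFit (hℓ : ∀ e, ℓ e ≠ none → e ∈ E) (hv : LabelsFit ℓ v) :
    edgeSet v ⊆ E := by
  intro e he
  obtain ⟨j, rfl⟩ := mem_edgeSet.1 he
  exact hℓ _ (by rw [hv j]; simp)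

theorem walkMass_nonneg (hη : 0 ≤ η) : 0 ≤ walkMass η E ℓ v := by
  unfold walkMass
  split_ifs
  · refine mul_nonneg (by positivity) (Finset.prod_nonneg fun j _ => ?_)
    split_ifs <;> positivity
  · exact le_rfl

theorem prod_new_old (η : ℝ) (v : Fin (k + 1) → Fin n) :
    (∏ j : Fin k, if firstUse v j = j then 1 else η) = η ^ (k - (edgeSet v).card) := by
  rw [Finset.prod_ite, Finset.prod_const_one, one_mul, Finset.prod_const, card_edgeSet]
  congr 1
  have h := Finset.card_filter_add_card_filter_not (s := (Finset.univ : Finset (Fin k)))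
    (fun j => firstUse v j = j)
  rw [Finset.card_univ, Fintype.card_fin] at h
  omega

/-- Without the truncation at 1 the block degrees cancel: a new step gives 1/d̂ and an old step
η/d̂. The bound depends on the labels only through fitting and the degree estimates. -/
theorem walkMass_le (hη : 0 ≤ η) :
    walkMass η E ℓ v ≤ 1 / (n : ℝ) * (1 / (k ! : ℝ)) * η ^ (k - (edgeSet v).card) *
      (ind (LabelsFit ℓ v) * ∏ j, 1 / (degHat E ℓ v j : ℝ)) := by
  by_cases h : LabelsFit ℓ v
  · rw [walkMass, if_pos h, ind_of h, one_mul, ← prod_new_old, mul_assoc (1 / (n : ℝ) * _),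
      ← Finset.prod_mul_distrib]
    refine mul_le_mul_of_nonneg_left (Finset.prod_le_prod (fun j _ => ?_) fun j _ => ?_)
      (by positivity)
    · split_ifs <;> positivity
    · split_ifs
      · rw [one_mul]
        by_cases hb : (blockDeg E ℓ v j : ℝ) = 0
        · rw [hb]
          simp
        · calc _ ≤ 1 / (blockDeg E ℓ v j : ℝ) * ((blockDeg E ℓ v j : ℝ) / degHat E ℓ v j) := by
                gcongr
                exact min_le_left _ _
            _ = _ := by field_simp
      · exact (min_le_left _ _).trans (by rw [mul_one_div])
  · rw [walkMass, if_neg h, ind_of_not h]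
    simp

/-- No truncation is active: by `hb` in new steps, and by η ≤ 1 ≤ d̂ in old ones. As d̂ never
exceeds the degree, the degree may replace it. -/
theorem le_walkMass (hη : 0 ≤ η) (h1 : η ≤ 1) (hv : LabelsFit ℓ v)
    (hvE : edgeSet v ⊆ E) (hb : ∀ j, blockDeg E ℓ v j ≤ degHat E ℓ v j) :
    1 / (n : ℝ) * (1 / (k ! : ℝ)) * η ^ (k - (edgeSet v).card) *
      ∏ j : Fin k, 1 / (degIn E (v j.castSucc) : ℝ) ≤ walkMass η E ℓ v := by
  rw [walkMass, if_pos hv, ← prod_new_old, mul_assoc (1 / (n : ℝ) * _),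
    ← Finset.prod_mul_distrib]
  refine mul_le_mul_of_nonneg_left (Finset.prod_le_prod (fun j _ => ?_) fun j _ => ?_)
    (by positivity)
  · split_ifs <;> positivity
  · have hd : (1 : ℝ) ≤ degHat E ℓ v j := by exact_mod_cast degHat_pos hvE j
    have hd' : (degHat E ℓ v j : ℝ) ≤ degIn E (v j.castSucc) := by
      exact_mod_cast degHat_le_degIn j
    have hd0 : (0 : ℝ) < degHat E ℓ v j := by linarith
    split_ifs with hj
    · have hp : (0 : ℝ) < blockDeg E ℓ v j := by
        exact_mod_cast blockDeg_pos hv (fun i => hvE (edgeAt_mem v i)) hj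
      have hbd : (blockDeg E ℓ v j : ℝ) ≤ degHat E ℓ v j := by exact_mod_cast hb j
      rw [min_eq_left ((div_le_one hd0).2 hbd), one_mul]
      calc 1 / (degIn E (v j.castSucc) : ℝ) ≤ 1 / degHat E ℓ v j :=
            one_div_le_one_div_of_le hd0 hd'
        _ = _ := by field_simp
    · rw [min_eq_left ((div_le_one hd0).2 (h1.trans hd)), mul_one_div]
      exact div_le_div_of_nonneg_left hη hd0 hd'

/-- The edges at the `j`-th vertex of a walk outside a set. -/
def otherEdges (E U : Finset (Sym2 (Fin n))) (x : Fin n) : Finset (Sym2 (Fin n)) :=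
  E.filter fun e => x ∈ e ∧ e ∉ U

/-- An edge at the vertex that the estimate misses lies in a block but not on v. It belongs to `U`,
whose labels will be conditioned on, or its label is independent of those. -/
theorem degHat_add_ge (U : Finset (Sym2 (Fin n))) (j : Fin k) :
    degIn E (v j.castSucc) ≤ degHat E ℓ v j +
      ((U \ edgeSet v).filter fun e => v j.castSucc ∈ e).card +
        headCount (otherEdges E U (v j.castSucc)) ℓ := by
  rw [degIn, degHat, headCount]
  refine le_trans (Finset.card_le_card ?_)
    ((Finset.card_union_le _ _).trans (Nat.add_le_add_right (Finset.card_union_le _ _) _))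
  intro e he
  rw [Finset.mem_filter] at he
  simp only [Finset.mem_union, Finset.mem_filter, Finset.mem_sdiff, otherEdges]
  by_cases h1 : e ∈ edgeSet v
  · exact Or.inl (Or.inl ⟨he.1, he.2, Or.inr (mem_edgeSet.1 h1)⟩)
  · by_cases h2 : e ∈ U
    · exact Or.inl (Or.inr ⟨⟨h2, h1⟩, he.2⟩)
    · by_cases h3 : ℓ e = none
      · exact Or.inl (Or.inl ⟨he.1, he.2, Or.inl h3⟩)
      · exact Or.inr ⟨⟨he.1, he.2, h2⟩, h3⟩

theorem card_otherEdges_le (U : Finset (Sym2 (Fin n))) (x : Fin n) :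
    (otherEdges E U x).card ≤ degIn E x :=
  Finset.card_le_card fun e he => by
    rw [otherEdges, Finset.mem_filter] at he
    exact Finset.mem_filter.2 ⟨he.1, he.2.1⟩

theorem disjoint_otherEdges (U : Finset (Sym2 (Fin n))) (x : Fin n) :
    Disjoint U (otherEdges E U x) :=
  Finset.disjoint_left.2 fun _ he h => (Finset.mem_filter.1 h).2.2 he

theorem degIn_pos (hvE : edgeSet v ⊆ E) (j : Fin k) : 1 ≤ degIn E (v j.castSucc) :=
  Finset.card_pos.2 ⟨edgeAt v j, Finset.mem_filter.2
    ⟨hvE (edgeAt_mem v j), Sym2.mem_mk_left _ _⟩⟩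

/-- Among the edges of the walk only the j-th can lie in block j, because fitting labels are first
uses; hence the + 1. -/
theorem blockDeg_le (hv : LabelsFit ℓ v) (j : Fin k) :
    blockDeg E ℓ v j ≤ headCount (otherEdges E (edgeSet v) (v j.castSucc)) ℓ + 1 := by
  rw [blockDeg, headCount, ← Finset.card_singleton (edgeAt v j)]
  refine le_trans (Finset.card_le_card ?_) (Finset.card_union_le _ _)
  intro e he
  simp only [Finset.mem_filter, Finset.mem_union, otherEdges, Finset.mem_singleton] at he ⊢
  by_cases h1 : e ∈ edgeSet v
  · obtain ⟨i, rfl⟩ := mem_edgeSet.1 h1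
    have h2 := (hv i).symm.trans he.2.1
    right
    rw [← Option.some.inj h2, edgeAt_firstUse]
  · exact Or.inl ⟨⟨he.1, he.2.2, h1⟩, by rw [he.2.1]; simp⟩

/-- A lower bound for the expected mass of a walk in the graph. -/
theorem le_labelExpect_walkMass [NeZero k] (h0 : 0 ≤ η) (h1 : k * η ≤ 1)
    (hvE : edgeSet v ⊆ E) :
    (1 - 2 * k * (k * η)) * (η ^ k / (k ! : ℝ)) *
      (1 / (n : ℝ) * ∏ j : Fin k, 1 / (degIn E (v j.castSucc) : ℝ)) ≤
        labelExpect η E fun ℓ : Sym2 (Fin n) → Option (Fin k) => walkMass η E ℓ v := by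
  have hk1 : (1 : ℝ) ≤ k := by exact_mod_cast NeZero.pos k
  have hη1 : η ≤ 1 := le_trans (le_mul_of_one_le_left h0 hk1) h1
  set c : ℝ := 1 / (n : ℝ) * (1 / (k ! : ℝ)) * η ^ (k - (edgeSet v).card) *
      ∏ j : Fin k, 1 / (degIn E (v j.castSucc) : ℝ) with hc
  have hc0 : 0 ≤ c := by positivity
  set S : Fin k → Finset (Sym2 (Fin n)) := fun j =>
    otherEdges E (edgeSet v) (v j.castSucc) with hS
  set d : Fin k → ℝ := fun j => (degIn E (v j.castSucc) : ℝ) with hd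
  -- Markov's inequality in pointwise form: an active truncation is paid for by a term linear in the
  -- head counts, so first moments suffice.
  have hpt : ∀ ℓ : Sym2 (Fin n) → Option (Fin k), (∀ e, ℓ e ≠ none → e ∈ E) →
      c * (ind (FitsOn (edgeSet v) (labelOf v) ℓ) - ∑ j, 2 / d j *
        (ind (FitsOn (edgeSet v) (labelOf v) ℓ) * (headCount (S j) ℓ : ℝ))) ≤
        walkMass η E ℓ v := by
    intro ℓ _
    by_cases hv : LabelsFit ℓ v
    · rw [ind_of (labelsFit_iff.1 hv)]
      simp only [one_mul]
      have hnn : ∀ j ∈ Finset.univ, 0 ≤ 2 / d j * (headCount (S j) ℓ : ℝ) :=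
        fun j _ => by positivity
      by_cases hb : ∀ j, blockDeg E ℓ v j ≤ degHat E ℓ v j
      · refine le_trans ?_ (le_walkMass h0 hη1 hv hvE hb)
        rw [← hc]
        refine mul_le_of_le_one_right hc0 ?_
        have := Finset.sum_nonneg hnn
        linarith
      · push Not at hb
        obtain ⟨j, hj⟩ := hb
        refine le_trans ?_ (walkMass_nonneg h0)
        refine mul_nonpos_of_nonneg_of_nonpos hc0 ?_
        have h2 := Finset.single_le_sum hnn (Finset.mem_univ j)
        have h3 := blockDeg_le (E := E) hv j
        have h4 := degHat_add_ge (ℓ := ℓ) (v := v) (E := E) (edgeSet v) j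
        rw [Finset.sdiff_self, Finset.filter_empty, Finset.card_empty, add_zero] at h4
        -- With head count h, the degree is at most d̂ + h, and d̂ is less than the block degree,
        -- which is at most h + 1.
        have h5 : degIn E (v j.castSucc) ≤ 2 * headCount (S j) ℓ := by
          simp only [hS]
          omega
        have h6 : d j ≤ 2 * (headCount (S j) ℓ : ℝ) := by
          simp only [hd]
          exact_mod_cast h5
        have h7 : 0 < d j := by
          simp only [hd]
          exact_mod_cast degIn_pos hvE j
        have h8 : 1 ≤ 2 / d j * (headCount (S j) ℓ : ℝ) := by
          rw [div_mul_eq_mul_div, le_div_iff₀ h7]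
          linarith
        linarith
    · rw [ind_of_not fun h => hv (labelsFit_iff.2 h)]
      simp only [zero_mul, mul_zero, Finset.sum_const_zero, sub_zero]
      exact walkMass_nonneg h0
  refine le_trans ?_ (labelExpect_mono h0 h1 hpt)
  rw [labelExpect_const_mul, labelExpect_sub, labelExpect_sum, labelExpect_fits hvE]
  have h2 : ∀ j ∈ Finset.univ, labelExpect η E (fun ℓ : Sym2 (Fin n) → Option (Fin k) =>
      2 / d j * (ind (FitsOn (edgeSet v) (labelOf v) ℓ) * (headCount (S j) ℓ : ℝ))) ≤
        η ^ (edgeSet v).card * (2 * (k * η)) := by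
    intro j _
    rw [labelExpect_const_mul, labelExpect_headCount hvE (S := S j)
      (Finset.filter_subset _ _) (disjoint_otherEdges _ _)]
    have h3 : ((S j).card : ℝ) ≤ d j := by
      simp only [hd, hS]
      exact_mod_cast card_otherEdges_le _ _
    have h7 : 0 < d j := by
      simp only [hd]
      exact_mod_cast degIn_pos hvE j
    calc _ ≤ 2 / d j * (η ^ (edgeSet v).card * (d j * (k * η))) := by gcongr
      _ = _ := by field_simp
  have h3 := Finset.sum_le_sum h2
  rw [Finset.sum_const, Finset.card_univ, Fintype.card_fin, nsmul_eq_mul] at h3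
  have h4 : (1 - 2 * k * (k * η)) * (η ^ k / (k ! : ℝ)) *
      (1 / (n : ℝ) * ∏ j : Fin k, 1 / (degIn E (v j.castSucc) : ℝ)) =
        c * (η ^ (edgeSet v).card - k * (η ^ (edgeSet v).card * (2 * (k * η)))) := by
    have h5 : η ^ k = η ^ (k - (edgeSet v).card) * η ^ (edgeSet v).card := by
      rw [← pow_add, Nat.sub_add_cancel (card_edgeSet_le v)]
    rw [h5, hc]
    ring
  rw [h4]
  gcongr

end WalkMass

end RandomWalkStream

namespace RandomWalkStream

/-! ### The second moment -/

section Pairs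

variable {n k : ℕ} {E : Finset (Sym2 (Fin n))} {v w : Fin (k + 1) → Fin n} {η : ℝ}

/-- The quotient of the degree of the `j`-th vertex of a walk and its estimate. -/
noncomputable def degRatio (E : Finset (Sym2 (Fin n))) (ℓ : Sym2 (Fin n) → Option (Fin k))
    (v : Fin (k + 1) → Fin n) (j : Fin k) : ℝ :=
  (degIn E (v j.castSucc) : ℝ) / degHat E ℓ v j

/-- The number of edges of `U` at the `j`-th vertex of a walk that are not edges of the walk. -/
def extraDeg (U : Finset (Sym2 (Fin n))) (v : Fin (k + 1) → Fin n) (j : Fin k) : ℕ :=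
  ((U \ edgeSet v).filter fun e => v j.castSucc ∈ e).card

theorem degRatio_nonneg {ℓ : Sym2 (Fin n) → Option (Fin k)} (j : Fin k) :
    0 ≤ degRatio E ℓ v j := by
  unfold degRatio
  positivity

theorem degRatio_pow_le {ℓ : Sym2 (Fin n) → Option (Fin k)} (hvE : edgeSet v ⊆ E)
    {U : Finset (Sym2 (Fin n))} (j : Fin k) (K : ℕ)
    (hy : 4 * extraDeg U v j ≤ degIn E (v j.castSucc)) :
    degRatio E ℓ v j ^ K ≤ ratioBound K (degIn E (v j.castSucc)) (extraDeg U v j)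
      (headCount (otherEdges E U (v j.castSucc)) ℓ) :=
  div_pow_le_ratioBound (degIn_pos hvE j) (degHat_pos hvE j) (degHat_add_ge U j) hy

/-- Counting the y extra edges as part of the estimate costs a factor y + 1, since D + y ≤ (y + 1) D
for D ≥ 1. No lower bound on the degree is needed, as interfering walks require. -/
theorem degRatio_pow_le_crude {ℓ : Sym2 (Fin n) → Option (Fin k)} (hvE : edgeSet v ⊆ E)
    {U : Finset (Sym2 (Fin n))} (j : Fin k) (K : ℕ) :
    degRatio E ℓ v j ^ K ≤ ((extraDeg U v j : ℝ) + 1) ^ K *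
      ratioBound K (degIn E (v j.castSucc)) 0
        (headCount (otherEdges E U (v j.castSucc)) ℓ) := by
  have hD := degHat_pos (ℓ := ℓ) hvE j
  have h := degHat_add_ge (E := E) (ℓ := ℓ) (v := v) U j
  have h1 := div_pow_le_ratioBound (K := K) (D := degHat E ℓ v j + extraDeg U v j) (y := 0)
    (i := headCount (otherEdges E U (v j.castSucc)) ℓ) (degIn_pos hvE j) (le_trans hD (Nat.le_add_right _ _)) (by rw [add_zero]; exact h) (by simp)
  refine le_trans ?_ (mul_le_mul_of_nonneg_left h1 (by positivity))
  rw [← mul_pow]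
  refine pow_le_pow_left₀ (degRatio_nonneg j) ?_ K
  have hD' : (1 : ℝ) ≤ degHat E ℓ v j := by exact_mod_cast hD
  rw [degRatio, mul_div_assoc', div_le_div_iff₀ (by linarith) (by positivity)]
  push_cast
  have h2 : (degHat E ℓ v j : ℝ) + extraDeg U v j ≤ (extraDeg U v j + 1) * degHat E ℓ v j := by
    have : (extraDeg U v j : ℝ) * 1 ≤ extraDeg U v j * degHat E ℓ v j := by gcongr
    linarith
  calc _ ≤ (degIn E (v j.castSucc) : ℝ) * ((extraDeg U v j + 1) * degHat E ℓ v j) := by gcongr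
    _ = _ := by ring

/-- Extra edges are absent, or they are at most k out of at least 1/η edges. That is a fraction of
at most kη, the same order as the loss to the blocks. -/
theorem labelExpect_degRatio (h0 : 0 ≤ η) (h1 : k * η ≤ 1) {K : ℕ}
    (hsmall : 2 ^ K * 4 * (k * η) ≤ 1) (hvE : edgeSet v ⊆ E) {U : Finset (Sym2 (Fin n))}
    (hU : U ⊆ E) (τ : Sym2 (Fin n) → Fin k) (j : Fin k)
    (hy : extraDeg U v j = 0 ∨ 1 ≤ η * degIn E (v j.castSucc)) (hyk : extraDeg U v j ≤ k) :
    labelExpect η E (fun ℓ => ind (FitsOn U τ ℓ) * degRatio E ℓ v j ^ K) ≤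
      η ^ U.card * (1 + 8 * 4 ^ K * (k * η)) := by
  have hd : (0 : ℝ) < degIn E (v j.castSucc) := by exact_mod_cast degIn_pos hvE j
  have hK : (1 : ℝ) ≤ 2 ^ K := one_le_pow₀ (by norm_num)
  have hq0 : 0 ≤ k * η := by positivity
  have hy4 : 4 * extraDeg U v j ≤ degIn E (v j.castSucc) := by
    rcases hy with hy | hy
    · omega
    · have h2 : 4 * (k * η) ≤ 1 := by nlinarith
      have h3 : (4 * extraDeg U v j : ℝ) ≤ degIn E (v j.castSucc) := by
        have h4 : (extraDeg U v j : ℝ) ≤ k := by exact_mod_cast hyk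
        calc (4 * extraDeg U v j : ℝ) ≤ 4 * k * 1 := by linarith
          _ ≤ 4 * k * (η * degIn E (v j.castSucc)) := by gcongr
          _ = 4 * (k * η) * degIn E (v j.castSucc) := by ring
          _ ≤ 1 * degIn E (v j.castSucc) := by gcongr
          _ = _ := one_mul _
      exact_mod_cast h3
  have hyd : (extraDeg U v j : ℝ) / degIn E (v j.castSucc) ≤ k * η := by
    rcases hy with hy | hy
    · rw [hy, Nat.cast_zero, zero_div]
      exact hq0
    · rw [div_le_iff₀ hd]
      have h4 : (extraDeg U v j : ℝ) ≤ k := by exact_mod_cast hyk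
      calc (extraDeg U v j : ℝ) ≤ k * 1 := by linarith
        _ ≤ k * (η * degIn E (v j.castSucc)) := by gcongr
        _ = _ := by ring
  refine (labelExpect_mono h0 h1 fun ℓ _ => mul_le_mul_of_nonneg_left
    (degRatio_pow_le hvE (U := U) j K hy4) (ind_nonneg _)).trans ?_
  refine (labelExpect_ratioBound h0 h1 hU (Finset.filter_subset _ _) (disjoint_otherEdges _ _) τ _
    (degIn_pos hvE j) (card_otherEdges_le _ _) hsmall).trans ?_
  have h24 : (2 : ℝ) ^ K ≤ 4 ^ K := pow_le_pow_left₀ (by norm_num) (by norm_num) K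
  refine mul_le_mul_of_nonneg_left ?_ (by positivity)
  have h5 : 2 * 4 ^ K * (k * η + (extraDeg U v j : ℝ) / degIn E (v j.castSucc)) ≤
      2 * 4 ^ K * (k * η + k * η) := by gcongr
  have h6 : 2 ^ K * 4 * (k * η) ≤ 4 ^ K * 4 * (k * η) := by gcongr
  linarith

theorem labelExpect_degRatio_crude (h0 : 0 ≤ η) (h1 : k * η ≤ 1) {K : ℕ}
    (hsmall : 2 ^ K * 4 * (k * η) ≤ 1) (hvE : edgeSet v ⊆ E) {U : Finset (Sym2 (Fin n))}
    (hU : U ⊆ E) (τ : Sym2 (Fin n) → Fin k) (j : Fin k) (hyk : extraDeg U v j ≤ k) :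
    labelExpect η E (fun ℓ => ind (FitsOn U τ ℓ) * degRatio E ℓ v j ^ K) ≤
      η ^ U.card * ((1 + 8 * 4 ^ K * (k * η)) * ((k : ℝ) + 1) ^ K) := by
  have hq0 : 0 ≤ k * η := by positivity
  have hy : (extraDeg U v j : ℝ) ≤ k := by exact_mod_cast hyk
  have hpt : ∀ ℓ : Sym2 (Fin n) → Option (Fin k),
      ind (FitsOn U τ ℓ) * degRatio E ℓ v j ^ K ≤ ((k : ℝ) + 1) ^ K * (ind (FitsOn U τ ℓ) *
        ratioBound K (degIn E (v j.castSucc)) 0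
          (headCount (otherEdges E U (v j.castSucc)) ℓ)) := by
    intro ℓ
    rw [mul_left_comm]
    refine mul_le_mul_of_nonneg_left ((degRatio_pow_le_crude hvE (U := U) j K).trans ?_)
      (ind_nonneg _)
    have := one_le_ratioBound K (degIn E (v j.castSucc)) 0
      (headCount (otherEdges E U (v j.castSucc)) ℓ)
    gcongr
  refine (labelExpect_mono h0 h1 fun ℓ _ => hpt ℓ).trans ?_
  rw [labelExpect_const_mul]
  have h2 := labelExpect_ratioBound h0 h1 hU (Finset.filter_subset _ _)
    (disjoint_otherEdges U (v j.castSucc)) τ 0 (degIn_pos hvE j) (card_otherEdges_le _ _) hsmall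
  have h24 : (2 : ℝ) ^ K ≤ 4 ^ K := pow_le_pow_left₀ (by norm_num) (by norm_num) K
  have h6 : 2 ^ K * 4 * (k * η) ≤ 4 ^ K * 4 * (k * η) := by gcongr
  have h7 : 0 ≤ 4 ^ K * (k * η) := by positivity
  calc _ ≤ ((k : ℝ) + 1) ^ K * (η ^ U.card * (1 + 8 * 4 ^ K * (k * η))) := by
        refine mul_le_mul_of_nonneg_left (h2.trans ?_) (by positivity)
        refine mul_le_mul_of_nonneg_left ?_ (by positivity)
        rw [Nat.cast_zero, zero_div, add_zero]
        linarith
    _ = _ := by ring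

/-- AM–GM. It reduces the joint moment of dependent degree ratios to moments of single ones. -/
theorem prod_le_mean_pow {ι : Type} [Fintype ι] [Nonempty ι] {z : ι → ℝ} (hz : ∀ i, 0 ≤ z i) :
    ∏ i, z i ≤ 1 / (Fintype.card ι : ℝ) * ∑ i, z i ^ Fintype.card ι := by
  have hN : (Fintype.card ι : ℝ) ≠ 0 := by exact_mod_cast Fintype.card_ne_zero
  have h := Real.geom_mean_le_arith_mean_weighted Finset.univ
    (fun _ : ι => 1 / (Fintype.card ι : ℝ)) (fun i => z i ^ Fintype.card ι)
    (fun _ _ => by positivity) (by simp [hN]) fun i _ => pow_nonneg (hz i) _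
  rw [Finset.mul_sum]
  refine le_trans (le_of_eq (Finset.prod_congr rfl fun i _ => ?_)) h
  rw [one_div, Real.pow_rpow_inv_natCast (hz i) Fintype.card_ne_zero]

/-- The label of an edge of two walks. -/
noncomputable def pairLabel [NeZero k] (v w : Fin (k + 1) → Fin n) (e : Sym2 (Fin n)) : Fin k :=
  if e ∈ edgeSet v then labelOf v e else labelOf w e

theorem fitsOn_pairLabel [NeZero k] {ℓ : Sym2 (Fin n) → Option (Fin k)} (hv : LabelsFit ℓ v)
    (hw : LabelsFit ℓ w) : FitsOn (edgeSet v ∪ edgeSet w) (pairLabel v w) ℓ := by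
  intro e he
  rw [pairLabel]
  split_ifs with h
  · exact labelsFit_iff.1 hv e h
  · exact labelsFit_iff.1 hw e ((Finset.mem_union.1 he).resolve_left h)

theorem extraDeg_union_le (v w : Fin (k + 1) → Fin n) (j : Fin k) :
    extraDeg (edgeSet v ∪ edgeSet w) v j ≤ k ∧ extraDeg (edgeSet v ∪ edgeSet w) w j ≤ k := by
  constructor
  · refine le_trans (Finset.card_le_card fun e he => ?_) (card_edgeSet_le w)
    have h := Finset.mem_sdiff.1 (Finset.mem_filter.1 he).1
    exact (Finset.mem_union.1 h.1).resolve_left h.2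
  · refine le_trans (Finset.card_le_card fun e he => ?_) (card_edgeSet_le v)
    have h := Finset.mem_sdiff.1 (Finset.mem_filter.1 he).1
    exact (Finset.mem_union.1 h.1).resolve_right h.2

/-- The probability of a walk in the graph with the edge set `E`. -/
noncomputable def walkWeightIn (E : Finset (Sym2 (Fin n))) (v : Fin (k + 1) → Fin n) : ℝ :=
  1 / (n : ℝ) * ∏ j : Fin k, 1 / (degIn E (v j.castSucc) : ℝ)

theorem walkWeightIn_nonneg : 0 ≤ walkWeightIn E v := by
  unfold walkWeightIn
  positivity

/-- Both walks can only fit if all edges of the union have prescribed labels. What remains is a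
product of 2k degree ratios, which `prod_le_mean_pow` turns into 2k-th powers of single ratios,
bounded by `M`. The powers of η stem from the old steps of each walk and from the labels of the
union. -/
theorem labelExpect_walkMass_mul_le [NeZero k] (h0 : 0 ≤ η) (h1 : k * η ≤ 1)
    (hvE : edgeSet v ⊆ E) (hwE : edgeSet w ⊆ E) {M : ℝ}
    (hMv : ∀ j, labelExpect η E (fun ℓ => ind (FitsOn (edgeSet v ∪ edgeSet w) (pairLabel v w) ℓ) *
      degRatio E ℓ v j ^ (2 * k)) ≤ η ^ (edgeSet v ∪ edgeSet w).card * M)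
    (hMw : ∀ j, labelExpect η E (fun ℓ => ind (FitsOn (edgeSet v ∪ edgeSet w) (pairLabel v w) ℓ) *
      degRatio E ℓ w j ^ (2 * k)) ≤ η ^ (edgeSet v ∪ edgeSet w).card * M) :
    labelExpect η E (fun ℓ : Sym2 (Fin n) → Option (Fin k) =>
        walkMass η E ℓ v * walkMass η E ℓ w) ≤
      (1 / (k ! : ℝ)) ^ 2 * (walkWeightIn E v * walkWeightIn E w) *
        (η ^ (k - (edgeSet v).card) * η ^ (k - (edgeSet w).card) *
          η ^ (edgeSet v ∪ edgeSet w).card * M) := by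
  have hk0 : (k : ℝ) ≠ 0 := by exact_mod_cast NeZero.ne k
  set U := edgeSet v ∪ edgeSet w with hU
  set c : ℝ := (1 / (k ! : ℝ)) ^ 2 * (walkWeightIn E v * walkWeightIn E w) *
    (η ^ (k - (edgeSet v).card) * η ^ (k - (edgeSet w).card)) with hc
  have hc0 : 0 ≤ c := by
    have := walkWeightIn_nonneg (E := E) (v := v)
    have := walkWeightIn_nonneg (E := E) (v := w)
    positivity
  have hsplit : ∀ (u : Fin (k + 1) → Fin n) (ℓ : Sym2 (Fin n) → Option (Fin k)),
      edgeSet u ⊆ E → ∏ j, 1 / (degHat E ℓ u j : ℝ) =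
        (∏ j : Fin k, 1 / (degIn E (u j.castSucc) : ℝ)) * ∏ j, degRatio E ℓ u j := by
    intro u ℓ hu
    rw [← Finset.prod_mul_distrib]
    refine Finset.prod_congr rfl fun j _ => ?_
    have hd : (degIn E (u j.castSucc) : ℝ) ≠ 0 := by
      exact_mod_cast Nat.ne_of_gt (degIn_pos hu j)
    rw [degRatio]
    field_simp
  have hpt : ∀ ℓ : Sym2 (Fin n) → Option (Fin k), walkMass η E ℓ v * walkMass η E ℓ w ≤
      c * (1 / (2 * (k : ℝ)) *
        (∑ j, ind (FitsOn U (pairLabel v w) ℓ) * degRatio E ℓ v j ^ (2 * k) +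
          ∑ j, ind (FitsOn U (pairLabel v w) ℓ) * degRatio E ℓ w j ^ (2 * k))) := by
    intro ℓ
    have hind : ind (LabelsFit ℓ v) * ind (LabelsFit ℓ w) ≤ ind (FitsOn U (pairLabel v w) ℓ) := by
      by_cases hv : LabelsFit ℓ v
      · by_cases hw : LabelsFit ℓ w
        · rw [ind_of hv, ind_of hw, ind_of (fitsOn_pairLabel hv hw), one_mul]
        · rw [ind_of_not hw, mul_zero]
          exact ind_nonneg _
      · rw [ind_of_not hv, zero_mul]
        exact ind_nonneg _
    have hv0 := fun j => degRatio_nonneg (E := E) (ℓ := ℓ) (v := v) j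
    have hw0 := fun j => degRatio_nonneg (E := E) (ℓ := ℓ) (v := w) j
    have hmean : (∏ j, degRatio E ℓ v j) * ∏ j, degRatio E ℓ w j ≤ 1 / (2 * (k : ℝ)) *
        (∑ j, degRatio E ℓ v j ^ (2 * k) + ∑ j, degRatio E ℓ w j ^ (2 * k)) := by
      have h2 := prod_le_mean_pow
        (z := (Sum.elim (degRatio E ℓ v) (degRatio E ℓ w) : Fin k ⊕ Fin k → ℝ))
        (fun i => by cases i <;> simp [hv0, hw0])
      simp only [Fintype.prod_sum_type, Fintype.sum_sum_type, Sum.elim_inl, Sum.elim_inr,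
        Fintype.card_sum, Fintype.card_fin] at h2
      rw [← two_mul] at h2
      push_cast at h2
      exact h2
    have hR0 : 0 ≤ (∏ j, degRatio E ℓ v j) * ∏ j, degRatio E ℓ w j :=
      mul_nonneg (Finset.prod_nonneg fun j _ => hv0 j) (Finset.prod_nonneg fun j _ => hw0 j)
    calc walkMass η E ℓ v * walkMass η E ℓ w ≤ _ :=
          mul_le_mul (walkMass_le h0) (walkMass_le h0) (walkMass_nonneg h0)
            ((walkMass_nonneg h0).trans (walkMass_le h0))
      _ = c * (ind (LabelsFit ℓ v) * ind (LabelsFit ℓ w) *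
            ((∏ j, degRatio E ℓ v j) * ∏ j, degRatio E ℓ w j)) := by
          rw [hsplit v ℓ hvE, hsplit w ℓ hwE, hc, walkWeightIn, walkWeightIn]
          ring
      _ ≤ c * (ind (FitsOn U (pairLabel v w) ℓ) * (1 / (2 * (k : ℝ)) *
            (∑ j, degRatio E ℓ v j ^ (2 * k) + ∑ j, degRatio E ℓ w j ^ (2 * k)))) :=
          mul_le_mul_of_nonneg_left (mul_le_mul hind hmean hR0 (ind_nonneg _)) hc0
      _ = _ := by
          rw [← Finset.mul_sum, ← Finset.mul_sum]
          ring
  refine (labelExpect_mono h0 h1 fun ℓ _ => hpt ℓ).trans ?_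
  rw [labelExpect_const_mul, labelExpect_const_mul, labelExpect_add, labelExpect_sum,
    labelExpect_sum]
  have h2 := Finset.sum_le_sum fun j (_ : j ∈ Finset.univ) => hMv j
  have h3 := Finset.sum_le_sum fun j (_ : j ∈ Finset.univ) => hMw j
  simp only [Finset.sum_const, Finset.card_univ, Fintype.card_fin, nsmul_eq_mul] at h2 h3
  calc _ ≤ c * (1 / (2 * (k : ℝ)) * (k * (η ^ U.card * M) + k * (η ^ U.card * M))) := by
        gcongr
    _ = _ := by
        rw [hc]
        field_simp
        ring

end Pairs

/-! ### Pairs of walks in a graph, and concentration of the mass of a set of walks -/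

section Graph

variable {n k : ℕ} (G : SimpleGraph (Fin n)) [DecidableRel G.Adj]

theorem degIn_edgeFinset (x : Fin n) : degIn G.edgeFinset x = G.degree x := by
  rw [← G.card_incidenceFinset_eq_degree x, G.incidenceFinset_eq_filter, degIn]

theorem edgeSet_subset_iff {v : Fin (k + 1) → Fin n} :
    edgeSet v ⊆ G.edgeFinset ↔ ∀ j : Fin k, G.Adj (v j.castSucc) (v j.succ) := by
  constructor
  · intro h j
    have := h (edgeAt_mem v j)
    rwa [SimpleGraph.mem_edgeFinset, edgeAt, SimpleGraph.mem_edgeSet] at this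
  · intro h e he
    obtain ⟨j, rfl⟩ := mem_edgeSet.1 he
    rw [SimpleGraph.mem_edgeFinset, edgeAt, SimpleGraph.mem_edgeSet]
    exact h j

theorem walkWeightIn_eq {v : Fin (k + 1) → Fin n} (h : edgeSet v ⊆ G.edgeFinset) :
    walkWeightIn G.edgeFinset v = walkWeight G v := by
  rw [walkWeightIn, walkWeight, pathWeight]
  congr 1
  refine Finset.prod_congr rfl fun j _ => ?_
  rw [stepWeight, if_pos ((edgeSet_subset_iff G).1 h j), degIn_edgeFinset]

theorem walkWeight_eq_zero {v : Fin (k + 1) → Fin n} (h : ¬edgeSet v ⊆ G.edgeFinset) :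
    walkWeight G v = 0 := by
  rw [edgeSet_subset_iff] at h
  push Not at h
  obtain ⟨j, hj⟩ := h
  rw [walkWeight, pathWeight, Finset.prod_eq_zero (Finset.mem_univ j) (if_neg hj), mul_zero]

theorem walkMass_eq_zero {E : Finset (Sym2 (Fin n))} {η : ℝ} {v : Fin (k + 1) → Fin n}
    {ℓ : Sym2 (Fin n) → Option (Fin k)}
    (hℓ : ∀ e, ℓ e ≠ none → e ∈ E) (h : ¬edgeSet v ⊆ E) : walkMass η E ℓ v = 0 := by
  rw [walkMass, if_neg fun hv => h (subset_of_labelsFit hℓ hv)]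

theorem Interfere.symm {η : ℝ} {v w : Fin (k + 1) → Fin n} (h : Interfere G η v w) :
    Interfere G η w v := by
  rcases h with ⟨i, j, h⟩ | ⟨i, j, h, h'⟩
  · exact Or.inl ⟨j, i, h.symm⟩
  · refine Or.inr ⟨j, i, h.symm, ?_⟩
    rw [h]
    exact h'

theorem exists_vertex_of_mem_edgeSet {v : Fin (k + 1) → Fin n} {e : Sym2 (Fin n)} {x : Fin n}
    (he : e ∈ edgeSet v) (hx : x ∈ e) : ∃ i, v i = x := by
  obtain ⟨j, rfl⟩ := mem_edgeSet.1 he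
  rw [edgeAt, Sym2.mem_iff] at hx
  exact hx.elim (fun h => ⟨_, h.symm⟩) fun h => ⟨_, h.symm⟩

/-- An extra edge at a vertex of v is an edge of w, so w visits this vertex; without interference
its degree is then at least 1/η. -/
theorem extraDeg_of_not_interfere {η : ℝ} (hη : 0 < η) {v w : Fin (k + 1) → Fin n}
    (h : ¬Interfere G η v w) (j : Fin k) :
    extraDeg (edgeSet v ∪ edgeSet w) v j = 0 ∨ 1 ≤ η * degIn G.edgeFinset (v j.castSucc) := by
  rw [or_iff_not_imp_left, extraDeg, ← Ne, Finset.card_ne_zero]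
  rintro ⟨e, he⟩
  rw [Finset.mem_filter, Finset.mem_sdiff, Finset.mem_union] at he
  obtain ⟨i, hi⟩ := exists_vertex_of_mem_edgeSet (he.1.1.resolve_left he.1.2) he.2
  by_contra hlt
  refine h (Or.inr ⟨_, i, hi, ?_⟩)
  rw [degIn_edgeFinset] at hlt
  rw [lt_div_iff₀ hη, mul_comm]
  exact not_le.1 hlt

theorem extraDeg_union_comm (v w : Fin (k + 1) → Fin n) (j : Fin k) :
    extraDeg (edgeSet v ∪ edgeSet w) w j = extraDeg (edgeSet w ∪ edgeSet v) w j := by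
  rw [Finset.union_comm]

open Classical in
/-- The correlation of two walks. -/
theorem labelExpect_pair_le [NeZero k] {η : ℝ} (h0 : 0 < η) (h1 : k * η ≤ 1)
    (hsmall : 2 ^ (2 * k) * 4 * (k * η) ≤ 1) (v w : Fin (k + 1) → Fin n) :
    labelExpect η G.edgeFinset (fun ℓ : Sym2 (Fin n) → Option (Fin k) =>
        walkMass η G.edgeFinset ℓ v * walkMass η G.edgeFinset ℓ w) ≤
      (η ^ k / (k ! : ℝ)) ^ 2 * (1 + 8 * 4 ^ (2 * k) * (k * η)) *
        (walkWeight G v * walkWeight G w + (((k : ℝ) + 1) ^ (2 * k) / η ^ k) *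
          if Interfere G η v w then walkWeight G v * walkWeight G w else 0) := by
  have hk1 : (1 : ℝ) ≤ k := by exact_mod_cast NeZero.pos k
  have hη1 : η ≤ 1 := le_trans (le_mul_of_one_le_left h0.le hk1) h1
  have hv0 := walkWeight_nonneg G v
  have hw0 := walkWeight_nonneg G w
  have hrhs : 0 ≤ (η ^ k / (k ! : ℝ)) ^ 2 * (1 + 8 * 4 ^ (2 * k) * (k * η)) *
        (walkWeight G v * walkWeight G w + (((k : ℝ) + 1) ^ (2 * k) / η ^ k) *
          if Interfere G η v w then walkWeight G v * walkWeight G w else 0) := by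
    have : 0 ≤ if Interfere G η v w then walkWeight G v * walkWeight G w else 0 := by
      split_ifs <;> positivity
    positivity
  by_cases hvE : edgeSet v ⊆ G.edgeFinset
  swap
  · refine le_trans (labelExpect_mono (F' := fun _ => 0) h0.le h1 fun ℓ hℓ => ?_)
      (by simpa [labelExpect] using hrhs)
    rw [walkMass_eq_zero hℓ hvE, zero_mul]
  by_cases hwE : edgeSet w ⊆ G.edgeFinset
  swap
  · refine le_trans (labelExpect_mono (F' := fun _ => 0) h0.le h1 fun ℓ hℓ => ?_)
      (by simpa [labelExpect] using hrhs)
    rw [walkMass_eq_zero hℓ hwE, mul_zero]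
  have hUE : edgeSet v ∪ edgeSet w ⊆ G.edgeFinset := Finset.union_subset hvE hwE
  have hvk := card_edgeSet_le v
  have hwk := card_edgeSet_le w
  have hηk : 0 < η ^ k := pow_pos h0 k
  by_cases hI : Interfere G η v w
  · have h := labelExpect_walkMass_mul_le (M := (1 + 8 * 4 ^ (2 * k) * (k * η)) *
      ((k : ℝ) + 1) ^ (2 * k)) h0.le h1 hvE hwE
      (fun j => labelExpect_degRatio_crude h0.le h1 hsmall hvE hUE _ j (extraDeg_union_le v w j).1)
      (fun j => labelExpect_degRatio_crude h0.le h1 hsmall hwE hUE _ j (extraDeg_union_le v w j).2)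
    refine h.trans ?_
    rw [walkWeightIn_eq G hvE, walkWeightIn_eq G hwE, if_pos hI]
    -- The union has at least as many edges as w, so the exponents add up to at least k. Compared
    -- with the η^(2k) of independent walks, at most a factor η^(-k) is lost.
    have h2 : η ^ (k - (edgeSet v).card) * η ^ (k - (edgeSet w).card) *
          η ^ (edgeSet v ∪ edgeSet w).card ≤ η ^ k := by
      rw [← pow_add, ← pow_add]
      refine pow_le_pow_of_le_one h0.le hη1 ?_
      have := Finset.card_le_card (Finset.subset_union_right (s₁ := edgeSet v) (s₂ := edgeSet w))
      omega
    calc _ ≤ (1 / (k ! : ℝ)) ^ 2 * (walkWeight G v * walkWeight G w) *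
          (η ^ k * ((1 + 8 * 4 ^ (2 * k) * (k * η)) * ((k : ℝ) + 1) ^ (2 * k))) := by gcongr
      _ = (η ^ k / (k ! : ℝ)) ^ 2 * (1 + 8 * 4 ^ (2 * k) * (k * η)) *
          (0 + (((k : ℝ) + 1) ^ (2 * k) / η ^ k) * (walkWeight G v * walkWeight G w)) := by
          field_simp
          ring
      _ ≤ _ := by
          gcongr
          positivity
  · have h := labelExpect_walkMass_mul_le (M := 1 + 8 * 4 ^ (2 * k) * (k * η)) h0.le h1 hvE hwE
      (fun j => labelExpect_degRatio h0.le h1 hsmall hvE hUE _ j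
        (extraDeg_of_not_interfere G h0 hI j) (extraDeg_union_le v w j).1)
      (fun j => labelExpect_degRatio h0.le h1 hsmall hwE hUE _ j (by
        rw [extraDeg_union_comm]
        exact extraDeg_of_not_interfere G h0 (fun h => hI h.symm) j) (extraDeg_union_le v w j).2)
    refine h.trans ?_
    rw [walkWeightIn_eq G hvE, walkWeightIn_eq G hwE, if_neg hI, mul_zero, add_zero]
    have hdis : Disjoint (edgeSet v) (edgeSet w) := by
      rw [Finset.disjoint_left]
      intro e he he'
      obtain ⟨i, rfl⟩ := mem_edgeSet.1 he
      obtain ⟨j, hj⟩ := mem_edgeSet.1 he'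
      exact hI (Or.inl ⟨i, j, hj⟩)
    -- For disjoint edge sets the exponents add up to exactly 2k, as for independent masses.
    have h2 : η ^ (k - (edgeSet v).card) * η ^ (k - (edgeSet w).card) *
          η ^ (edgeSet v ∪ edgeSet w).card = η ^ k * η ^ k := by
      rw [Finset.card_union_of_disjoint hdis, ← pow_add, ← pow_add, ← pow_add]
      congr 1
      omega
    rw [h2]
    apply le_of_eq
    ring

theorem labelExpect_walkMass_ge [NeZero k] {η : ℝ} (h0 : 0 ≤ η) (h1 : k * η ≤ 1)
    (v : Fin (k + 1) → Fin n) :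
    (1 - 2 * k * (k * η)) * (η ^ k / (k ! : ℝ)) * walkWeight G v ≤
      labelExpect η G.edgeFinset fun ℓ : Sym2 (Fin n) → Option (Fin k) =>
        walkMass η G.edgeFinset ℓ v := by
  by_cases hvE : edgeSet v ⊆ G.edgeFinset
  · rw [← walkWeightIn_eq G hvE]
    exact le_labelExpect_walkMass h0 h1 hvE
  · rw [walkWeight_eq_zero G hvE, mul_zero]
    refine le_trans (by simp [labelExpect]) (labelExpect_mono (F := fun _ => 0) h0 h1 fun ℓ _ =>
      walkMass_nonneg h0)

open Classical in
/-- The mass of a set of walks is concentrated. -/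
theorem labelExpect_sq_le [NeZero n] [NeZero k] (hdeg : ∀ v, 0 < G.degree v) {η : ℝ} (h0 : 0 < η)
    (h1 : k * η ≤ 1) (hsmall : 2 ^ (2 * k) * 4 * (k * η) ≤ 1)
    (A : Finset (Fin (k + 1) → Fin n)) :
    labelExpect η G.edgeFinset (fun ℓ : Sym2 (Fin n) → Option (Fin k) =>
      (∑ v ∈ A, walkMass η G.edgeFinset ℓ v -
        η ^ k / (k ! : ℝ) * ∑ v ∈ A, walkWeight G v) ^ 2) ≤
      (η ^ k / (k ! : ℝ)) ^ 2 * (8 * 4 ^ (2 * k) * (k * η) + 4 * k * (k * η) +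
        (1 + 8 * 4 ^ (2 * k) * (k * η)) * ((((k : ℝ) + 1) ^ (2 * k) / η ^ k) *
          ((2 * (k : ℝ) ^ 2 + ((k : ℝ) + 1) ^ 2 / η) / n))) := by
  set μ : ℝ := η ^ k / (k ! : ℝ) with hμ
  set r : ℝ := ∑ v ∈ A, walkWeight G v with hr
  set δ : ℝ := 8 * 4 ^ (2 * k) * (k * η) with hδ
  set B : ℝ := ((k : ℝ) + 1) ^ (2 * k) / η ^ k with hB
  have hB0 : 0 ≤ B := by positivity
  have hδ0 : 0 ≤ δ := by positivity
  have hμ0 : 0 ≤ μ := by positivity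
  have hr0 : 0 ≤ r := Finset.sum_nonneg fun v _ => walkWeight_nonneg G v
  have hr1 : r ≤ 1 := by
    rw [← sum_walkWeight G hdeg k]
    exact Finset.sum_le_sum_of_subset_of_nonneg (Finset.subset_univ _)
      fun v _ _ => walkWeight_nonneg G v
  -- The deviation is taken from μr and not from the mean, so an upper bound on the second moment
  -- and a lower bound on the first are enough.
  have hexp : ∀ ℓ : Sym2 (Fin n) → Option (Fin k),
      (∑ v ∈ A, walkMass η G.edgeFinset ℓ v - μ * r) ^ 2 =
        (∑ v ∈ A, ∑ w ∈ A, walkMass η G.edgeFinset ℓ v * walkMass η G.edgeFinset ℓ w) +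
        (-(2 * (μ * r))) * (∑ v ∈ A, walkMass η G.edgeFinset ℓ v) + (μ * r) ^ 2 * 1 := by
    intro ℓ
    rw [← Finset.sum_mul_sum]
    ring
  have hone : labelExpect η G.edgeFinset
      (fun _ : Sym2 (Fin n) → Option (Fin k) => (1 : ℝ)) = 1 := by
    have h := labelExpect_fits (η := η) (Finset.empty_subset G.edgeFinset)
      (fun _ => (0 : Fin k))
    simpa [FitsOn, ind] using h
  simp only [hexp]
  rw [labelExpect_add, labelExpect_add, labelExpect_const_mul, labelExpect_const_mul, hone,
    labelExpect_sum, labelExpect_sum]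
  simp only [labelExpect_sum]
  have hfirst : (1 - 2 * k * (k * η)) * μ * r ≤ ∑ v ∈ A, labelExpect η G.edgeFinset
      fun ℓ : Sym2 (Fin n) → Option (Fin k) => walkMass η G.edgeFinset ℓ v := by
    rw [hr, Finset.mul_sum]
    exact Finset.sum_le_sum fun v _ => labelExpect_walkMass_ge G h0.le h1 v
  have hsecond : (∑ v ∈ A, ∑ w ∈ A, labelExpect η G.edgeFinset
      fun ℓ : Sym2 (Fin n) → Option (Fin k) =>
        walkMass η G.edgeFinset ℓ v * walkMass η G.edgeFinset ℓ w) ≤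
      μ ^ 2 * (1 + δ) * (r ^ 2 +
        B * ((2 * (k : ℝ) ^ 2 + ((k : ℝ) + 1) ^ 2 / η) / n)) := by
    calc _ ≤ ∑ v ∈ A, ∑ w ∈ A, μ ^ 2 * (1 + δ) *
          (walkWeight G v * walkWeight G w + B *
            if Interfere G η v w then walkWeight G v * walkWeight G w else 0) :=
          Finset.sum_le_sum fun v _ => Finset.sum_le_sum fun w _ =>
            labelExpect_pair_le G h0 h1 hsmall v w
      _ = μ ^ 2 * (1 + δ) * (r ^ 2 + B * ∑ v ∈ A, ∑ w ∈ A,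
            if Interfere G η v w then walkWeight G v * walkWeight G w else 0) := by
          simp only [← Finset.mul_sum, Finset.sum_add_distrib]
          rw [sq r, hr, Finset.sum_mul_sum]
          simp only [Finset.mul_sum]
      _ ≤ _ := by
          gcongr
          refine le_trans ?_ (sum_interfere_le G hdeg h0 k)
          have hnn : ∀ v w : Fin (k + 1) → Fin n,
              0 ≤ if Interfere G η v w then walkWeight G v * walkWeight G w else 0 := by
            intro v w
            have := walkWeight_nonneg G v
            have := walkWeight_nonneg G w
            split_ifs <;> positivity
          refine le_trans (Finset.sum_le_sum fun v _ =>
            Finset.sum_le_sum_of_subset_of_nonneg (Finset.subset_univ A) fun w _ _ => hnn v w) ?_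
          exact Finset.sum_le_sum_of_subset_of_nonneg (Finset.subset_univ A)
            fun v _ _ => Finset.sum_nonneg fun w _ => hnn v w
  have h3 := mul_le_mul_of_nonneg_left hfirst (by positivity : 0 ≤ 2 * (μ * r))
  have hr2 : r ^ 2 ≤ 1 := pow_le_one₀ hr0 hr1
  have h4 : μ ^ 2 * (δ + 4 * k * (k * η)) * r ^ 2 ≤ μ ^ 2 * (δ + 4 * k * (k * η)) * 1 := by
    gcongr
  nlinarith [hsecond, h3, h4]

end Graph

end RandomWalkStream

namespace RandomWalkStream

/-! ### The fraction of closed walks among the first accepted ones -/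

section Sampling

variable {α : Type} [Fintype α]

/-- The expectation over independent samples with the same distribution. -/
noncomputable def sampleExpect (w : Option α → ℝ) (s : ℕ) (F : List α → ℝ) : ℝ :=
  ∑ v : Fin s → Option α, (∏ i, w (v i)) * F (List.ofFn v).reduceOption

theorem sampleExpect_zero (w : Option α → ℝ) (F : List α → ℝ) : sampleExpect w 0 F = F [] := by
  rw [sampleExpect, Fintype.sum_unique]
  simp [List.reduceOption]

theorem sampleExpect_succ (w : Option α → ℝ) (s : ℕ) (F : List α → ℝ) :
    sampleExpect w (s + 1) F = w none * sampleExpect w s F +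
      ∑ a, w (some a) * sampleExpect w s fun l => F (a :: l) := by
  have h : ∀ (a : Option α) (v : Fin s → Option α),
      (∏ i, w ((Fin.cons a v : Fin (s + 1) → Option α) i)) *
        F (List.ofFn (Fin.cons a v : Fin (s + 1) → Option α)).reduceOption =
      w a * ((∏ i, w (v i)) * F (a :: List.ofFn v).reduceOption) := by
    intro a v
    rw [Fin.prod_univ_succ, List.ofFn_succ]
    simp only [Fin.cons_zero, Fin.cons_succ]
    rw [mul_assoc]
  rw [sampleExpect, sum_cons]
  simp only [h, ← Finset.mul_sum]
  rw [Fintype.sum_option]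
  simp only [List.reduceOption_cons_of_none, List.reduceOption_cons_of_some]
  rfl

theorem sampleExpect_mono {w : Option α → ℝ} (hw : ∀ a, 0 ≤ w a) {s : ℕ} {F F' : List α → ℝ}
    (h : ∀ l, F l ≤ F' l) : sampleExpect w s F ≤ sampleExpect w s F' :=
  Finset.sum_le_sum fun v _ => mul_le_mul_of_nonneg_left (h _)
    (Finset.prod_nonneg fun i _ => hw (v i))

theorem sampleExpect_add (w : Option α → ℝ) (s : ℕ) (F F' : List α → ℝ) :
    sampleExpect w s (fun l => F l + F' l) = sampleExpect w s F + sampleExpect w s F' := by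
  simp only [sampleExpect, mul_add, Finset.sum_add_distrib]

theorem sampleExpect_const_mul (w : Option α → ℝ) (s : ℕ) (c : ℝ) (F : List α → ℝ) :
    sampleExpect w s (fun l => c * F l) = c * sampleExpect w s F := by
  simp only [sampleExpect, Finset.mul_sum, mul_left_comm]

theorem sampleExpect_one {w : Option α → ℝ} (hw : ∑ a, w a = 1) (s : ℕ) :
    sampleExpect w s (fun _ => 1) = 1 := by
  induction s with
  | zero => exact sampleExpect_zero w _
  | succ s ih => rw [sampleExpect_succ, ih, ← Finset.sum_mul, ← add_mul,
      ← Fintype.sum_option, hw, one_mul]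

/-- A generating function: each sample contributes the factor 1 - P/2, where P is the acceptance
probability. Multiplied by 2^b it bounds the probability of fewer than b acceptances. -/
theorem sampleExpect_half_pow {w : Option α → ℝ} (hw : ∑ a, w a = 1) (s : ℕ) :
    sampleExpect w s (fun l => (1 / 2) ^ l.length) = (1 - (∑ a, w (some a)) / 2) ^ s := by
  induction s with
  | zero => simp [sampleExpect_zero]
  | succ s ih =>
    rw [sampleExpect_succ, ih]
    have h : ∀ a : α, (fun l : List α => ((1 : ℝ) / 2) ^ (a :: l).length) =
        fun l => 1 / 2 * (1 / 2) ^ l.length := fun a => by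
      funext l
      rw [List.length_cons, pow_succ, mul_comm]
    simp only [h, sampleExpect_const_mul, ih]
    rw [← Finset.sum_mul, pow_succ]
    rw [Fintype.sum_option] at hw
    have : w none = 1 - ∑ a, w (some a) := by linarith
    rw [this]
    ring

/-- The sum of a function over the first accepted samples. -/
noncomputable def takeSum (f : α → ℝ) (b : ℕ) (l : List α) : ℝ := ((l.take b).map f).sum

/-- Conditioning on the first sample: a rejection leaves b as it is, an acceptance adds a value that
is centred and leaves b - 1. Stopping does not bias the sum. -/
theorem sampleExpect_takeSum {w : Option α → ℝ} {f : α → ℝ}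
    (hw : ∑ a, w a = 1) (hf : ∑ a, w (some a) * f a = 0) (s b : ℕ) :
    sampleExpect w s (takeSum f b) = 0 := by
  induction s generalizing b with
  | zero => simp [sampleExpect_zero, takeSum]
  | succ s ih =>
    rw [sampleExpect_succ, ih, mul_zero, zero_add]
    cases b with
    | zero => simp [takeSum, sampleExpect]
    | succ b =>
      have h : ∀ a : α, sampleExpect w s (fun l => takeSum f (b + 1) (a :: l)) = f a := by
        intro a
        have h1 : (fun l => takeSum f (b + 1) (a :: l)) =
            fun l => f a * 1 + takeSum f b l := by
          funext l
          simp [takeSum]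
        rw [h1, sampleExpect_add, sampleExpect_const_mul, sampleExpect_one hw, ih, mul_one,
          add_zero]
      simp only [h, hf]

/-- The cross terms vanish by `sampleExpect_takeSum`, so each of the at most b counted samples adds
at most 1, however large s is. -/
theorem sampleExpect_takeSum_sq {w : Option α → ℝ} (hw0 : ∀ a, 0 ≤ w a) {f : α → ℝ}
    (hw : ∑ a, w a = 1) (hf : ∑ a, w (some a) * f a = 0) (hf1 : ∀ a, f a ^ 2 ≤ 1) (s b : ℕ) :
    sampleExpect w s (fun l => takeSum f b l ^ 2) ≤ b := by
  induction s generalizing b with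
  | zero =>
    rw [sampleExpect_zero]
    simp [takeSum]
  | succ s ih =>
    cases b with
    | zero => simp [takeSum, sampleExpect]
    | succ b =>
      rw [sampleExpect_succ]
      have h : ∀ a : α, sampleExpect w s (fun l => takeSum f (b + 1) (a :: l) ^ 2) ≤
          (b + 1 : ℕ) := by
        intro a
        have h1 : (fun l => takeSum f (b + 1) (a :: l) ^ 2) =
            fun l => f a ^ 2 * 1 + 2 * f a * takeSum f b l + takeSum f b l ^ 2 := by
          funext l
          simp only [takeSum, List.take_succ_cons, List.map_cons, List.sum_cons]
          ring
        rw [h1, sampleExpect_add, sampleExpect_add, sampleExpect_const_mul, sampleExpect_const_mul,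
          sampleExpect_one hw, sampleExpect_takeSum hw hf]
        push_cast
        linarith [ih b, hf1 a]
      calc _ ≤ w none * ((b + 1 : ℕ) : ℝ) + ∑ a, w (some a) * ((b + 1 : ℕ) : ℝ) :=
            add_le_add (mul_le_mul_of_nonneg_left (ih (b + 1)) (hw0 _))
              (Finset.sum_le_sum fun a _ => mul_le_mul_of_nonneg_left (h a) (hw0 _))
        _ = _ := by rw [← Finset.sum_mul, ← add_mul, ← Fintype.sum_option, hw, one_mul]

theorem takeSum_eq_countP {β : Type} (c : β → Bool) (ρ : ℝ) {b : ℕ} {l : List β} (hb : b ≤ l.length) :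
    takeSum (fun a => (if c a then 1 else 0) - ρ) b l = ((l.take b).countP c : ℝ) - b * ρ := by
  have h : ∀ l : List β, (l.map fun a => (if c a then (1 : ℝ) else 0) - ρ).sum =
      (l.countP c : ℝ) - l.length * ρ := by
    intro l
    induction l with
    | nil => simp
    | cons a l ih =>
      rw [List.map_cons, List.sum_cons, ih, List.countP_cons, List.length_cons]
      push_cast
      split_ifs <;> ring
  rw [takeSum, h, List.length_take, min_eq_left hb]

/-- Too few accepted samples, or a bad empirical frequency. -/
def BadSample (c : α → Bool) (b : ℕ) (r ε : ℝ) (l : List α) : Prop :=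
  b ≤ l.length → ε < |r - 1 / (b : ℝ) * ((l.take b).countP c : ℝ)|

theorem sampleExpect_bad_le {w : Option α → ℝ} (hw0 : ∀ a, 0 ≤ w a) (hw : ∑ a, w a = 1)
    (c : α → Bool) {b s : ℕ} {r ε : ℝ} (hb : 1 ≤ b) (hε : 0 < ε) (hbε : 160 ≤ b * ε ^ 2)
    (hs : 50 * (b : ℝ) ≤ s * ∑ a, w (some a))
    (hr : |r - (∑ a, w (some a) * if c a then 1 else 0) / ∑ a, w (some a)| ≤ ε / 2) :
    sampleExpect w s (fun l => ind (BadSample c b r ε l)) ≤ 1 / 20 := by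
  set P := ∑ a, w (some a) with hP
  set ρ := (∑ a, w (some a) * if c a then 1 else 0) / P with hρ
  have hb0 : (1 : ℝ) ≤ b := by exact_mod_cast hb
  have hP0 : 0 < P := by
    by_contra h
    have : (s : ℝ) * P ≤ 0 := mul_nonpos_of_nonneg_of_nonpos (Nat.cast_nonneg s) (not_lt.1 h)
    linarith
  have hP1 : P ≤ 1 := by
    rw [Fintype.sum_option] at hw
    linarith [hw0 none]
  have hQ0 : 0 ≤ ∑ a, w (some a) * if c a then 1 else 0 :=
    Finset.sum_nonneg fun a _ => mul_nonneg (hw0 _) (by split_ifs <;> norm_num)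
  have hQP : (∑ a, w (some a) * if c a then 1 else 0) ≤ P :=
    Finset.sum_le_sum fun a _ => mul_le_of_le_one_right (hw0 _) (by split_ifs <;> norm_num)
  have hρ0 : 0 ≤ ρ := div_nonneg hQ0 hP0.le
  have hρ1 : ρ ≤ 1 := (div_le_one hP0).2 hQP
  set f : α → ℝ := fun a => (if c a then 1 else 0) - ρ with hf
  have hf0 : ∑ a, w (some a) * f a = 0 := by
    simp only [hf, mul_sub, Finset.sum_sub_distrib, ← Finset.sum_mul, ← hP]
    rw [hρ]
    field_simp
    ring
  have hf1 : ∀ a, f a ^ 2 ≤ 1 := by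
    intro a
    simp only [hf]
    split_ifs <;> nlinarith
  -- With N acceptances, N < b makes the first term at least 1. Otherwise the frequency is off from
  -- ρ by more than ε/2, so the centred sum exceeds bε/2 and the second term is at least 1. Their
  -- expectations are at most exp(-24b) and 4/(bε²), each at most 1/40.
  have hpt : ∀ l : List α, ind (BadSample c b r ε l) ≤
      2 ^ b * (1 / 2) ^ l.length + 4 / (b * ε) ^ 2 * takeSum f b l ^ 2 := by
    intro l
    have h1 : (0 : ℝ) ≤ 2 ^ b * (1 / 2) ^ l.length := by positivity
    have h2 : 0 ≤ 4 / (b * ε) ^ 2 * takeSum f b l ^ 2 := by positivity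
    by_cases hbad : BadSample c b r ε l
    · rw [ind_of hbad]
      by_cases hl : b ≤ l.length
      · have h3 := hbad hl
        have h4 := takeSum_eq_countP c ρ hl
        set N : ℝ := ((l.take b).countP c : ℝ) with hN
        have h5 : ε / 2 < |ρ - 1 / (b : ℝ) * N| := by
          have := abs_sub_le r ρ (1 / (b : ℝ) * N)
          linarith
        have h6 : takeSum f b l = -(b * (ρ - 1 / (b : ℝ) * N)) := by
          rw [hf, h4]
          field_simp
          ring
        have h7 : (ε / 2) ^ 2 ≤ (ρ - 1 / (b : ℝ) * N) ^ 2 := by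
          rw [← sq_abs (ρ - _)]
          exact pow_le_pow_left₀ (by positivity) h5.le 2
        have h8 : 1 ≤ 4 / (b * ε) ^ 2 * takeSum f b l ^ 2 := by
          rw [h6, div_mul_eq_mul_div, le_div_iff₀ (by positivity)]
          nlinarith [mul_le_mul_of_nonneg_left h7 (by positivity : (0 : ℝ) ≤ 4 * b ^ 2)]
        linarith
      · have h3 : (1 : ℝ) ≤ 2 ^ b * (1 / 2) ^ l.length := by
          rw [one_div, inv_pow, ← div_eq_mul_inv, one_le_div (by positivity)]
          exact pow_le_pow_right₀ (by norm_num) (not_le.1 hl).le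
        linarith
    · rw [ind_of_not hbad]
      linarith
  refine (sampleExpect_mono hw0 hpt).trans ?_
  rw [sampleExpect_add, sampleExpect_const_mul, sampleExpect_const_mul, sampleExpect_half_pow hw]
  have h1 : (2 : ℝ) ^ b * (1 - P / 2) ^ s ≤ 1 / 40 := by
    have h2 : (1 - P / 2) ^ s ≤ Real.exp (-(25 * b)) := by
      calc (1 - P / 2) ^ s ≤ Real.exp (-(P / 2)) ^ s :=
            pow_le_pow_left₀ (by linarith) (Real.one_sub_le_exp_neg _) s
        _ = Real.exp (s * -(P / 2)) := (Real.exp_nat_mul _ _).symm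
        _ ≤ _ := Real.exp_le_exp.2 (by linarith)
    have h3 : (2 : ℝ) ^ b ≤ Real.exp b := by
      have : (2 : ℝ) ≤ Real.exp 1 := by linarith [Real.add_one_le_exp (1 : ℝ)]
      calc (2 : ℝ) ^ b ≤ Real.exp 1 ^ b := pow_le_pow_left₀ (by norm_num) this b
        _ = _ := by rw [← Real.exp_nat_mul, mul_one]
    calc _ ≤ Real.exp b * Real.exp (-(25 * b)) :=
          mul_le_mul h3 h2 (pow_nonneg (by linarith) _) (Real.exp_pos _).le
      _ = Real.exp (-(24 * b)) := by rw [← Real.exp_add]; ring_nf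
      _ ≤ 1 / 40 := by
          rw [Real.exp_neg, ← one_div]
          refine one_div_le_one_div_of_le (by norm_num) ?_
          have h4 : (40 : ℝ) ≤ (2 : ℝ) ^ 24 := by norm_num
          have : (2 : ℝ) ≤ Real.exp 1 := by linarith [Real.add_one_le_exp (1 : ℝ)]
          calc (40 : ℝ) ≤ 2 ^ 24 := h4
            _ ≤ Real.exp 1 ^ 24 := pow_le_pow_left₀ (by norm_num) this 24
            _ = Real.exp 24 := by rw [← Real.exp_nat_mul]; norm_num
            _ ≤ _ := Real.exp_le_exp.2 (by linarith)
  have h2 : 4 / (b * ε) ^ 2 * sampleExpect w s (fun l => takeSum f b l ^ 2) ≤ 1 / 40 := by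
    calc _ ≤ 4 / (b * ε) ^ 2 * b := by
          gcongr
          exact sampleExpect_takeSum_sq hw0 hw hf0 hf1 s b
      _ ≤ 1 / 40 := by
          rw [div_mul_eq_mul_div, div_le_div_iff₀ (by positivity) (by norm_num)]
          nlinarith
  linarith

end Sampling

/-! ### From the outcome of one walker to the output of the algorithm -/

section Output

variable {n k : ℕ}

/-- The outputs that approximate a number. -/
def goodOutput (r ε : ℝ) : Set (Option ℝ) := {o | ∃ x : ℝ, o = some x ∧ |r - x| ≤ ε}

theorem outputOf_notMem_iff {s b : ℕ} {r ε : ℝ} (v : Fin s → Option (Fin (k + 1) → Fin n)) :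
    outputOf b v ∈ (goodOutput r ε)ᶜ ↔
      BadSample (fun v : Fin (k + 1) → Fin n => decide (v (Fin.last k) = v 0)) b r ε
        (List.ofFn v).reduceOption := by
  unfold outputOf BadSample goodOutput
  by_cases hb : b ≤ (List.ofFn v).reduceOption.length <;> simp [hb]

/-- The failure probability of independent walks, in terms of the outcome of a single walk. -/
theorem expect_output_bad_le {s b : ℕ} {r ε : ℝ} (p : PMF (Option (Fin (k + 1) → Fin n)))
    {w : (Fin (k + 1) → Fin n) → ℝ} (hw0 : ∀ v, 0 ≤ w v)
    (hp : ∀ v, p (some v) = ENNReal.ofReal (w v)) (hb : 1 ≤ b) (hε : 0 < ε)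
    (hbε : 160 ≤ b * ε ^ 2) (hs : 50 * (b : ℝ) ≤ s * ∑ v, w v)
    (hr : |r - (∑ v ∈ Finset.univ.filter
      (fun v : Fin (k + 1) → Fin n => v (Fin.last k) = v 0), w v) / ∑ v, w v| ≤ ε / 2) :
    expect ((indep fun _ : Fin s => p).map (outputOf b)) ((goodOutput r ε)ᶜ.indicator 1) ≤
      ENNReal.ofReal (1 / 20) := by
  set w' : Option (Fin (k + 1) → Fin n) → ℝ := fun a => (p a).toReal with hw'
  have hw'0 : ∀ a, 0 ≤ w' a := fun a => ENNReal.toReal_nonneg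
  have hsome : ∀ v, w' (some v) = w v := fun v => by
    simp only [hw', hp, ENNReal.toReal_ofReal (hw0 v)]
  have hofReal : ∀ a, p a = ENNReal.ofReal (w' a) := fun a =>
    (ENNReal.ofReal_toReal (p.apply_ne_top a)).symm
  have hw'1 : ∑ a, w' a = 1 := by
    have h := p.tsum_coe
    rw [tsum_fintype] at h
    simp only [hw']
    rw [← ENNReal.toReal_sum fun a _ => p.apply_ne_top a, h, ENNReal.toReal_one]
  have key := sampleExpect_bad_le (w := w') (s := s) (b := b) (r := r) (ε := ε) hw'0 hw'1
    (fun v : Fin (k + 1) → Fin n => decide (v (Fin.last k) = v 0)) hb hε hbε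
    (by simpa only [hsome] using hs) (by
      simp only [hsome]
      rw [Finset.sum_filter] at hr
      simpa using hr)
  refine le_trans (le_of_eq ?_) (ENNReal.ofReal_le_ofReal key)
  rw [expect_map, expect_fintype, sampleExpect, ENNReal.ofReal_sum_of_nonneg
    fun v _ => mul_nonneg (Finset.prod_nonneg fun i _ => hw'0 _) (ind_nonneg _)]
  refine Finset.sum_congr rfl fun v _ => ?_
  rw [ENNReal.ofReal_mul (Finset.prod_nonneg fun i _ => hw'0 _),
    ENNReal.ofReal_prod_of_nonneg fun i _ => hw'0 _, indep_apply]
  simp only [← hofReal]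
  congr 1
  by_cases h : outputOf b v ∈ (goodOutput r ε)ᶜ
  · rw [Function.comp_apply, Set.indicator_of_mem h, ind_of ((outputOf_notMem_iff v).1 h)]
    simp
  · rw [Function.comp_apply, Set.indicator_of_notMem h,
      ind_of_not fun h' => h ((outputOf_notMem_iff v).2 h'), ENNReal.ofReal_zero]

end Output

end RandomWalkStream

namespace RandomWalkStream

/-! ### The failure probability -/

section Failure

variable {n k : ℕ}

/-- If P or Q deviates by more than t = (ε/10)μ, the right side is at least 1 and nothing is to be
shown. Otherwise P ≥ (19/20)μ, so sP ≥ 95b and |r - Q/P| ≤ 2t/P ≤ ε/2, and the sampling bound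
applies. With the Chebyshev step built into the bound, it can be averaged over the labels directly.
-/
theorem walkDist_concentrated [NeZero n] {η ε r : ℝ} (hη : 0 < η) (hε : 0 < ε) (hε2 : ε < 1 / 2)
    {σ : List (Sym2 (Fin n))} {E : Finset (Sym2 (Fin n))} {c : Fin k → ℕ}
    {ℓ : Sym2 (Fin n) → Option (Fin k)} {b s : ℕ} (hb : 1 ≤ b) (hbε : 160 ≤ b * ε ^ 2)
    (hs : (b : ℝ) * 100 * (η ^ k)⁻¹ * (k ! : ℝ) ≤ s) (hr0 : 0 ≤ r) (hr1 : r ≤ 1)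
    (hσ : σ.Nodup) (hE : σ.toFinset = E) (hc : ∑ j, c j ≤ σ.length)
    (hℓ : ∀ e, ℓ e ≠ none → e ∈ E) (hlab : labelSeq σ.length c = σ.map ℓ) :
    expect ((indep fun _ : Fin s => walkDist n k η c σ).map (outputOf b))
        ((goodOutput r ε)ᶜ.indicator 1) ≤
      ENNReal.ofReal (1 / 20 + 1 / (ε / 10 * (η ^ k / (k ! : ℝ))) ^ 2 *
        ((∑ v, walkMass η E ℓ v - η ^ k / (k ! : ℝ)) ^ 2 +
          (∑ v ∈ Finset.univ.filter (fun v : Fin (k + 1) → Fin n => v (Fin.last k) = v 0),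
            walkMass η E ℓ v - η ^ k / (k ! : ℝ) * r) ^ 2)) := by
  set μ : ℝ := η ^ k / (k ! : ℝ) with hμ
  set P : ℝ := ∑ v, walkMass η E ℓ v with hP
  set Q : ℝ := ∑ v ∈ Finset.univ.filter
    (fun v : Fin (k + 1) → Fin n => v (Fin.last k) = v 0), walkMass η E ℓ v with hQ
  have hμ0 : 0 < μ := by positivity
  set t : ℝ := ε / 10 * μ with ht
  have ht0 : 0 < t := by positivity
  have hone : expect ((indep fun _ : Fin s => walkDist n k η c σ).map (outputOf b))
        ((goodOutput r ε)ᶜ.indicator 1) ≤ 1 := by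
    refine (expect_mono fun a => ?_).trans (expect_const _ 1).le
    exact Set.indicator_le_self' (fun _ _ => zero_le_one) a
  have hsplit : ∀ x y : ℝ, t < |x| → 1 ≤ 1 / 20 + 1 / t ^ 2 * (x ^ 2 + y ^ 2) := by
    intro x y hx
    have h1 : t ^ 2 ≤ x ^ 2 := by
      rw [← sq_abs x]
      exact pow_le_pow_left₀ ht0.le hx.le 2
    have h2 : 1 ≤ 1 / t ^ 2 * (x ^ 2 + y ^ 2) := by
      rw [one_div, ← div_eq_inv_mul, one_le_div (by positivity)]
      nlinarith [sq_nonneg y]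
    linarith
  by_cases hPt : |P - μ| ≤ t
  swap
  · refine hone.trans ?_
    rw [ENNReal.one_le_ofReal]
    exact hsplit _ _ (not_le.1 hPt)
  by_cases hQt : |Q - μ * r| ≤ t
  swap
  · refine hone.trans ?_
    rw [ENNReal.one_le_ofReal, add_comm (_ ^ 2)]
    exact hsplit _ _ (not_le.1 hQt)
  have hP1 : μ * (19 / 20) ≤ P := by
    have h1 := (abs_le.1 hPt).1
    have h2 : t ≤ μ / 20 := by
      rw [ht]
      nlinarith
    linarith
  have hP0 : 0 < P := by linarith
  refine (expect_output_bad_le (walkDist n k η c σ) (fun v => walkMass_nonneg hη.le)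
    (fun v => walkDist_apply_some hη hσ hE hℓ hc hlab v) hb hε hbε ?_ ?_).trans
      (ENNReal.ofReal_le_ofReal (le_add_of_nonneg_right (by positivity)))
  · rw [← hP]
    have h1 : (b : ℝ) * 100 * (η ^ k)⁻¹ * (k ! : ℝ) * μ = b * 100 := by
      rw [hμ]
      field_simp
    have h2 := mul_le_mul_of_nonneg_right hs hP0.le
    have h3 : (b : ℝ) * 100 * (η ^ k)⁻¹ * (k ! : ℝ) * (μ * (19 / 20)) ≤
        (b : ℝ) * 100 * (η ^ k)⁻¹ * (k ! : ℝ) * P := by gcongr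
    have h4 : (0 : ℝ) ≤ b := Nat.cast_nonneg b
    nlinarith
  · rw [← hP, ← hQ]
    have h1 : r - Q / P = (r * (P - μ) - (Q - μ * r)) / P := by
      field_simp
      ring
    rw [h1, abs_div, abs_of_pos hP0, div_le_iff₀ hP0]
    have h2 : |r * (P - μ)| ≤ t := by
      rw [abs_mul, abs_of_nonneg hr0]
      exact (mul_le_of_le_one_left (abs_nonneg _) hr1).trans hPt
    have h3 := abs_sub (r * (P - μ)) (Q - μ * r)
    have h4 : 2 * t ≤ ε / 2 * P := by
      rw [ht]
      nlinarith
    linarith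

theorem sum_labels_eq {η : ℝ} {E : Finset (Sym2 (Fin n))} (h0 : 0 ≤ η) (h1 : k * η ≤ 1)
    {F : (Sym2 (Fin n) → Option (Fin k)) → ℝ} (hF : ∀ ℓ, 0 ≤ F ℓ) :
    ∑ ℓ : E → Option (Fin k), (∏ e, ENNReal.ofReal (labelWeight η (ℓ e))) *
      ENNReal.ofReal (F (extendLabels ℓ)) = ENNReal.ofReal (labelExpect η E F) := by
  have h : ∀ ℓ : E → Option (Fin k), 0 ≤ ∏ e, labelWeight η (ℓ e) := fun ℓ =>
    Finset.prod_nonneg fun e _ => labelWeight_nonneg h0 h1 (ℓ e)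
  rw [labelExpect, ENNReal.ofReal_sum_of_nonneg fun ℓ _ => mul_nonneg (h ℓ) (hF _)]
  refine Finset.sum_congr rfl fun ℓ _ => ?_
  rw [ENNReal.ofReal_mul (h ℓ), ENNReal.ofReal_prod_of_nonneg
    fun e _ => labelWeight_nonneg h0 h1 (ℓ e)]

theorem labelExpect_one [NeZero k] {η : ℝ} {E : Finset (Sym2 (Fin n))} :
    labelExpect η E (fun _ : Sym2 (Fin n) → Option (Fin k) => (1 : ℝ)) = 1 := by
  have h := labelExpect_fits (η := η) (Finset.empty_subset E) (fun _ => (0 : Fin k))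
  simpa [FitsOn, ind] using h

theorem returnProb_mem_Icc [NeZero n] (G : SimpleGraph (Fin n)) [DecidableRel G.Adj]
    (hdeg : ∀ v, 0 < G.degree v) (k : ℕ) : 0 ≤ returnProb G k ∧ returnProb G k ≤ 1 := by
  rw [returnProb_eq_sum]
  refine ⟨Finset.sum_nonneg fun v _ => walkWeight_nonneg G v, ?_⟩
  rw [← sum_walkWeight G hdeg k]
  exact Finset.sum_le_sum_of_subset_of_nonneg (Finset.subset_univ _)
    fun v _ _ => walkWeight_nonneg G v

/-- The success probability of the algorithm, if the relative variance is small. -/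
theorem success_of_variance_le [NeZero n] [NeZero k] (G : SimpleGraph (Fin n))
    [DecidableRel G.Adj] (hdeg : ∀ v, 0 < G.degree v) {ε C D : ℝ} (hε : 0 < ε)
    (hε2 : ε < 1 / 2) (hD : 160 ≤ D) {η : ℝ} (hηdef : stepFraction C ε k = η) (hη : 0 < η)
    (h1 : k * η ≤ 1) (hsmall : 2 ^ (2 * k) * 4 * (k * η) ≤ 1)
    (hvar : 8 * 4 ^ (2 * k) * (k * η) + 4 * k * (k * η) +
        (1 + 8 * 4 ^ (2 * k) * (k * η)) * ((((k : ℝ) + 1) ^ (2 * k) / η ^ k) *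
          ((2 * (k : ℝ) ^ 2 + ((k : ℝ) + 1) ^ 2 / η) / n)) ≤ ε ^ 2 / 4000) :
    9 / 10 ≤ ((randomStream G).bind
      (approxRP n G.edgeFinset.card k ε C D).run).toOuterMeasure
        {r | ∃ x : ℝ, r = some x ∧ |returnProb G k - x| ≤ ε} := by
  obtain ⟨hr0, hr1⟩ := returnProb_mem_Icc G hdeg k
  set r := returnProb G k with hr
  set b := numWalks D ε with hb
  have hbD : D / ε ^ 2 ≤ b := Nat.le_ceil _
  have hbε : 160 ≤ (b : ℝ) * ε ^ 2 := by
    rw [div_le_iff₀ (by positivity)] at hbD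
    linarith
  have hb1 : 1 ≤ b := by
    rw [Nat.one_le_iff_ne_zero]
    intro h
    rw [h] at hbε
    norm_num at hbε
  refine le_toOuterMeasure_of_compl (b := ENNReal.ofReal (1 / 10)) _ _ ?_ ENNReal.ofReal_ne_top ?_
  · have h9 : (9 / 10 : ℝ≥0∞) = ENNReal.ofReal (9 / 10) := by
      rw [ENNReal.ofReal_div_of_pos (by norm_num)]
      norm_num
    rw [h9, ← ENNReal.ofReal_add (by norm_num) (by norm_num)]
    norm_num
  set μ : ℝ := η ^ k / (k ! : ℝ) with hμ
  have hμ0 : 0 < μ := by positivity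
  set closed := Finset.univ.filter (fun v : Fin (k + 1) → Fin n => v (Fin.last k) = v 0)
  set F : (Sym2 (Fin n) → Option (Fin k)) → ℝ := fun ℓ =>
    1 / 20 + 1 / (ε / 10 * μ) ^ 2 * ((∑ v, walkMass η G.edgeFinset ℓ v - μ) ^ 2 +
      (∑ v ∈ closed, walkMass η G.edgeFinset ℓ v - μ * r) ^ 2) with hF
  have hrun : ∀ σ, (approxRP n G.edgeFinset.card k ε C D).run σ =
      (blockSizes k η G.edgeFinset.card).bind fun c =>
        (indep fun _ : Fin (numStarts C ε k b) => walkDist n k η c σ).map (outputOf b) := by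
    intro σ
    rw [approxRP_run, hηdef]
  rw [toOuterMeasure_eq_expect, expect_bind]
  simp only [hrun, expect_bind]
  have hs : (b : ℝ) * 100 * (η ^ k)⁻¹ * (k ! : ℝ) ≤ numStarts C ε k b := by
    rw [← hηdef]
    exact Nat.le_ceil _
  refine (expect_stream_le G hη h1 _ (fun ℓ => ENNReal.ofReal (F ℓ))
    fun σ c ℓ hσ hE hc hℓ hlab => walkDist_concentrated (E := G.edgeFinset) hη hε hε2 hb1 hbε hs
      hr0 hr1 hσ hE hc hℓ hlab).trans ?_
  rw [sum_labels_eq hη.le h1 fun ℓ => by simp only [hF]; positivity]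
  refine ENNReal.ofReal_le_ofReal ?_
  set Δ : ℝ := 8 * 4 ^ (2 * k) * (k * η) + 4 * k * (k * η) +
        (1 + 8 * 4 ^ (2 * k) * (k * η)) * ((((k : ℝ) + 1) ^ (2 * k) / η ^ k) *
          ((2 * (k : ℝ) ^ 2 + ((k : ℝ) + 1) ^ 2 / η) / n)) with hΔ
  have hA := labelExpect_sq_le G hdeg hη h1 hsmall Finset.univ
  have hB := labelExpect_sq_le G hdeg hη h1 hsmall closed
  rw [sum_walkWeight G hdeg, mul_one] at hA
  rw [← returnProb_eq_sum] at hB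
  have hF' : F = fun ℓ => 1 / 20 * 1 + 1 / (ε / 10 * μ) ^ 2 *
      ((∑ v, walkMass η G.edgeFinset ℓ v - μ) ^ 2 +
      (∑ v ∈ closed, walkMass η G.edgeFinset ℓ v - μ * r) ^ 2) := by
    simp only [hF, mul_one]
  rw [hF', labelExpect_add, labelExpect_const_mul, labelExpect_const_mul, labelExpect_add,
    labelExpect_one]
  -- The tolerance ε/10 and the two sets of walks give 2 · 100 Δ/ε², which is at most 1/20 for Δ ≤
  -- ε²/4000.
  calc _ ≤ 1 / 20 * 1 + 1 / (ε / 10 * μ) ^ 2 * (μ ^ 2 * Δ + μ ^ 2 * Δ) := by gcongr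
    _ = 1 / 20 + 200 * Δ / ε ^ 2 := by
        field_simp
        ring
    _ ≤ 1 / 20 + 200 * (ε ^ 2 / 4000) / ε ^ 2 := by gcongr
    _ = 1 / 10 := by
        field_simp
        norm_num

end Failure

end RandomWalkStream

namespace RandomWalkStream

/-! ### The choice of the constants -/

section Constants

theorem stepFraction_eq_exp {C ε : ℝ} (hε : 0 < ε) (k : ℕ) :
    stepFraction C ε k = Real.exp (-(8 * Real.log (1 / ε) + C * k * Real.log 2)) := by
  rw [stepFraction, Real.rpow_def_of_pos (by norm_num), neg_add, Real.exp_add]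
  congr 1
  · rw [one_div, Real.log_inv, mul_neg, neg_neg]
    have h := Real.exp_nat_mul (Real.log ε) 8
    rw [Real.exp_log hε] at h
    rw [← h]
    norm_num
  · ring_nf

theorem stepFraction_pos {C ε : ℝ} (hε : 0 < ε) (k : ℕ) : 0 < stepFraction C ε k := by
  rw [stepFraction_eq_exp hε]
  exact Real.exp_pos _

theorem stepFraction_le {C ε : ℝ} (hC : 30 ≤ C) (hε : 0 < ε) (hε2 : ε < 1 / 2) (k : ℕ) :
    stepFraction C ε k ≤ ε ^ 2 * (1 / 2) ^ (30 * k) := by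
  rw [stepFraction]
  have h1 : ε ^ 8 ≤ ε ^ 2 := pow_le_pow_of_le_one hε.le (by linarith) (by norm_num)
  have h2 : (2 : ℝ) ^ (-(C * k)) ≤ (1 / 2) ^ (30 * k) := by
    rw [one_div, inv_pow, ← Real.rpow_natCast, ← Real.rpow_neg (by norm_num)]
    refine Real.rpow_le_rpow_of_exponent_le (by norm_num) ?_
    push_cast
    have : (30 : ℝ) * k ≤ C * k := by gcongr
    linarith
  gcongr

/-- C ≥ 30 supplies 2^(-30k). The factors 4^(2k) and k use up at most five powers 2^k, and 2^(-25k)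
≤ 2^(-25) is left. -/
theorem four_pow_mul_stepFraction_le {C ε : ℝ} (hC : 30 ≤ C) (hε : 0 < ε) (hε2 : ε < 1 / 2)
    {k : ℕ} (hk : 1 ≤ k) :
    4 ^ (2 * k) * (k * stepFraction C ε k) ≤ ε ^ 2 * (1 / 2) ^ 25 ∧
      k * (k * stepFraction C ε k) ≤ ε ^ 2 * (1 / 2) ^ 25 := by
  have h := stepFraction_le hC hε hε2 k
  have hk2 : (k : ℝ) ≤ 2 ^ k := by exact_mod_cast Nat.lt_two_pow_self.le
  have h0 := (stepFraction_pos (C := C) hε k).le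
  have h25 : ((1 : ℝ) / 2) ^ (25 * k) ≤ (1 / 2) ^ 25 :=
    pow_le_pow_of_le_one (by norm_num) (by norm_num) (by omega)
  have h30 : ((1 : ℝ) / 2) ^ (30 * k) = (1 / 2) ^ (25 * k) * ((1 / 2) ^ k) ^ 5 := by
    rw [← pow_mul, ← pow_add]
    congr 1
    omega
  have hz : (2 : ℝ) ^ k * (1 / 2) ^ k = 1 := by
    rw [← mul_pow]
    norm_num
  set z : ℝ := (1 / 2) ^ k with hzdef
  have hz0 : 0 < z := by positivity
  have hz1 : z ≤ 1 := pow_le_one₀ (by norm_num) (by norm_num)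
  have h2 : (0 : ℝ) < 2 ^ k := by positivity
  constructor
  · have h4 : (4 : ℝ) ^ (2 * k) = (2 ^ k) ^ 4 := by
      rw [← pow_mul, mul_comm k 4, show (4 : ℝ) = 2 ^ 2 by norm_num, ← pow_mul]
      congr 1
      omega
    calc 4 ^ (2 * k) * (k * stepFraction C ε k)
        ≤ (2 ^ k) ^ 4 * (2 ^ k * (ε ^ 2 * ((1 / 2) ^ (25 * k) * z ^ 5))) := by
          rw [h4, ← h30]
          gcongr
      _ = ε ^ 2 * (1 / 2) ^ (25 * k) * (2 ^ k * z) ^ 5 := by ring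
      _ ≤ ε ^ 2 * (1 / 2) ^ 25 := by
          rw [hz, one_pow, mul_one]
          gcongr
  · calc k * (k * stepFraction C ε k)
        ≤ 2 ^ k * (2 ^ k * (ε ^ 2 * ((1 / 2) ^ (25 * k) * z ^ 5))) := by
          rw [← h30]
          gcongr
      _ = ε ^ 2 * (1 / 2) ^ (25 * k) * ((2 ^ k * z) ^ 2 * z ^ 3) := by ring
      _ ≤ ε ^ 2 * (1 / 2) ^ 25 := by
          rw [hz, one_pow, one_mul]
          have : z ^ 3 ≤ 1 := pow_le_one₀ hz0.le hz1
          calc _ ≤ ε ^ 2 * (1 / 2) ^ 25 * 1 := by gcongr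
            _ = _ := mul_one _

theorem two_pow_eq_exp (m : ℕ) : (2 : ℝ) ^ m = Real.exp (m * Real.log 2) := by
  rw [Real.exp_nat_mul, Real.exp_log (by norm_num)]

/-- All factors are written as exponentials in a = log(1/ε) and L = log 2. The factor η^(-k - 1)
costs (k + 1)(8a + CkL), the polynomial factors and the target cost 2a and O(k²)L, and 1/n gains log
n. The coefficients 18 and 20 + 2C of `h` cover these costs because k ≥ 1. -/
theorem interference_le {C ε : ℝ} (hC : 0 ≤ C) (hε : 0 < ε) (hε2 : ε < 1 / 2) {k : ℕ}
    (hk : 1 ≤ k) {n : ℝ} (hn : 0 < n)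
    (h : 18 * (k * Real.log (1 / ε)) + (20 + 2 * C) * (k ^ 2 * Real.log 2) ≤ Real.log n) :
    (((k : ℝ) + 1) ^ (2 * k) / stepFraction C ε k ^ k) *
      ((2 * (k : ℝ) ^ 2 + ((k : ℝ) + 1) ^ 2 / stepFraction C ε k) / n) ≤
        ε ^ 2 * (1 / 2) ^ 14 := by
  set a := Real.log (1 / ε) with ha
  set L := Real.log 2 with hL
  have hL0 : 0 < L := Real.log_pos (by norm_num)
  have ha0 : 0 < a := Real.log_pos (by rw [lt_div_iff₀ hε]; linarith)
  have hk1 : (1 : ℝ) ≤ k := by exact_mod_cast hk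
  have hε1 : ε = Real.exp (-a) := by
    rw [ha, one_div, Real.log_inv, neg_neg, Real.exp_log hε]
  set η := stepFraction C ε k with hη
  have hηe : η = Real.exp (-(8 * a + C * k * L)) := stepFraction_eq_exp hε k
  have hη0 : 0 < η := stepFraction_pos hε k
  have hη1 : η ≤ 1 := by
    rw [hηe, Real.exp_le_one_iff]
    have : 0 ≤ C * k * L := by positivity
    linarith
  have hk2 : (k : ℝ) + 1 ≤ 2 ^ k := by exact_mod_cast Nat.lt_two_pow_self
  have h1 : ((k : ℝ) + 1) ^ (2 * k) ≤ Real.exp (2 * k ^ 2 * L) := by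
    calc ((k : ℝ) + 1) ^ (2 * k) ≤ (2 ^ k) ^ (2 * k) := by gcongr
      _ = 2 ^ (2 * k ^ 2) := by rw [← pow_mul]; ring_nf
      _ = _ := by rw [two_pow_eq_exp]; push_cast; rfl
  have h2 : 2 * (k : ℝ) ^ 2 + ((k : ℝ) + 1) ^ 2 / η ≤ Real.exp ((2 * k + 2) * L) / η := by
    rw [le_div_iff₀ hη0, add_mul, div_mul_cancel₀ _ hη0.ne']
    have h3 : 2 * (k : ℝ) ^ 2 * η ≤ 2 * (k : ℝ) ^ 2 * 1 := by gcongr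
    have h4 : ((k : ℝ) + 1) ^ 2 ≤ (2 ^ k) ^ 2 := by gcongr
    have h5 : Real.exp ((2 * k + 2) * L) = 4 * (2 ^ k) ^ 2 := by
      have := two_pow_eq_exp (2 * k + 2)
      push_cast at this
      rw [← hL] at this
      rw [← this, ← pow_mul, pow_add, mul_comm k 2]
      ring
    rw [h5]
    nlinarith
  have h3 : (η ^ k)⁻¹ = Real.exp (k * (8 * a + C * k * L)) := by
    rw [hηe, ← Real.exp_nat_mul, ← Real.exp_neg]
    ring_nf
  have h4 : η⁻¹ = Real.exp (8 * a + C * k * L) := by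
    rw [hηe, ← Real.exp_neg, neg_neg]
  have h5 : n⁻¹ = Real.exp (-Real.log n) := by rw [Real.exp_neg, Real.exp_log hn]
  have h6 : ε ^ 2 * (1 / 2) ^ 14 = Real.exp (-(2 * a) - 14 * L) := by
    have := two_pow_eq_exp 14
    rw [← hL] at this
    rw [one_div, inv_pow, this, hε1, ← Real.exp_nat_mul, ← Real.exp_neg, ← Real.exp_add]
    push_cast
    ring_nf
  calc _ ≤ (Real.exp (2 * k ^ 2 * L) / η ^ k) * ((Real.exp ((2 * k + 2) * L) / η) / n) := by
        gcongr
    _ = Real.exp (2 * k ^ 2 * L + k * (8 * a + C * k * L) + ((2 * k + 2) * L) +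
          (8 * a + C * k * L) + -Real.log n) := by
        rw [div_eq_mul_inv, div_eq_mul_inv, div_eq_mul_inv, h3, h4, h5]
        simp only [Real.exp_add]
        ring
    _ ≤ _ := by
        rw [h6, Real.exp_le_exp]
        have e1 : L * (2 * k ^ 2 + 2 * k + 16) ≤ L * (20 * k ^ 2) :=
          mul_le_mul_of_nonneg_left (by nlinarith) hL0.le
        have e2 : a * (8 * k + 8 + 2) ≤ a * (18 * k) :=
          mul_le_mul_of_nonneg_left (by linarith) ha0.le
        have e3 : C * L * (k ^ 2 + k) ≤ C * L * (2 * k ^ 2) :=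
          mul_le_mul_of_nonneg_left (by nlinarith) (by positivity)
        nlinarith

/-- The three terms are at most 8 · 2^(-25), 4 · 2^(-25) and 2 · 2^(-14) times ε², which together
stay below ε²/4000. -/
theorem variance_le {C ε : ℝ} (hC : 30 ≤ C) (hε : 0 < ε) (hε2 : ε < 1 / 2) {k : ℕ}
    (hk : 1 ≤ k) {n : ℝ} (hn : 0 < n)
    (h : 18 * (k * Real.log (1 / ε)) + (20 + 2 * C) * (k ^ 2 * Real.log 2) ≤ Real.log n) :
    8 * 4 ^ (2 * k) * (k * stepFraction C ε k) + 4 * k * (k * stepFraction C ε k) +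
        (1 + 8 * 4 ^ (2 * k) * (k * stepFraction C ε k)) *
          ((((k : ℝ) + 1) ^ (2 * k) / stepFraction C ε k ^ k) *
          ((2 * (k : ℝ) ^ 2 + ((k : ℝ) + 1) ^ 2 / stepFraction C ε k) / n)) ≤ ε ^ 2 / 4000 := by
  obtain ⟨h1, h2⟩ := four_pow_mul_stepFraction_le hC hε hε2 hk
  have h3 := interference_le (by linarith) hε hε2 hk hn h
  have hη0 := stepFraction_pos (C := C) hε k
  set B := (((k : ℝ) + 1) ^ (2 * k) / stepFraction C ε k ^ k) *
          ((2 * (k : ℝ) ^ 2 + ((k : ℝ) + 1) ^ 2 / stepFraction C ε k) / n) with hB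
  have hB0 : 0 ≤ B := by positivity
  have hε3 : 0 < ε ^ 2 := by positivity
  have hε4 : ε ^ 2 ≤ 1 := pow_le_one₀ hε.le (by linarith)
  have h4 : 1 + 8 * 4 ^ (2 * k) * (k * stepFraction C ε k) ≤ 2 := by
    norm_num at h1 ⊢
    linarith
  have h5 : (1 + 8 * 4 ^ (2 * k) * (k * stepFraction C ε k)) * B ≤ 2 * (ε ^ 2 * (1 / 2) ^ 14) :=
    mul_le_mul h4 h3 hB0 (by norm_num)
  norm_num at h1 h2 h5 ⊢
  nlinarith

theorem smallness {C ε : ℝ} (hC : 30 ≤ C) (hε : 0 < ε) (hε2 : ε < 1 / 2) {k : ℕ}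
    (hk : 1 ≤ k) : k * stepFraction C ε k ≤ 1 ∧
      2 ^ (2 * k) * 4 * (k * stepFraction C ε k) ≤ 1 := by
  obtain ⟨h1, -⟩ := four_pow_mul_stepFraction_le hC hε hε2 hk
  have hη0 := stepFraction_pos (C := C) hε k
  have hε4 : ε ^ 2 ≤ 1 := pow_le_one₀ hε.le (by linarith)
  have h2 : (2 : ℝ) ^ (2 * k) ≤ 4 ^ (2 * k) := pow_le_pow_left₀ (by norm_num) (by norm_num) _
  have h3 : (1 : ℝ) ≤ 2 ^ (2 * k) := one_le_pow₀ (by norm_num)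
  have h4 : (0 : ℝ) ≤ k * stepFraction C ε k := by positivity
  have h5 : 2 ^ (2 * k) * (k * stepFraction C ε k) ≤ 4 ^ (2 * k) * (k * stepFraction C ε k) := by
    gcongr
  norm_num at h1
  have h6 : 1 * (k * stepFraction C ε k) ≤ 2 ^ (2 * k) * (k * stepFraction C ε k) := by gcongr
  constructor <;> linarith

end Constants

/-! ### Space -/

section Space

variable {n k s : ℕ}

/-- All numbers in the memory of a walker are at most `t`. -/
def Walker.CountsAtMost (w : Walker n k) (t : ℕ) : Prop := ∀ j, w.cnt j ≤ t ∧ w.tail j ≤ t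

theorem Walker.countsAtMost_stepLabel {w u : Walker n k} {t : ℕ} (hw : w.CountsAtMost t)
    {z : Option (Fin k) × Sym2 (Fin n)} (hu : u ∈ (w.stepLabel z).support) :
    u.CountsAtMost (t + 1) := by
  intro j
  have hj := hw j
  unfold Walker.stepLabel at hu
  cases hz : z.1 with
  | some i =>
    rw [hz] at hu
    simp only [Walker.stepBlock] at hu
    split_ifs at hu
    · rw [PMF.mem_support_map_iff] at hu
      obtain ⟨i', -, rfl⟩ := hu
      refine ⟨?_, hj.2.trans (Nat.le_succ t)⟩
      by_cases hij : j = i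
      · subst hij
        simp only [Function.update_self]
        exact Nat.succ_le_succ hj.1
      · simp only [Function.update_of_ne hij]
        exact hj.1.trans (Nat.le_succ t)
    · rw [PMF.mem_support_pure_iff] at hu
      subst hu
      exact ⟨hj.1.trans (Nat.le_succ t), hj.2.trans (Nat.le_succ t)⟩
  | none =>
    rw [hz] at hu
    simp only at hu
    rw [PMF.mem_support_pure_iff] at hu
    subst hu
    refine ⟨hj.1.trans (Nat.le_succ t), ?_⟩
    simp only [Walker.stepTail]
    split_ifs
    · exact Nat.succ_le_succ hj.2
    · exact hj.2.trans (Nat.le_succ t)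

theorem decIn_le (js : List (Fin k)) (left : Fin k → ℕ) (j : Fin k) :
    decIn js left j ≤ left j := by
  rw [decIn]
  cases nextIn js left with
  | none => exact le_rfl
  | some i =>
    by_cases hij : j = i
    · subst hij
      simp
    · exact (Function.update_of_ne hij _ _).le

/-- The numbers in the memory stay small. -/
theorem memory_bounded {m : ℕ} {σ : List (Sym2 (Fin n))} {x y : Memory n k s} {t : ℕ}
    (hleft : ∀ j, x.left j ≤ m) (hw : ∀ i, (x.walkers i).CountsAtMost t)
    (hy : y ∈ (runList Memory.step σ x).support) :
    (∀ j, y.left j ≤ m) ∧ ∀ i, (y.walkers i).CountsAtMost (t + σ.length) := by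
  induction σ generalizing x t with
  | nil =>
    rw [runList, PMF.mem_support_pure_iff] at hy
    subst hy
    exact ⟨hleft, hw⟩
  | cons e σ ih =>
    rw [runList, PMF.mem_support_bind_iff] at hy
    obtain ⟨z, hz, hy⟩ := hy
    obtain ⟨left, ws⟩ := x
    rw [Memory.step_eq, PMF.mem_support_map_iff] at hz
    obtain ⟨ws', hws', rfl⟩ := hz
    have h := ih (t := t + 1) (fun j => (decIn_le _ left j).trans (hleft j))
      (fun i => Walker.countsAtMost_stepLabel (hw i) (mem_support_indep hws' i)) hy
    rw [List.length_cons, Nat.add_comm σ.length, ← Nat.add_assoc]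
    exact h

theorem blockSizes_le {η : ℝ} {m : ℕ} {c : Fin k → ℕ} (hc : c ∈ (blockSizes k η m).support)
    (j : Fin k) : c j ≤ m := by
  induction m generalizing c with
  | zero =>
    rw [blockSizes, PMF.mem_support_pure_iff] at hc
    rw [hc]
  | succ m ih =>
    rw [blockSizes, PMF.mem_support_bind_iff] at hc
    obtain ⟨d, hd, hc⟩ := hc
    rw [PMF.mem_support_map_iff] at hc
    obtain ⟨i, -, rfl⟩ := hc
    have := ih hd
    simp only
    split_ifs <;> omega

theorem Walker.words_lt {w : Walker n k} {t N : ℕ} (hw : w.CountsAtMost t) (ht : t < N)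
    (hn : n < N) (hk : k < N) {a : ℕ} (ha : a ∈ w.words) : a < N := by
  rw [Walker.words, List.mem_cons] at ha
  rcases ha with rfl | ha
  · exact w.root.2.trans hn
  · rw [List.mem_flatten] at ha
    obtain ⟨l, hl, ha⟩ := ha
    rw [List.mem_ofFn] at hl
    obtain ⟨j, rfl⟩ := hl
    have hedge : ∀ e : Option (Sym2 (Fin n)),
        (Walker.edgeWords e).1 < N ∧ (Walker.edgeWords e).2 < N := by
      intro e
      cases e with
      | none => exact ⟨by simp only [Walker.edgeWords]; omega, by simp only [Walker.edgeWords]; omega⟩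
      | some e =>
        have h1 := e.inf.2
        have h2 := e.sup.2
        simp only [Walker.edgeWords]
        omega
    have h1 := (w.tmpl j).2
    have h2 := j.2
    have h3 := hedge (w.res j)
    have h4 := hw j
    simp only [List.mem_cons, List.not_mem_nil, or_false] at ha
    rcases ha with rfl | rfl | rfl | rfl | rfl
    · omega
    · exact h3.1
    · exact h3.2
    · omega
    · omega

theorem Memory.words_length (x : Memory n k s) : x.words.length = k + s * (1 + 5 * k) := by
  simp [Memory.words, List.length_flatten, List.map_ofFn, Function.comp_def, Walker.words_length]

/-- The number of words never changes, so only their size needs an invariant: block counters never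
exceed m, and the counts of a walker grow by at most one per arrival. -/
theorem spaceAtMost_approxRP [NeZero n] {m : ℕ} {ε C D S : ℝ} {σ : List (Sym2 (Fin n))} {N : ℕ}
    (hσ : σ.length ≤ m) (hm : m < N) (hn : n < N) (hk : k < N)
    (hS : ((k + numStarts C ε k (numWalks D ε) * (1 + 5 * k) : ℕ) : ℝ) ≤ S) :
    (approxRP n m k ε C D).SpaceAtMost σ S N := by
  intro τ hτ x hx
  rw [after_approxRP] at hx
  obtain ⟨y, hy, hx⟩ := (PMF.mem_support_bind_iff _ _ _).1 hx
  rw [Memory.start, PMF.mem_support_bind_iff] at hy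
  obtain ⟨c, hc, hy⟩ := hy
  rw [PMF.mem_support_map_iff] at hy
  obtain ⟨ws, hws, rfl⟩ := hy
  have hws0 : ∀ i, (ws i).CountsAtMost 0 := by
    intro i
    have h := mem_support_indep hws i
    rw [PMF.mem_support_bind_iff] at h
    obtain ⟨u, -, h⟩ := h
    rw [PMF.mem_support_map_iff] at h
    obtain ⟨π, -, h⟩ := h
    rw [← h]
    exact fun j => ⟨le_rfl, le_rfl⟩
  have hb := memory_bounded (m := m) (t := 0) (fun j => blockSizes_le hc j) hws0 hx
  have hlen : 0 + τ.length < N := by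
    have := hτ.length_le
    omega
  have hx' : (approxRP n m k ε C D).words x = Memory.words x := rfl
  rw [hx']
  refine ⟨?_, fun a ha => ?_⟩
  · refine le_trans (le_of_eq ?_) hS
    exact congrArg Nat.cast (Memory.words_length x)
  · rcases List.mem_append.1 ha with ha | ha
    · rw [List.mem_ofFn] at ha
      obtain ⟨j, rfl⟩ := ha
      exact (hb.1 j).trans_lt hm
    · rw [List.mem_flatten] at ha
      obtain ⟨l, hl, ha⟩ := ha
      rw [List.mem_ofFn] at hl
      obtain ⟨i, rfl⟩ := hl
      exact Walker.words_lt (hb.2 i) hlen hn hk ha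

/-- The factors b, η^(-k), k! and k are absorbed into powers of 1/ε and of 2. The constant 707 = 101
+ 101 · 6 collects the k block counters, the at most 6k words of each walker, and the rounding of s
from 100 to 101. -/
theorem numberOfWords_le {C D : ℝ} (hD : 0 < D) {ε : ℝ} (hε : 0 < ε)
    (hε2 : ε < 1 / 2) {k : ℕ} (hk : 1 ≤ k) :
    ((k + numStarts C ε k (numWalks D ε) * (1 + 5 * k) : ℕ) : ℝ) ≤
      (1 / ε) ^ ((12 + ⌈C⌉₊ + ⌈707 * (D + 1)⌉₊) * k) *
        2 ^ ((12 + ⌈C⌉₊ + ⌈707 * (D + 1)⌉₊) * k ^ 2) := by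
  set β : ℝ := 1 / ε with hβ
  have hβ2 : 2 ≤ β := by
    rw [hβ, le_div_iff₀ hε]
    linarith
  set C' := ⌈C⌉₊ with hC'
  set D' := ⌈707 * (D + 1)⌉₊ with hD'
  have hk1 : (1 : ℝ) ≤ k := by exact_mod_cast hk
  have hb : (numWalks D ε : ℝ) ≤ (D + 1) * β ^ 2 := by
    have h1 : (numWalks D ε : ℝ) ≤ D / ε ^ 2 + 1 := (Nat.ceil_lt_add_one (by positivity)).le
    have h2 : D / ε ^ 2 = D * β ^ 2 := by
      rw [hβ]
      field_simp
    have h3 : 1 ≤ β ^ 2 := one_le_pow₀ (by linarith)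
    rw [h2] at h1
    linarith
  have hη : (stepFraction C ε k ^ k)⁻¹ ≤ β ^ (8 * k) * 2 ^ (C' * k ^ 2) := by
    have h1 : (stepFraction C ε k)⁻¹ = β ^ 8 * (2 : ℝ) ^ (C * k) := by
      rw [stepFraction, mul_inv, ← Real.rpow_neg (by norm_num), neg_neg, hβ, one_div, inv_pow]
    have h2 : (2 : ℝ) ^ (C * k) ≤ 2 ^ (C' * k) := by
      rw [← Real.rpow_natCast]
      refine Real.rpow_le_rpow_of_exponent_le (by norm_num) ?_
      push_cast
      gcongr
      exact Nat.le_ceil C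
    rw [← inv_pow, h1]
    calc _ ≤ (β ^ 8 * 2 ^ (C' * k)) ^ k := by gcongr
      _ = _ := by
        rw [mul_pow, ← pow_mul, ← pow_mul]
        congr 2
        ring
  have hfac : (k ! : ℝ) ≤ 2 ^ k ^ 2 := by
    have h1 : k ! ≤ (2 ^ k) ^ k :=
      (Nat.factorial_le_pow k).trans (Nat.pow_le_pow_left Nat.lt_two_pow_self.le k)
    rw [← pow_mul, ← sq] at h1
    exact_mod_cast h1
  set T : ℝ := (D + 1) * β ^ 2 * (β ^ (8 * k) * 2 ^ (C' * k ^ 2)) * 2 ^ k ^ 2 with hT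
  have hT1 : 1 ≤ T := by
    have e1 : 1 ≤ (D + 1) * β ^ 2 := one_le_mul_of_one_le_of_one_le (by linarith)
      (one_le_pow₀ (by linarith))
    have e2 : 1 ≤ β ^ (8 * k) * (2 : ℝ) ^ (C' * k ^ 2) := one_le_mul_of_one_le_of_one_le
      (one_le_pow₀ (by linarith)) (one_le_pow₀ (by norm_num))
    exact one_le_mul_of_one_le_of_one_le (one_le_mul_of_one_le_of_one_le e1 e2)
      (one_le_pow₀ (by norm_num))
  have hη0 := stepFraction_pos (C := C) hε k
  have hs : (numStarts C ε k (numWalks D ε) : ℝ) ≤ 101 * T := by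
    have h1 : (numStarts C ε k (numWalks D ε) : ℝ) ≤ (numWalks D ε : ℝ) * 100 *
        (stepFraction C ε k ^ k)⁻¹ * (k ! : ℝ) + 1 := (Nat.ceil_lt_add_one (by positivity)).le
    have h2 : (numWalks D ε : ℝ) * 100 * (stepFraction C ε k ^ k)⁻¹ * (k ! : ℝ) ≤
        ((D + 1) * β ^ 2) * 100 * (β ^ (8 * k) * 2 ^ (C' * k ^ 2)) * 2 ^ k ^ 2 := by gcongr
    have h3 : ((D + 1) * β ^ 2) * 100 * (β ^ (8 * k) * 2 ^ (C' * k ^ 2)) * 2 ^ k ^ 2 =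
        100 * T := by
      rw [hT]
      ring
    linarith
  have hk2 : (k : ℝ) ≤ 2 ^ k := by exact_mod_cast Nat.lt_two_pow_self.le
  have hkk : k ≤ k ^ 2 := by nlinarith
  have hD2 : 707 * (D + 1) ≤ 2 ^ (D' * k ^ 2) := by
    have h1 : 707 * (D + 1) ≤ (D' : ℝ) := Nat.le_ceil _
    have h2 : (D' : ℝ) ≤ 2 ^ D' := by exact_mod_cast Nat.lt_two_pow_self.le
    have h3 : (2 : ℝ) ^ D' ≤ 2 ^ (D' * k ^ 2) :=
      pow_le_pow_right₀ (by norm_num) (Nat.le_mul_of_pos_right _ (by positivity))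
    linarith
  have hβp : β ^ 2 * β ^ (8 * k) ≤ β ^ ((12 + C' + D') * k) := by
    rw [← pow_add]
    refine pow_le_pow_right₀ (by linarith) ?_
    nlinarith [Nat.zero_le (C' * k), Nat.zero_le (D' * k)]
  calc ((k + numStarts C ε k (numWalks D ε) * (1 + 5 * k) : ℕ) : ℝ)
      = k + numStarts C ε k (numWalks D ε) * (1 + 5 * k) := by push_cast; ring
    _ ≤ k * (101 * T) + 101 * T * (6 * k) := by
        have h1 : (k : ℝ) * 1 ≤ k * (101 * T) := by
          gcongr
          linarith
        have h2 : (numStarts C ε k (numWalks D ε) : ℝ) * (1 + 5 * k) ≤ 101 * T * (6 * k) := by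
          gcongr
          linarith
        linarith
    _ = (707 * (D + 1)) * (β ^ 2 * β ^ (8 * k)) * (2 ^ (C' * k ^ 2) * 2 ^ k ^ 2 * k) := by
        rw [hT]
        ring
    _ ≤ 2 ^ (D' * k ^ 2) * β ^ ((12 + C' + D') * k) *
          (2 ^ (C' * k ^ 2) * 2 ^ k ^ 2 * 2 ^ k ^ 2) := by
        have h2k : (k : ℝ) ≤ 2 ^ k ^ 2 :=
          hk2.trans (pow_le_pow_right₀ (by norm_num) hkk)
        gcongr
    _ = β ^ ((12 + C' + D') * k) * 2 ^ (D' * k ^ 2 + (C' * k ^ 2 + k ^ 2 + k ^ 2)) := by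
        rw [pow_add, pow_add, pow_add]
        ring
    _ ≤ _ := by
        have : (2 : ℝ) ^ (D' * k ^ 2 + (C' * k ^ 2 + k ^ 2 + k ^ 2)) ≤
            2 ^ ((12 + C' + D') * k ^ 2) := pow_le_pow_right₀ (by norm_num) (by nlinarith)
        gcongr

theorem length_of_mem_randomStream (G : SimpleGraph (Fin n)) [DecidableRel G.Adj]
    {σ : List (Sym2 (Fin n))} (hσ : σ ∈ (randomStream G).support) :
    σ.length = G.edgeFinset.card := by
  rw [randomStream, PMF.mem_support_map_iff] at hσ
  obtain ⟨o, -, rfl⟩ := hσ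
  rw [List.length_ofFn]

end Space

end RandomWalkStream

/-! ### The main theorem -/

theorem corollary2 :
    ∃ C₀ D₀ : ℝ, 0 < C₀ ∧ 0 < D₀ ∧ ∀ C D : ℝ, C₀ ≤ C → D₀ ≤ D →
    ∃ c' : ℝ, 0 < c' ∧ ∃ A : ℕ,
    ∀ (n : ℕ) [NeZero n] (G : SimpleGraph (Fin n)) [DecidableRel G.Adj],
      (∀ v, 0 < G.degree v) →
      ∀ ε : ℝ, (n : ℝ) ^ (-(1 / 1000 : ℝ)) < ε → ε < 1 / 2 →
      ∀ k : ℕ, 1 ≤ k →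
        (k : ℝ) ≤ min (c' * Real.log n / Real.log (1 / ε)) (Real.sqrt (c' * Real.log n)) →
      -- success probability over the order of the stream and the internal randomness
      9 / 10 ≤ ((RandomWalkStream.randomStream G).bind
          (RandomWalkStream.approxRP n G.edgeFinset.card k ε C D).run).toOuterMeasure
            {r | ∃ x : ℝ, r = some x ∧ |RandomWalkStream.returnProb G k - x| ≤ ε} ∧
      -- space, in words that hold natural numbers below `n ^ 2`
      ∀ σ ∈ (RandomWalkStream.randomStream G).support,
        (RandomWalkStream.approxRP n G.edgeFinset.card k ε C D).SpaceAtMost σ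
          ((1 / ε) ^ (A * k) * 2 ^ (A * k ^ 2)) (n ^ 2) := by
  -- C ≥ 30 makes the powers of 2 in η beat 4^(2k) and k, and D ≥ 160 gives bε² ≥ 160, as the
  -- sampling bound needs.
  refine ⟨30, 160, by norm_num, by norm_num, fun C D hC hD => ?_⟩
  -- 38 + 2C is the sum of the coefficients 18 and 20 + 2C in `interference_le`; both k log(1/ε) and
  -- k² are at most c' log n.
  refine ⟨1 / (38 + 2 * C), by positivity, 12 + ⌈C⌉₊ + ⌈707 * (D + 1)⌉₊, ?_⟩
  intro n _ G _ hdeg ε hnε hε2 k hk hkn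
  have hn0 : (0 : ℝ) < n := by exact_mod_cast NeZero.pos n
  have hε : 0 < ε := (Real.rpow_pos_of_pos hn0 _).trans hnε
  have hk1 : (1 : ℝ) ≤ k := by exact_mod_cast hk
  have : NeZero k := ⟨by omega⟩
  have ha : 0 < Real.log (1 / ε) := Real.log_pos (by rw [lt_div_iff₀ hε]; linarith)
  have hka : k * Real.log (1 / ε) ≤ 1 / (38 + 2 * C) * Real.log n :=
    (le_div_iff₀ ha).1 (hkn.trans (min_le_left _ _))
  have hC0 : 0 < 38 + 2 * C := by linarith
  have hkk : (k : ℝ) ^ 2 ≤ 1 / (38 + 2 * C) * Real.log n := by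
    have h1 := hkn.trans (min_le_right _ _)
    have h0 : 0 ≤ 1 / (38 + 2 * C) * Real.log n := le_trans (by positivity) hka
    rw [← Real.sq_sqrt h0]
    exact pow_le_pow_left₀ (by positivity) h1 2
  have hL1 : Real.log 2 ≤ 1 := by
    have := Real.log_two_lt_d9
    linarith
  have hmain : 18 * (k * Real.log (1 / ε)) + (20 + 2 * C) * (k ^ 2 * Real.log 2) ≤
      Real.log n := by
    have h1 : (k : ℝ) ^ 2 * Real.log 2 ≤ (k : ℝ) ^ 2 * 1 := by gcongr
    have h2 : (20 + 2 * C) * ((k : ℝ) ^ 2 * Real.log 2) ≤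
        (20 + 2 * C) * (1 / (38 + 2 * C) * Real.log n) := by
      refine mul_le_mul_of_nonneg_left ?_ (by linarith)
      linarith
    have h3 : 18 * (1 / (38 + 2 * C) * Real.log n) +
        (20 + 2 * C) * (1 / (38 + 2 * C) * Real.log n) = Real.log n := by
      field_simp
      ring
    linarith
  obtain ⟨h1, h2⟩ := RandomWalkStream.smallness hC hε hε2 hk
  refine ⟨RandomWalkStream.success_of_variance_le G hdeg hε hε2 hD rfl
    (RandomWalkStream.stepFraction_pos hε k) h1 h2
      (RandomWalkStream.variance_le hC hε hε2 hk hn0 hmain), fun σ hσ => ?_⟩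
  have hlogn : (k : ℝ) ≤ Real.log n := by
    have h3 : (k : ℝ) ≤ k ^ 2 := by nlinarith
    have h0 : 0 ≤ 1 / (38 + 2 * C) * Real.log n := le_trans (by positivity) hka
    have h4 : 0 ≤ Real.log n := by
      by_contra h
      have := mul_neg_of_pos_of_neg (by positivity : 0 < 1 / (38 + 2 * C)) (not_le.1 h)
      linarith
    have h5 : 1 / (38 + 2 * C) * Real.log n ≤ 1 * Real.log n := by
      gcongr
      rw [div_le_one hC0]
      linarith
    linarith
  -- Template entries must fit into a word. Together with k ≥ 1 this also gives n ≥ 2, hence n < n².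
  have hkn' : k < n := by
    have h3 : Real.log n ≤ n - 1 := Real.log_le_sub_one_of_pos hn0
    have : (k : ℝ) < n := by linarith
    exact_mod_cast this
  have hn2 : n < n ^ 2 := by nlinarith
  refine RandomWalkStream.spaceAtMost_approxRP
    (RandomWalkStream.length_of_mem_randomStream G hσ).le ?_ hn2 (hkn'.trans hn2)
    (RandomWalkStream.numberOfWords_le (by linarith) hε hε2 hk)
  have h3 := G.card_edgeFinset_le_card_choose_two
  rw [Fintype.card_fin] at h3
  refine h3.trans_lt ?_
  rw [Nat.choose_two_right]
  refine (Nat.div_le_self _ _).trans_lt ?_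
  rw [sq]
  exact Nat.mul_lt_mul_of_pos_left (by omega) (by omega)
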